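/- **Setting.** Let coordinates $(u,r,\theta,\varphi)$ be given for $r>r_0$ over an open piece $\mathcal O$ of null infinity $\mathscr I$ covered by $(u,\theta,\varphi)$, $0<\theta<\pi$, and let the metric be $g^{\mu\nu}=l^\mu n^\nu+n^\mu l^\nu-m^\mu\bar m^\nu-\bar m^\mu m^\nu$ with $l=\partial_r$, $n=\partial_u+U\partial_r+C^i\partial_i$, $m=\xi^i\partial_i$ ($i=\theta,\varphi$). All quantities are polyhomogeneous: $f\sim\sum_{k}\sum_{j\le N_k}f^{k,j}r^{-k}\ln^j r$ with coefficients smooth on $\mathcal O$, the expansion being differentiable term by term and locally uniform. The spacetime is asymptotically flat with finite shear: $U=-\tfrac12+\dots$ (no logarithm at order $0$), $C^i$ starts at order $2$, $\xi^\theta=\frac{1}{\sqrt2\,r}+\dots$, $\xi^\varphi=-\frac{i}{\sqrt2\sin\theta\, r}+\dots$ (no logarithm at order $1$), the shear $\sigma=m^\mu m^\nu\nabla_\nu l_\mu$ starts with $\sigma_{2,0}r^{-2}$ without logarithms, and the Weyl scalars $\Psi_0,\Psi_1,\Psi_2,\Psi_3$ start at orders $4,4,3,2$ in $1/r$ (logarithms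 allowed). Let $\xi=a\,l+b\,n-c\,m-\bar c\,\bar m$ be a Killing field with $a,b$ real and $a,b,c$ polyhomogeneous with leading order $r^{1}$; let $a_{-1},c_{-1}$ be the coefficients of $r$ in $a,c$, and let $b$ also denote its order-$0$ coefficient. For a quantity $X$ of spin weight $s$ put $\eth_1X=\frac{\sin^s\theta}{\sqrt2}(\partial_\theta-\frac{i}{\sin\theta}\partial_\varphi)(\sin^{-s}\theta\,X)$ and $\bar\eth_1X=\frac{\sin^{-s}\theta}{\sqrt2}(\partial_\theta+\frac{i}{\sin\theta}\partial_\varphi)(\sin^{s}\theta\,X)$; $c_{-1}$ has spin weight $-1$. The Killing field is arbitrary; in particular it may be any non-supertranslational one ($c_{-1}\not\equiv0$). **(1) Form of the constraints.** The Killing symmetry implies, on $\mathcal O$, for each $X$ below, with the indicated spin weight $s$ and coefficient $H$, $$b\,\partial_uX-c_{-1}\eth_1X-\bar c_{-1}\bar\eth_1X+HX=Q:$$ * $X=\sigma_{2,0}$: $s=2$, $H=-(a_{-1}+\eth_1c_{-1}-\bar\eth_1\bar c_{-1})$; * $X=\partial_u\sigma_{2,0}$: $s=2$, $H=-2\eth_1c_{-1}$;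 * $X=\Psi_0^{n,j}$ (all $n,j\ge0$): $s=2$, $H=-((n-4)a_{-1}+2\eth_1c_{-1})$; * $X=\Psi_1^{4,j}$: $s=1$, $H=-(2a_{-1}+\eth_1c_{-1})$; * $X=\Psi_2^{3,j}$ and $X=\operatorname{Re}\Psi_2^{3,0}$: $s=0$, $H=-3a_{-1}$. Here $X,H,Q$ are smooth on $\mathcal O$, and $Q$ is given by an expression, the same for all such spacetimes, in quantities calculated at previous orders: $b$; the coefficients of $a,c$ of order at most $n-5$ in $1/r$ and of $U,C^i,\xi^i$ of order at most $n-3$ (in the cases other than $\Psi_0^{n,j}$: at most $-1$ and at most $1$); and the following Weyl coefficients. For $\Psi_0^{n,j}$: $\Psi_0^{k,i}$ with $k<n$, or $k=n$ and $i>j$, and $\Psi_1^{k,i}$ with $k<n$. For $\Psi_1^{4,j}$: $\Psi_1^{k,i}$ with $k<4$, or $k=4$ and $i>j$, $\Psi_0^{k,i}$ with $k\le4$, and $\Psi_2^{k,i}$ with $k\le3$. For $\Psi_2^{3,j}$, and (with $j=0$) for $\operatorname{Re}\Psi_2^{3,0}$: $\Psi_2^{k,i}$ with $k<3$, or $k=3$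 and $i>j$, and $\Psi_3^{k,i}$ with $k\le2$. For $\sigma_{2,0}$ and $\partial_u\sigma_{2,0}$: none. **(2) Characteristics.** The components $(\xi^u,\xi^\theta,\xi^\varphi)$ have, as $r\to\infty$, the smooth limit $$\xi|_{\mathscr I}=\Big(b,\;-\tfrac{1}{\sqrt2}(\bar c_{-1}+c_{-1}),\;-\tfrac{i}{\sqrt2\sin\theta}(\bar c_{-1}-c_{-1})\Big),$$ and $\partial_ub=-a_{-1}$, $\partial_ua_{-1}=0$, $\partial_uc_{-1}=0$ (so locally $b=-a_{-1}u+\alpha(\theta,\varphi)$). For every integer $s$ and every function $H$, the operator $LX=b\partial_uX-c_{-1}\eth_1X-\bar c_{-1}\bar\eth_1X+HX$ on spin weight $s$ equals $\xi|_{\mathscr I}\cdot\partial X+FX$ with $F=H-\frac{s\cot\theta}{\sqrt2}(\bar c_{-1}-c_{-1})$, and its characteristics in $\mathcal O$ are exactly the orbits (integral curves) of $\xi|_{\mathscr I}$. **(3) Splitting of the solution.** Let moreover $H,Q$ be $C^1$ on $\mathcal O$. Let $(t,y)\mapsto\Phi(t,y)$, $y=(y_1,y_2)$, be a $C^1$ map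 on an open set $D$ containing with $(t,y)$ the segment from $(0,y)$ to $(t,y)$, such that $\Phi(0,y)=(u_0,y_1,y_2)$ lies on the initial cut $u=u_0$ and each $t\mapsto\Phi(t,y)$ is a characteristic; assume that $\Phi$ is injective with non-zero Jacobian. Let $f$ be $C^1$ on $\{y:(0,y)\in D\}$. Then $\Phi(D)$ is open, and there are $C^1$ functions $X_h,X_p$ on $\Phi(D)$ with $$X_h(\Phi(t,y))=f(y)\,e^{-\int_0^tF(\Phi(s,y))ds},\qquad X_p(\Phi(t,y))=e^{-\int_0^tF(\Phi(s,y))ds}\int_0^tQ(\Phi(s,y))\,e^{\int_0^sF(\Phi(s',y))ds'}ds,$$ such that $LX_h=0$ and $LX_p=Q$ on $\Phi(D)$, and $X_h=f$, $X_p=0$ on the initial cut (at the points $\Phi(0,y)$). A differentiable function $X$ on $\Phi(D)$ satisfies $LX=Q$ with $X=f$ on the initial cut if and only if $X=X_h+X_p$. This applies in particular to each constraint equation of (1). -/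

import Mathlib

open scoped ContDiff Topology

namespace AFKilling

noncomputable section

/-! ### Coordinates

A spacetime point is `x = (u, r, θ, φ)`, a point of null infinity is `p = (u, θ, φ)`. -/

abbrev ST := Fin 4 → ℝ
abbrev Scri := Fin 3 → ℝ

/-- The point with retarded time `p 0`, affine parameter `r` and angles `p 1`, `p 2`. -/
def lift (p : Scri) (r : ℝ) : ST := ![p 0, r, p 1, p 2]

/-- The generator of null infinity (and its point) obtained by forgetting `r`. -/
def toScri (x : ST) : Scri := ![x 0, x 2, x 3]

/-- The part `r > r₀` of the spacetime that lies over the piece `O` of null infinity. -/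
def nearScri (O : Set Scri) (r₀ : ℝ) : Set ST := {x | r₀ < x 1 ∧ toScri x ∈ O}

/-- Partial derivative in the coordinate direction `i`. -/
def pd {n : ℕ} {E : Type*} [NormedAddCommGroup E] [NormedSpace ℝ E]
    (i : Fin n) (f : (Fin n → ℝ) → E) (x : Fin n → ℝ) : E :=
  fderiv ℝ f x (Pi.single i 1)

/-- Iterated partial derivatives. -/
def pdList {n : ℕ} {E : Type*} [NormedAddCommGroup E] [NormedSpace ℝ E]
    (L : List (Fin n)) (f : (Fin n → ℝ) → E) : (Fin n → ℝ) → E :=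
  L.foldr (fun i g => pd i g) f

/-! ### Polyhomogeneous expansions -/

/-- A family of coefficients: `e k j` is the coefficient of `r⁻ᵏ (ln r)ʲ`. -/
abbrev Coeffs := ℤ → ℕ → Scri → ℂ

/-- `f ~ ∑_{k ≥ k₀} ∑_{j ≤ N k} e k j r⁻ᵏ (ln r)ʲ` near null infinity: the coefficients are smooth on
`O`, and the remainder after the terms of order `K`, with each of its partial derivatives, is
`O(r⁻ᴷ)` locally uniformly on `O`, for every `K` (by the expansion to order `K + 1`, it is then
`O(r⁻ᴷ⁻¹ (ln r)^N(K+1))`). -/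
def HasPolyExpansion (O : Set Scri) (r₀ : ℝ) (f : ST → ℂ) (k₀ : ℤ) (e : Coeffs) : Prop :=
  ContDiffOn ℝ ∞ f (nearScri O r₀) ∧
  (∀ k j, ContDiffOn ℝ ∞ (e k j) O) ∧
  (∀ k j, k < k₀ → ∀ p ∈ O, e k j p = 0) ∧
  ∃ N : ℤ → ℕ, (∀ k j, N k < j → ∀ p ∈ O, e k j p = 0) ∧
    ∀ (K : ℤ) (L : List (Fin 4)) (A : Set Scri), IsCompact A → A ⊆ O →
      ∃ B r₁ : ℝ, ∀ r ≥ r₁, ∀ p ∈ A,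
        ‖pdList L (fun x => f x - ∑ k ∈ Finset.Icc k₀ K, ∑ j ∈ Finset.range (N k + 1),
            e k j (toScri x) * ((x 1 ^ (-k) * Real.log (x 1) ^ j : ℝ) : ℂ)) (lift p r)‖
          ≤ B * r ^ (-K)

/-! ### The null tetrad, the metric and its curvature -/

/-- The tetrad functions: `l = ∂_r`, `n = ∂_u + U ∂_r + C⁰ ∂_θ + C¹ ∂_φ`, `m = ξ⁰ ∂_θ + ξ¹ ∂_φ`. -/
structure Tetrad where
  U : ST → ℝ
  C : Fin 2 → ST → ℝ
  xi : Fin 2 → ST → ℂ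

namespace Tetrad

variable (T : Tetrad)

def l (_T : Tetrad) (_ : ST) : Fin 4 → ℂ := ![0, 1, 0, 0]
def n (x : ST) : Fin 4 → ℂ := ![1, T.U x, T.C 0 x, T.C 1 x]
def m (x : ST) : Fin 4 → ℂ := ![0, 0, T.xi 0 x, T.xi 1 x]
def mbar (x : ST) : Fin 4 → ℂ := fun i => starRingEnd ℂ (T.m x i)

/-- `m` and `m̄` are linearly independent, so that `l, n, m, m̄` is a basis. -/
def NondegenerateAt (x : ST) : Prop := (T.xi 0 x * starRingEnd ℂ (T.xi 1 x)).im ≠ 0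

/-- Contravariant metric `lᵃnᵇ + nᵃlᵇ - mᵃm̄ᵇ - m̄ᵃmᵇ` (a real matrix). -/
def ginv (x : ST) : Matrix (Fin 4) (Fin 4) ℝ := fun i j =>
  (T.l x i * T.n x j + T.n x i * T.l x j - T.m x i * T.mbar x j - T.mbar x i * T.m x j).re

/-- Covariant metric. -/
def g (x : ST) : Matrix (Fin 4) (Fin 4) ℝ := (T.ginv x)⁻¹

/-- Christoffel symbols `Γᵃ_{bc}`. -/
def Gam (a b c : Fin 4) (x : ST) : ℝ :=
  (1 / 2) * ∑ d, T.ginv x a d *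
    (pd b (fun y => T.g y d c) x + pd c (fun y => T.g y d b) x - pd d (fun y => T.g y b c) x)

/-- Riemann tensor `Rᵃ_{bcd} = ∂_c Γᵃ_{db} - ∂_d Γᵃ_{cb} + Γᵃ_{ce} Γᵉ_{db} - Γᵃ_{de} Γᵉ_{cb}`. -/
def RiemUp (a b c d : Fin 4) (x : ST) : ℝ :=
  pd c (T.Gam a d b) x - pd d (T.Gam a c b) x
    + ∑ e, (T.Gam a c e x * T.Gam e d b x - T.Gam a d e x * T.Gam e c b x)

def Riem (a b c d : Fin 4) (x : ST) : ℝ := ∑ e, T.g x a e * T.RiemUp e b c d x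

def Ric (b d : Fin 4) (x : ST) : ℝ := ∑ a, T.RiemUp a b a d x

def scal (x : ST) : ℝ := ∑ b, ∑ d, T.ginv x b d * T.Ric b d x

/-- Weyl tensor `C_{abcd}` in dimension four. -/
def Weyl (a b c d : Fin 4) (x : ST) : ℝ :=
  T.Riem a b c d x
    - (1 / 2) * (T.g x a c * T.Ric b d x - T.g x a d * T.Ric b c x
        - T.g x b c * T.Ric a d x + T.g x b d * T.Ric a c x)
    + (T.scal x / 6) * (T.g x a c * T.g x b d - T.g x a d * T.g x b c)

def weylC (x : ST) (v w y z : Fin 4 → ℂ) : ℂ :=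
  ∑ a, ∑ b, ∑ c, ∑ d, (T.Weyl a b c d x : ℂ) * v a * w b * y c * z d

/-- The Weyl scalars `Ψ₀, Ψ₁, Ψ₂, Ψ₃`. -/
def Psi (i : Fin 4) (x : ST) : ℂ :=
  (![T.weylC x (T.l x) (T.m x) (T.l x) (T.m x),
     T.weylC x (T.l x) (T.n x) (T.l x) (T.m x),
     T.weylC x (T.l x) (T.m x) (T.mbar x) (T.n x),
     T.weylC x (T.l x) (T.n x) (T.mbar x) (T.n x)] : Fin 4 → ℂ) i

/-- Covariant components of `l`. -/
def lcov (x : ST) (a : Fin 4) : ℝ := ∑ b, T.g x a b * (T.l x b).re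

/-- The shear `σ = mᵃ mᵇ ∇_b l_a`. -/
def shear (x : ST) : ℂ :=
  ∑ a, ∑ b, T.m x a * T.m x b *
    ((pd b (fun y => T.lcov y a) x - ∑ c, T.Gam c b a x * T.lcov x c : ℝ) : ℂ)

/-- The vector field `a l + b n - c m - c̄ m̄` (`a`, `b` real). -/
def vec (a b : ST → ℝ) (c : ST → ℂ) (x : ST) (i : Fin 4) : ℝ :=
  (a x * T.l x i + b x * T.n x i - c x * T.m x i - starRingEnd ℂ (c x) * T.mbar x i).re

/-- The Killing equation `𝓛_v g = 0` at `x`. -/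
def KillingAt (v : ST → Fin 4 → ℝ) (x : ST) : Prop :=
  ∀ i j, ∑ k, (v x k * pd k (fun y => T.g y i j) x
    + T.g x k j * pd i (fun y => v y k) x + T.g x i k * pd j (fun y => v y k) x) = 0

end Tetrad

/-! ### Asymptotically flat polyhomogeneous spacetimes with a Killing field -/

/-- A polyhomogeneous asymptotically flat spacetime with finite shear, near a piece `O` of null
infinity covered by the coordinates `(u, θ, φ)`, together with a Killing field
`a l + b n - c m - c̄ m̄` with polyhomogeneous components. The fields ending in `E` are the expansion
coefficients. -/
structure KillingSpacetime where
  O : Set Scri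
  isOpen_O : IsOpen O
  theta_mem : ∀ p ∈ O, 0 < p 1 ∧ p 1 < Real.pi
  r₀ : ℝ
  r₀_pos : 0 < r₀
  T : Tetrad
  nondeg : ∀ x ∈ nearScri O r₀, T.NondegenerateAt x
  UE : Coeffs
  CE : Fin 2 → Coeffs
  xiE : Fin 2 → Coeffs
  sigmaE : Coeffs
  PsiE : Fin 4 → Coeffs
  U_exp : HasPolyExpansion O r₀ (fun x => (T.U x : ℂ)) 0 UE
  C_exp : ∀ i, HasPolyExpansion O r₀ (fun x => (T.C i x : ℂ)) 2 (CE i)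
  xi_exp : ∀ i, HasPolyExpansion O r₀ (T.xi i) 1 (xiE i)
  sigma_exp : HasPolyExpansion O r₀ T.shear 2 sigmaE
  Psi_exp : ∀ i, HasPolyExpansion O r₀ (T.Psi i) ((![4, 4, 3, 2] : Fin 4 → ℤ) i) (PsiE i)
  -- The leading terms: a unit round sphere, `U → -1/2`, and no logarithm in the leading shear.
  U_lead : ∀ p ∈ O, UE 0 0 p = -1 / 2
  U_log : ∀ j, ∀ p ∈ O, UE 0 (j + 1) p = 0
  xi_lead : ∀ p ∈ O, xiE 0 1 0 p = 1 / (Real.sqrt 2 : ℂ) ∧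
    xiE 1 1 0 p = -Complex.I / ((Real.sqrt 2 * Real.sin (p 1) : ℝ) : ℂ)
  xi_log : ∀ i j, ∀ p ∈ O, xiE i 1 (j + 1) p = 0
  sigma_log : ∀ j, ∀ p ∈ O, sigmaE 2 (j + 1) p = 0
  a : ST → ℝ
  b : ST → ℝ
  c : ST → ℂ
  aE : Coeffs
  bE : Coeffs
  cE : Coeffs
  a_exp : HasPolyExpansion O r₀ (fun x => (a x : ℂ)) (-1) aE
  b_exp : HasPolyExpansion O r₀ (fun x => (b x : ℂ)) (-1) bE
  c_exp : HasPolyExpansion O r₀ c (-1) cE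
  killing : ∀ x ∈ nearScri O r₀, T.KillingAt (T.vec a b c) x

/-! ### The operators on null infinity -/

/-- `ð₁` on quantities of spin weight `s`. -/
def eth (s : ℤ) (X : Scri → ℂ) (p : Scri) : ℂ :=
  ((Real.sin (p 1) ^ s / Real.sqrt 2 : ℝ) : ℂ) *
    (pd 1 (fun q => ((Real.sin (q 1) ^ (-s) : ℝ) : ℂ) * X q) p
      - Complex.I / (Real.sin (p 1) : ℂ) *
        pd 2 (fun q => ((Real.sin (q 1) ^ (-s) : ℝ) : ℂ) * X q) p)

/-- `ð̄₁` on quantities of spin weight `s`. -/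
def ethbar (s : ℤ) (X : Scri → ℂ) (p : Scri) : ℂ :=
  ((Real.sin (p 1) ^ (-s) / Real.sqrt 2 : ℝ) : ℂ) *
    (pd 1 (fun q => ((Real.sin (q 1) ^ s : ℝ) : ℂ) * X q) p
      + Complex.I / (Real.sin (p 1) : ℂ) *
        pd 2 (fun q => ((Real.sin (q 1) ^ s : ℝ) : ℂ) * X q) p)

/-- `X ↦ b ∂_u X - c ð₁ X - c̄ ð̄₁ X + H X` on quantities of spin weight `s`. -/
def constraintOp (s : ℤ) (b c H : Scri → ℂ) (X : Scri → ℂ) (p : Scri) : ℂ :=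
  b p * pd 0 X p - c p * eth s X p - starRingEnd ℂ (c p) * ethbar s X p + H p * X p

/-! ### Characteristics and their congruences -/

/-- On `O`, the operator `L` is `X ↦ ∑ vᵏ ∂_k X + F X`. -/
def HasTransportForm (O : Set Scri) (L : (Scri → ℂ) → Scri → ℂ) (v : Scri → Scri)
    (F : Scri → ℂ) : Prop :=
  ∀ (X : Scri → ℂ), ∀ p ∈ O, DifferentiableAt ℝ X p → L X p = fderiv ℝ X p (v p) + F p * X p

/-- `γ`, defined on the interval `J`, is an integral curve in `O` of the vector field `v`. -/
def IsOrbit (O : Set Scri) (v : Scri → Scri) (γ : ℝ → Scri) (J : Set ℝ) : Prop :=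
  J.OrdConnected ∧ ∀ t ∈ J, γ t ∈ O ∧ HasDerivWithinAt γ (v (γ t)) J t

/-- `γ`, defined on the interval `J`, is a characteristic in `O` of the first-order operator `L`. -/
def IsCharacteristic (O : Set Scri) (L : (Scri → ℂ) → Scri → ℂ) (γ : ℝ → Scri) (J : Set ℝ) :
    Prop :=
  ∃ (v : Scri → Scri) (F : Scri → ℂ), HasTransportForm O L v F ∧ IsOrbit O v γ J

/-- The point with angles `y` of the cut `u = u₀`. -/
def cut (u₀ : ℝ) (y : Fin 2 → ℝ) : Scri := ![u₀, y 0, y 1]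

/-- The characteristics of `L` that start on the cut `u = u₀` at `t = 0`: the mapping
`(t, y) ↦ Φ (t, y)`, on an open set `D`, with non-zero Jacobian and invertible onto its image. -/
structure IsCharacteristicMap (O : Set Scri) (L : (Scri → ℂ) → Scri → ℂ) (u₀ : ℝ)
    (D : Set (ℝ × (Fin 2 → ℝ))) (Φ : ℝ × (Fin 2 → ℝ) → Scri) : Prop where
  isOpen : IsOpen D
  segment : ∀ t y, (t, y) ∈ D → ∀ s ∈ Set.uIcc 0 t, (s, y) ∈ D
  init : ∀ y, (0, y) ∈ D → Φ (0, y) = cut u₀ y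
  characteristic : ∀ y, IsCharacteristic O L (fun t => Φ (t, y)) {t | (t, y) ∈ D}
  contDiffOn : ContDiffOn ℝ 1 Φ D
  jacobian : ∀ q ∈ D, Function.Bijective (fderiv ℝ Φ q)
  injOn : Set.InjOn Φ D

/-- `f e^{-∫F}`, the integral being taken along the characteristic from the initial cut. -/
def homogeneousPart (F : Scri → ℂ) (f : (Fin 2 → ℝ) → ℂ) (Φ : ℝ × (Fin 2 → ℝ) → Scri)
    (t : ℝ) (y : Fin 2 → ℝ) : ℂ :=
  f y * Complex.exp (-∫ s in (0 : ℝ)..t, F (Φ (s, y)))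

/-- `e^{-∫F} ∫ Q e^{∫F}`, the integrals being taken along the characteristic from the initial cut. -/
def sourcePart (F Q : Scri → ℂ) (Φ : ℝ × (Fin 2 → ℝ) → Scri) (t : ℝ) (y : Fin 2 → ℝ) : ℂ :=
  Complex.exp (-∫ s in (0 : ℝ)..t, F (Φ (s, y))) *
    ∫ s in (0 : ℝ)..t, Q (Φ (s, y)) * Complex.exp (∫ s' in (0 : ℝ)..s, F (Φ (s', y)))

/-! ### The constraint equations -/

/-- The constrained quantities: `σ_{2,0}`, the news `∂_u σ_{2,0}`, `Ψ₀^{n,j}`, `Ψ₁^{4,j}`,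
`Ψ₂^{3,j}` and the mass aspect `Re Ψ₂^{3,0}`. -/
inductive Constraint
  | shear
  | news
  | psi0 (n j : ℕ)
  | psi1 (j : ℕ)
  | psi2 (j : ℕ)
  | mass

/-- Coefficients known at some stage of the order-by-order solution. -/
structure PrevData where
  b0 : Scri → ℂ
  aE : Coeffs
  cE : Coeffs
  UE : Coeffs
  CE : Fin 2 → Coeffs
  xiE : Fin 2 → Coeffs
  PsiE : Fin 4 → Coeffs

open Classical in
/-- Keep the coefficients whose index `(k, j)` satisfies `P`, and discard the others. -/
def keep (P : ℤ → ℕ → Prop) (e : Coeffs) : Coeffs := fun k j p => if P k j then e k j p else 0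

namespace Constraint

/-- Spin weight. -/
def spin : Constraint → ℤ
  | shear => 2
  | news => 2
  | psi0 _ _ => 2
  | psi1 _ => 1
  | psi2 _ => 0
  | mass => 0

/-- The highest order of the Killing components `a`, `c` that the source may involve; for the tetrad
functions it is two more. -/
def order : Constraint → ℤ
  | psi0 n _ => n - 5
  | _ => -1

/-- The coefficients `(k, i)` of the Weyl scalars `Ψ₀, Ψ₁, Ψ₂, Ψ₃` that the source may involve. -/
def weylKnown : Constraint → Fin 4 → ℤ → ℕ → Prop
  | shear => fun _ _ _ => False
  | news => fun _ _ _ => False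
  | psi0 n j => ![fun k i => k < n ∨ (k = n ∧ j < i), fun k _ => k < n,
      fun _ _ => False, fun _ _ => False]
  | psi1 j => ![fun k _ => k ≤ 4, fun k i => k < 4 ∨ (k = 4 ∧ j < i), fun k _ => k ≤ 3,
      fun _ _ => False]
  | psi2 j => ![fun _ _ => False, fun _ _ => False, fun k i => k < 3 ∨ (k = 3 ∧ j < i),
      fun k _ => k ≤ 2]
  | mass => ![fun _ _ => False, fun _ _ => False, fun k i => k < 3 ∨ (k = 3 ∧ 0 < i),
      fun k _ => k ≤ 2]

end Constraint

namespace KillingSpacetime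

variable (S : KillingSpacetime)

/-- The Killing field, in coordinates. -/
def field : ST → Fin 4 → ℝ := S.T.vec S.a S.b S.c

/-- The leading coefficients `a_{-1}`, `b`, `c_{-1}`. -/
def am1 : Scri → ℂ := S.aE (-1) 0
def b0 : Scri → ℂ := S.bE 0 0
def cm1 : Scri → ℂ := S.cE (-1) 0

/-- `v` is the restriction of the Killing field to null infinity, that is, the limit as `r → ∞` of
its components along `∂_u, ∂_θ, ∂_φ`. -/
def IsRestriction (v : Scri → Scri) : Prop :=
  ∀ p ∈ S.O, Filter.Tendsto (fun r => toScri (S.field (lift p r))) Filter.atTop (𝓝 (v p))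

def ethc : Scri → ℂ := eth (-1) S.cm1
def ethbarcbar : Scri → ℂ := ethbar 1 (fun p => starRingEnd ℂ (S.cm1 p))

/-- The constrained quantity `X`. -/
def quantity : Constraint → Scri → ℂ
  | .shear => S.sigmaE 2 0
  | .news => pd 0 (S.sigmaE 2 0)
  | .psi0 n j => S.PsiE 0 n j
  | .psi1 j => S.PsiE 1 4 j
  | .psi2 j => S.PsiE 2 3 j
  | .mass => fun p => ((S.PsiE 2 3 0 p).re : ℂ)

/-- The coefficient `H`. -/
def damping : Constraint → Scri → ℂ
  | .shear => fun p => -(S.am1 p + S.ethc p - S.ethbarcbar p)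
  | .news => fun p => -2 * S.ethc p
  | .psi0 n _ => fun p => -(((n : ℂ) - 4) * S.am1 p + 2 * S.ethc p)
  | .psi1 _ => fun p => -(2 * S.am1 p + S.ethc p)
  | .psi2 _ => fun p => -3 * S.am1 p
  | .mass => fun p => -3 * S.am1 p

/-- The coefficients calculated before the constraint is reached. -/
def prev (κ : Constraint) : PrevData where
  b0 := S.b0
  aE := keep (fun k _ => k ≤ κ.order) S.aE
  cE := keep (fun k _ => k ≤ κ.order) S.cE
  UE := keep (fun k _ => k ≤ κ.order + 2) S.UE
  CE i := keep (fun k _ => k ≤ κ.order + 2) (S.CE i)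
  xiE i := keep (fun k _ => k ≤ κ.order + 2) (S.xiE i)
  PsiE i := keep (κ.weylKnown i) (S.PsiE i)

/-- The left-hand operator of a generic constraint equation. -/
def op (s : ℤ) (H : Scri → ℂ) : (Scri → ℂ) → Scri → ℂ := constraintOp s S.b0 S.cm1 H

/-- The coefficient of `X` after `ð₁`, `ð̄₁` are written with partial derivatives. -/
def totalDamping (s : ℤ) (H : Scri → ℂ) (p : Scri) : ℂ :=
  H p - (s : ℂ) * ((Real.cos (p 1) / (Real.sqrt 2 * Real.sin (p 1)) : ℝ) : ℂ) *
    (starRingEnd ℂ (S.cm1 p) - S.cm1 p)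

end KillingSpacetime

end

end AFKilling

open AFKilling

/-! A Killing field `v` drags the metric along itself, hence also the Levi-Civita connection and the
Weyl tensor, while its brackets with the null tetrad form an infinitesimal Lorentz rotation
(`exists_killingBrackets`). Applying `v` to a Weyl scalar therefore gives a linear combination of
Weyl scalars, for instance `v Ψ₀ = 2(A' + γ)Ψ₀ + 4βΨ₁` (`psi0_lie`, `psi1_lie`, `psi2_lie`). The
shear is the `m̄` component of `[l, m]` (`shear_eq`), and the Jacobi identity gives a similar
equation for it (`shear_lie`). All of this is algebra: it is proved over a commutative ring with
four commuting derivations and then applied to the ring `Sm` of smooth functions on the spacetime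
region. `exists_brackets` collects the result.

These equations are then expanded along the rays `r → ∞`. The brackets force `b` to be independent
of `r` with `∂_u b = -a_{-1}`, exclude logarithms from the leading coefficients of `a` and `c`, make
those coefficients independent of `u`, and yield the conformal Killing relation `2a_{-1} = ð₁c_{-1}
+ ð̄₁c̄_{-1}`. Since `vʳ` grows like `a_{-1} r`, the field `v` acts on the coefficient of `r⁻ⁿ` as
its restriction to null infinity plus multiplication by `-n a_{-1}`. Together with the limits of
`A'` and `γ` (`A_lead_am1`, `γ_lead_eq`) this is the coefficient `H`, up to the cotangent term
coming from the spin weight (`op_eq`). As `β = O(1/r)`, the scalars that multiply it enter at lower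
order only.

The source is never computed. It is enough that `L X` at a point depends only on the previous data.
`transport_of_eq` subtracts the equations of two spacetimes with the same data and reads off the
first order at which they may differ: every known contribution cancels there, so `L` takes the same
value on both quantities (`op_quantity`). Then `source` takes its value from any spacetime with the
given data. The news equation is the `u`-derivative of the shear equation (`op_news`), and the mass
equation is the real part of the one for `Ψ₂` (`op_mass`).

Finally, `op_eq` shows that `L` is a vector field plus a multiplication. The vector field is
determined by `L` (`HasTransportForm.unique`), so characteristics and orbits coincide. Along each of
them `L X = Q` is a linear ordinary differential equation, solved with an integrating factor; the
inverse function theorem turns `Φ` into `C¹` coordinates, and the splitting follows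
(`IsCharacteristicMap.exists_splitting`). -/

namespace AFKilling

noncomputable section

section

/-! ### Curvature over a commutative ring with commuting derivations -/

section Algebra

open Matrix

variable {A : Type*} [CommRing A] [Algebra ℂ A]

/-- Entrywise derivative of a matrix. -/
def dmat (D : Derivation ℂ A A) (M : Matrix (Fin 4) (Fin 4) A) : Matrix (Fin 4) (Fin 4) A := M.map D

lemma dmat_apply (D : Derivation ℂ A A) (M : Matrix (Fin 4) (Fin 4) A) (i j : Fin 4) :
    dmat D M i j = D (M i j) := rfl

lemma dmat_mul (D : Derivation ℂ A A) (M N : Matrix (Fin 4) (Fin 4) A) :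
    dmat D (M * N) = dmat D M * N + M * dmat D N := by
  ext i j
  simp only [dmat_apply, Matrix.mul_apply, Matrix.add_apply, map_sum, Derivation.leibniz,
    smul_eq_mul, ← Finset.sum_add_distrib]
  exact Finset.sum_congr rfl fun k _ => by ring

lemma dmat_add (D : Derivation ℂ A A) (M N : Matrix (Fin 4) (Fin 4) A) :
    dmat D (M + N) = dmat D M + dmat D N := by
  ext i j; simp [dmat_apply]

lemma dmat_sub (D : Derivation ℂ A A) (M N : Matrix (Fin 4) (Fin 4) A) :
    dmat D (M - N) = dmat D M - dmat D N := by
  ext i j; simp [dmat_apply]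

lemma dmat_sum_smul (D : Derivation ℂ A A) (f : Fin 4 → A)
    (M : Fin 4 → Matrix (Fin 4) (Fin 4) A) :
    dmat D (∑ k, f k • M k) = ∑ k, D (f k) • M k + ∑ k, f k • dmat D (M k) := by
  ext i j
  simp only [dmat_apply, Matrix.sum_apply, Matrix.add_apply, map_sum, Derivation.leibniz,
    smul_eq_mul, ← Finset.sum_add_distrib, Matrix.smul_apply]
  exact Finset.sum_congr rfl fun k _ => by ring

lemma dmat_transpose (D : Derivation ℂ A A) (M : Matrix (Fin 4) (Fin 4) A) :
    dmat D Mᵀ = (dmat D M)ᵀ := rfl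

/-- One half, as an element of a complex algebra. -/
def half : A := algebraMap ℂ A (1 / 2)

lemma two_mul_half : 2 * (half : A) = 1 := by
  have : (2 : A) = algebraMap ℂ A 2 := (map_ofNat _ 2).symm
  rw [half, this, ← map_mul]; norm_num

lemma derivation_half_mul (D : Derivation ℂ A A) (x : A) : D (half * x) = half * D x := by
  simp [half]

lemma eq_zero_of_two_mul {x : A} (h : 2 * x = 0) : x = 0 := by
  linear_combination half * h - x * (two_mul_half (A := A))

/-- Christoffel symbols of the first kind, `Γ_{ebc}`, as matrices in `(e, c)`. -/
def chrLow (d : Fin 4 → Derivation ℂ A A) (g : Matrix (Fin 4) (Fin 4) A) (b : Fin 4) :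
    Matrix (Fin 4) (Fin 4) A :=
  fun e c => half * (d b (g e c) + d c (g e b) - d e (g b c))

/-- Christoffel symbols `Γᵃ_{bc}` as matrices in `(a, c)`. -/
def chr (d : Fin 4 → Derivation ℂ A A) (g G : Matrix (Fin 4) (Fin 4) A) (b : Fin 4) :
    Matrix (Fin 4) (Fin 4) A := G * chrLow d g b

/-- The curvature matrix `∂_c Γ_e - ∂_e Γ_c + [Γ_c, Γ_e]` of a connection. -/
def curv (d : Fin 4 → Derivation ℂ A A) (Γ : Fin 4 → Matrix (Fin 4) (Fin 4) A) (c e : Fin 4) :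
    Matrix (Fin 4) (Fin 4) A :=
  dmat (d c) (Γ e) - dmat (d e) (Γ c) + (Γ c * Γ e - Γ e * Γ c)

/-- The derivation `∑ vᵏ ∂_k`. -/
def vder (d : Fin 4 → Derivation ℂ A A) (v : Fin 4 → A) : Derivation ℂ A A := ∑ k, v k • d k

lemma vder_apply (d : Fin 4 → Derivation ℂ A A) (v : Fin 4 → A) (f : A) :
    vder d v f = ∑ k, v k * d k f := by
  simp [vder, Fin.sum_univ_four]

/-- The Jacobian `∂_j vᵏ`. -/
def jac (d : Fin 4 → Derivation ℂ A A) (v : Fin 4 → A) : Matrix (Fin 4) (Fin 4) A :=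
  fun k j => d j (v k)

variable {d : Fin 4 → Derivation ℂ A A} (hd : ∀ i j f, d i (d j f) = d j (d i f))
  {g G : Matrix (Fin 4) (Fin 4) A} (hg : ∀ i j, g i j = g j i) (hGg : G * g = 1)
  {v : Fin 4 → A}

include hd

lemma vder_comm (v : Fin 4 → A) (b : Fin 4) (f : A) :
    vder d v (d b f) = d b (vder d v f) - ∑ k, jac d v k b * d k f := by
  simp only [vder_apply, map_sum, ← Finset.sum_sub_distrib]
  refine Finset.sum_congr rfl fun k _ => ?_
  simp only [Derivation.leibniz, smul_eq_mul, jac, hd b k f]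
  ring

lemma dmat_vder_comm (v : Fin 4 → A) (b : Fin 4) (M : Matrix (Fin 4) (Fin 4) A) :
    dmat (vder d v) (dmat (d b) M) =
      dmat (d b) (dmat (vder d v) M) - ∑ k, jac d v k b • dmat (d k) M := by
  ext i j
  simp only [dmat_apply, vder_comm hd, Matrix.sub_apply, Matrix.sum_apply, Matrix.smul_apply,
    smul_eq_mul]

include hg

/-- The hypothesis `hK` is the Killing equation in matrix form. In the cyclic combination defining
`Γ_{ebc}` the second derivatives of `v` cancel, except for two equal terms that add up to the
inhomogeneous term `g ∂_b (jac d v)` of a connection. -/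
lemma chrLow_lie (hK : dmat (vder d v) g = -((jac d v)ᵀ * g + g * jac d v)) (b : Fin 4) :
    dmat (vder d v) (chrLow d g b) = -((jac d v)ᵀ * chrLow d g b + chrLow d g b * jac d v
      + ∑ k, jac d v k b • chrLow d g k + g * dmat (d b) (jac d v)) := by
  have hK' : ∀ i j, vder d v (g i j) = -∑ k, (d i (v k) * g k j + g i k * d j (v k)) := by
    intro i j
    have := congrFun (congrFun hK i) j
    simpa [dmat_apply, Matrix.mul_apply, Finset.sum_add_distrib, jac] using this
  ext e c
  simp only [dmat_apply, chrLow, derivation_half_mul, map_add, map_sub, vder_comm hd, hK',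
    map_neg, map_sum, Matrix.neg_apply, Matrix.add_apply, Matrix.mul_apply, Matrix.sum_apply,
    Matrix.smul_apply, Matrix.transpose_apply, smul_eq_mul, ← Finset.sum_add_distrib,
    ← Finset.sum_sub_distrib, ← Finset.sum_neg_distrib, Finset.mul_sum]
  refine Finset.sum_congr rfl fun k _ => ?_
  simp only [Derivation.leibniz, smul_eq_mul, jac, hd c e (v k), hd b e (v k), hd c b (v k),
    hg e k, hg b k]
  linear_combination (-(g k e * d b (d c (v k)))) * two_mul_half (A := A)

omit hd hg in
include hGg in
lemma g_mul_chr (b : Fin 4) : g * chr d g G b = chrLow d g b := by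
  have : g * G = 1 := mul_eq_one_comm.mp hGg
  rw [chr, ← mul_assoc, this, one_mul]

include hGg in
-- The product rule is applied to `g * Γ = chrLow` and `g` is cancelled, so that the inverse metric
-- need not be differentiated. The result says that the Lie derivative of the connection vanishes.
lemma chr_lie (hK : dmat (vder d v) g = -((jac d v)ᵀ * g + g * jac d v)) (b : Fin 4) :
    dmat (vder d v) (chr d g G b) = jac d v * chr d g G b - chr d g G b * jac d v
      - ∑ k, jac d v k b • chr d g G k - dmat (d b) (jac d v) := by
  have h1 := chrLow_lie hd hg hK b
  simp only [← g_mul_chr hGg, dmat_mul, hK] at h1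
  have h2 : g * dmat (vder d v) (chr d g G b) = g * (jac d v * chr d g G b
      - chr d g G b * jac d v - ∑ k, jac d v k b • chr d g G k - dmat (d b) (jac d v)) := by
    simp only [mul_sub, Finset.mul_sum, Matrix.mul_smul] at h1 ⊢
    linear_combination (norm := noncomm_ring) h1
  have := congrArg (G * ·) h2
  simpa [← mul_assoc, hGg] using this

omit hg hd in
lemma sum_smul_curv (Γ : Fin 4 → Matrix (Fin 4) (Fin 4) A) (f : Fin 4 → A) (e : Fin 4) :
    ∑ k, f k • curv d Γ k e = ∑ k, f k • dmat (d k) (Γ e) - ∑ k, f k • dmat (d e) (Γ k)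
      + ((∑ k, f k • Γ k) * Γ e - Γ e * ∑ k, f k • Γ k) := by
  simp only [curv, smul_add, smul_sub, Finset.sum_add_distrib, Finset.sum_sub_distrib,
    Finset.sum_mul, Finset.mul_sum, Matrix.smul_mul, Matrix.mul_smul]

omit hg hd in
lemma curv_swap (Γ : Fin 4 → Matrix (Fin 4) (Fin 4) A) (c e : Fin 4) :
    curv d Γ c e = -curv d Γ e c := by
  simp only [curv]; abel

omit hg in
-- Invariance of the connection passes to its curvature: second derivatives of `jac d v` are
-- symmetric and cancel, and its first derivatives cancel between the derivative part and the
-- commutator part of the curvature.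
lemma curv_lie {Γ : Fin 4 → Matrix (Fin 4) (Fin 4) A}
    (hΓ : ∀ b, dmat (vder d v) (Γ b) = jac d v * Γ b - Γ b * jac d v
      - ∑ k, jac d v k b • Γ k - dmat (d b) (jac d v)) (c e : Fin 4) :
    dmat (vder d v) (curv d Γ c e) = jac d v * curv d Γ c e - curv d Γ c e * jac d v
      - ∑ k, jac d v k c • curv d Γ k e - ∑ k, jac d v k e • curv d Γ c k := by
  have hJ : ∀ k, d c (jac d v k e) = d e (jac d v k c) := fun k => hd _ _ _
  have hJ' : dmat (d c) (dmat (d e) (jac d v)) = dmat (d e) (dmat (d c) (jac d v)) := by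
    ext i j; exact hd _ _ _
  have hs : ∑ k, jac d v k e • curv d Γ c k = -∑ k, jac d v k e • curv d Γ k c := by
    rw [← Finset.sum_neg_distrib]
    exact Finset.sum_congr rfl fun k _ => by rw [curv_swap, smul_neg]
  rw [hs, sum_smul_curv, sum_smul_curv]
  simp only [curv, dmat_add, dmat_sub, dmat_mul, dmat_vder_comm hd, hΓ, dmat_sum_smul, hJ, hJ']
  -- Once every sum and derivative is an opaque matrix, only an identity in a free noncommutative
  -- ring is left.
  generalize jac d v = J
  generalize ∑ k, J k c • Γ k = Sc
  generalize ∑ k, J k e • Γ k = Se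
  generalize ∑ k, d e (J k c) • Γ k = T1
  generalize ∑ k, J k c • dmat (d k) (Γ e) = T2
  generalize ∑ k, J k e • dmat (d k) (Γ c) = T3
  generalize ∑ k, J k c • dmat (d e) (Γ k) = T4
  generalize ∑ k, J k e • dmat (d c) (Γ k) = T5
  generalize dmat (d e) (dmat (d c) J) = T6
  generalize dmat (d c) J = Jc
  generalize dmat (d e) J = Je
  generalize dmat (d c) (Γ e) = E1
  generalize dmat (d e) (Γ c) = E2
  generalize Γ c = P
  generalize Γ e = Q
  noncomm_ring

end Algebra

end

/-! ### Riemann, Ricci and Weyl tensors: invariance along a Killing field and algebraic symmetries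
-/

section

section AlgebraTensors

open Matrix

variable {A : Type*} [CommRing A] [Algebra ℂ A]

/-- The Riemann tensor with lowered indices. -/
def riem (d : Fin 4 → Derivation ℂ A A) (g G : Matrix (Fin 4) (Fin 4) A) (a b c e : Fin 4) : A :=
  (g * curv d (chr d g G) c e) a b

/-- The Ricci tensor. -/
def ric (d : Fin 4 → Derivation ℂ A A) (g G : Matrix (Fin 4) (Fin 4) A) :
    Matrix (Fin 4) (Fin 4) A :=
  fun b e => ∑ a, curv d (chr d g G) a e a b

/-- The scalar curvature. -/
def scalCurv (d : Fin 4 → Derivation ℂ A A) (g G : Matrix (Fin 4) (Fin 4) A) : A :=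
  ∑ b, ∑ e, G b e * ric d g G b e

/-- The Weyl tensor. -/
def weyl (d : Fin 4 → Derivation ℂ A A) (g G : Matrix (Fin 4) (Fin 4) A) (a b c e : Fin 4) : A :=
  riem d g G a b c e
    - half * (g a c * ric d g G b e - g a e * ric d g G b c
        - g b c * ric d g G a e + g b e * ric d g G a c)
    + algebraMap ℂ A (1 / 6) * scalCurv d g G * (g a c * g b e - g a e * g b c)

variable {d : Fin 4 → Derivation ℂ A A} (hd : ∀ i j f, d i (d j f) = d j (d i f))
  {g G : Matrix (Fin 4) (Fin 4) A} (hg : ∀ i j, g i j = g j i) (hGg : G * g = 1)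
  {v : Fin 4 → A} (hK : dmat (vder d v) g = -((jac d v)ᵀ * g + g * jac d v))

omit [Algebra ℂ A] in
include hGg in
lemma symm_of_mul_eq_one (hg : ∀ i j, g i j = g j i) (i j : Fin 4) : G i j = G j i := by
  have h1 : gᵀ = g := by ext i j; exact hg j i
  have h2 : g * Gᵀ = 1 := by
    have := congrArg transpose hGg
    rwa [transpose_mul, transpose_one, h1] at this
  have : Gᵀ = G := by
    calc Gᵀ = (G * g) * Gᵀ := by rw [hGg, one_mul]
      _ = G := by rw [mul_assoc, h2, mul_one]
  exact (congrFun (congrFun this i) j).symm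

omit [Algebra ℂ A] in
include hGg in
lemma sum_mul_eq_ite (i j : Fin 4) : ∑ k, G i k * g k j = if i = j then 1 else 0 := by
  rw [← Matrix.mul_apply, hGg, Matrix.one_apply]

include hGg hK in
lemma inv_lie : dmat (vder d v) G = G * (jac d v)ᵀ + jac d v * G := by
  have hgG : g * G = 1 := mul_eq_one_comm.mp hGg
  have h1 : dmat (vder d v) (G * g) = 0 := by
    rw [hGg]; ext i j; by_cases h : i = j <;> simp [dmat_apply, h]
  rw [dmat_mul, hK] at h1
  have h2 : (dmat (vder d v) G * g + G * -((jac d v)ᵀ * g + g * jac d v)) * G = 0 := by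
    rw [h1, zero_mul]
  have h3 : (dmat (vder d v) G * g + G * -((jac d v)ᵀ * g + g * jac d v)) * G
      = dmat (vder d v) G * (g * G) - G * (jac d v)ᵀ * (g * G) - (G * g) * jac d v * G := by
    noncomm_ring
  rw [h3, hgG, hGg, mul_one, mul_one, one_mul] at h2
  linear_combination (norm := noncomm_ring) h2

include hd hg hGg hK

lemma riem_lie (a b c e : Fin 4) : vder d v (riem d g G a b c e) =
    -∑ k, (jac d v k a * riem d g G k b c e + jac d v k b * riem d g G a k c e
      + jac d v k c * riem d g G a b k e + jac d v k e * riem d g G a b c k) := by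
  have h1 := curv_lie hd (chr_lie hd hg hGg hK) c e
  have h2 : dmat (vder d v) (g * curv d (chr d g G) c e) =
      -((jac d v)ᵀ * (g * curv d (chr d g G) c e) + (g * curv d (chr d g G) c e) * jac d v
        + ∑ k, jac d v k c • (g * curv d (chr d g G) k e)
        + ∑ k, jac d v k e • (g * curv d (chr d g G) c k)) := by
    rw [dmat_mul, hK, h1]
    simp only [mul_sub, Finset.mul_sum, Matrix.mul_smul]
    noncomm_ring
  have h3 := congrFun (congrFun h2 a) b
  simp only [dmat_apply, Matrix.neg_apply, Matrix.add_apply, Matrix.mul_apply (M := (jac d v)ᵀ),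
    Matrix.mul_apply (N := jac d v),
    Matrix.sum_apply, Matrix.smul_apply, smul_eq_mul, transpose_apply] at h3
  simp only [riem]
  rw [h3]
  simp only [← Finset.sum_add_distrib]
  congr 1
  exact Finset.sum_congr rfl fun k _ => by ring

lemma ric_lie : dmat (vder d v) (ric d g G) =
    -((jac d v)ᵀ * ric d g G + ric d g G * jac d v) := by
  have h1 := fun c e => curv_lie hd (chr_lie hd hg hGg hK) c e
  ext b e
  have h2 : ∀ a, vder d v (curv d (chr d g G) a e a b) =
      ∑ k, jac d v a k * curv d (chr d g G) a e k b - ∑ k, jac d v k a * curv d (chr d g G) k e a b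
      - (∑ k, curv d (chr d g G) a e a k * jac d v k b
        + ∑ k, jac d v k e * curv d (chr d g G) a k a b) := by
    intro a
    have := congrFun (congrFun (h1 a e) a) b
    simp only [dmat_apply, Matrix.sub_apply, Matrix.mul_apply, Matrix.sum_apply,
      Matrix.smul_apply, smul_eq_mul] at this
    rw [this]; ring
  simp only [dmat_apply, ric, map_sum, h2, Finset.sum_sub_distrib, Finset.sum_add_distrib,
    Matrix.neg_apply, Matrix.add_apply, Matrix.mul_apply, transpose_apply]
  -- The terms that rotate the two contracted indices are the same double sum with opposite signs.
  rw [Finset.sum_comm (f := fun a k => jac d v a k * curv d (chr d g G) a e k b), sub_self]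
  rw [Finset.sum_comm (f := fun a k => curv d (chr d g G) a e a k * jac d v k b),
    Finset.sum_comm (f := fun a k => jac d v k e * curv d (chr d g G) a k a b)]
  simp only [Finset.mul_sum, Finset.sum_mul, zero_sub, ← Finset.sum_add_distrib]
  congr 1
  exact Finset.sum_congr rfl fun k _ => Finset.sum_congr rfl fun i _ => by ring

/-- The derivative of `G * Ricᵀ` is its commutator with the Jacobian, and a commutator has trace
zero. -/
lemma scalCurv_lie : vder d v (scalCurv d g G) = 0 := by
  have h0 : ∀ M N : Matrix (Fin 4) (Fin 4) A, ∑ b, ∑ e, M b e * N b e = trace (M * Nᵀ) := by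
    intro M N; simp [trace, Matrix.mul_apply]
  have h1 : vder d v (scalCurv d g G) = trace (dmat (vder d v) (G * (ric d g G)ᵀ)) := by
    rw [scalCurv, h0]; simp [trace, dmat_apply]
  rw [h1, dmat_mul, dmat_transpose, ric_lie hd hg hGg hK, inv_lie hGg hK]
  have : (G * (jac d v)ᵀ + jac d v * G) * (ric d g G)ᵀ +
      G * (-((jac d v)ᵀ * ric d g G + ric d g G * jac d v))ᵀ
      = jac d v * (G * (ric d g G)ᵀ) - (G * (ric d g G)ᵀ) * jac d v := by
    simp only [transpose_neg, transpose_add, transpose_mul, transpose_transpose]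
    noncomm_ring
  rw [this, trace_sub, trace_mul_comm, sub_self]

lemma weyl_lie (a b c e : Fin 4) : vder d v (weyl d g G a b c e) =
    -∑ k, (jac d v k a * weyl d g G k b c e + jac d v k b * weyl d g G a k c e
      + jac d v k c * weyl d g G a b k e + jac d v k e * weyl d g G a b c k) := by
  have hg' : ∀ i j, vder d v (g i j) = -∑ k, (jac d v k i * g k j + jac d v k j * g i k) := by
    intro i j
    have := congrFun (congrFun hK i) j
    simpa [dmat_apply, Matrix.mul_apply, Finset.sum_add_distrib, mul_comm] using this
  have hr' : ∀ i j, vder d v (ric d g G i j) =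
      -∑ k, (jac d v k i * ric d g G k j + jac d v k j * ric d g G i k) := by
    intro i j
    have := congrFun (congrFun (ric_lie hd hg hGg hK) i) j
    simpa [dmat_apply, Matrix.mul_apply, Finset.sum_add_distrib, mul_comm] using this
  have hC : ∀ (z : ℂ) (x : A), vder d v (algebraMap ℂ A z * x) = algebraMap ℂ A z * vder d v x := by
    intro z x; simp
  have hh : vder d v (half : A) = 0 := by simp [half]
  simp only [weyl, map_add, map_sub, mul_assoc, hC, hh, riem_lie hd hg hGg hK,
    Derivation.leibniz, smul_eq_mul, scalCurv_lie hd hg hGg hK, hg', hr', mul_zero, add_zero]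
  simp only [mul_neg, Finset.mul_sum, ← Finset.sum_neg_distrib, ← Finset.sum_add_distrib,
    ← Finset.sum_sub_distrib]
  exact Finset.sum_congr rfl fun k _ => by ring

omit hK hd hGg in
lemma dmat_eq_chrLow (c : Fin 4) : dmat (d c) g = chrLow d g c + (chrLow d g c)ᵀ := by
  ext a b
  simp only [dmat_apply, chrLow, Matrix.add_apply, transpose_apply]
  rw [hg b a, hg c a, hg c b]
  linear_combination (-(d c (g a b))) * two_mul_half (A := A)

omit hK hd in
-- With the index lowered through metric compatibility, the quadratic terms form an expression that
-- changes sign under transposition. Antisymmetry of Riemann in its first pair is thereby reduced to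
-- `∂_c ∂_e g = ∂_e ∂_c g`.
lemma g_mul_curv (c e : Fin 4) : g * curv d (chr d g G) c e =
    dmat (d c) (chrLow d g e) - dmat (d e) (chrLow d g c)
      - (chrLow d g c)ᵀ * G * chrLow d g e + (chrLow d g e)ᵀ * G * chrLow d g c := by
  have h1 := dmat_mul (d c) g (chr d g G e)
  have h2 := dmat_mul (d e) g (chr d g G c)
  have hgG : g * G = 1 := mul_eq_one_comm.mp hGg
  rw [g_mul_chr hGg, dmat_eq_chrLow hg] at h1 h2
  have h3 : ∀ b e, g * (chr d g G b * chr d g G e) = chrLow d g b * chr d g G e := by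
    intro b e; rw [← mul_assoc, g_mul_chr hGg]
  simp only [curv, mul_add, mul_sub, h3]
  simp only [chr] at *
  linear_combination (norm := noncomm_ring) h2 - h1

omit hK in
lemma riem_antisymm_left (a b c e : Fin 4) : riem d g G a b c e = -riem d g G b a c e := by
  have hG : Gᵀ = G := by ext i j; exact symm_of_mul_eq_one hGg hg j i
  have h1 : g * curv d (chr d g G) c e + (g * curv d (chr d g G) c e)ᵀ = 0 := by
    have h2 : dmat (d c) (dmat (d e) g) = dmat (d e) (dmat (d c) g) := by
      ext i j; exact hd _ _ _
    simp only [dmat_eq_chrLow hg, dmat_add, dmat_transpose] at h2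
    simp only [g_mul_curv hg hGg, transpose_add, transpose_sub, transpose_mul,
      transpose_transpose, hG]
    linear_combination (norm := noncomm_ring) h2
  have := congrFun (congrFun h1 a) b
  exact eq_neg_of_add_eq_zero_left this

omit hK hd hg hGg in
lemma riem_antisymm_right (a b c e : Fin 4) : riem d g G a b c e = -riem d g G a b e c := by
  simp only [riem]; rw [curv_swap]; simp

omit hK hd hGg in
lemma riem_bianchi (a b c e : Fin 4) :
    riem d g G a b c e + riem d g G a c e b + riem d g G a e b c = 0 := by
  have hs : ∀ b c k, chr d g G b k c = chr d g G c k b := by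
    intro b c k
    simp only [chr, Matrix.mul_apply, chrLow]
    exact Finset.sum_congr rfl fun i _ => by rw [hg b c]; ring
  have h1 : ∀ a, curv d (chr d g G) c e a b + curv d (chr d g G) e b a c
      + curv d (chr d g G) b c a e = 0 := by
    intro a
    simp only [curv, Matrix.add_apply, Matrix.sub_apply, dmat_apply, Matrix.mul_apply,
      hs b c, hs b e, hs c e]
    ring
  simp only [riem, Matrix.mul_apply, ← Finset.sum_add_distrib, ← mul_add, h1, mul_zero,
    Finset.sum_const_zero]

omit hK in
-- The classical octahedron argument: a signed sum of four Bianchi identities, rewritten with the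
-- two antisymmetries, is twice the required difference.
lemma riem_pair (a b c e : Fin 4) : riem d g G a b c e = riem d g G c e a b := by
  have B := fun a b c e => riem_bianchi (d := d) (G := G) hg a b c e
  have S := fun a b c e => riem_antisymm_left hd hg hGg a b c e
  have R := fun a b c e => riem_antisymm_right (d := d) (g := g) (G := G) a b c e
  refine sub_eq_zero.mp (eq_zero_of_two_mul ?_)
  have b2 := B b c e a
  rw [R b c e a, S b e a c, S b a c e] at b2
  have b3 := B c e a b
  rw [S c a b e, R a c b e, S c b e a, R b c e a] at b3
  have b4 := B e a b c
  rw [S e a b c, R e b c a, S e c a b] at b4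
  linear_combination B a b c e - b2 - b3 + b4

omit hK hd in
lemma ric_eq_sum (b e : Fin 4) : ric d g G b e = ∑ a, ∑ c, G a c * riem d g G a b c e := by
  have h : ∀ c, curv d (chr d g G) c e = G * (g * curv d (chr d g G) c e) := by
    intro c; rw [← mul_assoc, hGg, one_mul]
  rw [Finset.sum_comm]
  refine Finset.sum_congr rfl fun c _ => ?_
  rw [h, Matrix.mul_apply]
  exact Finset.sum_congr rfl fun a _ => by rw [symm_of_mul_eq_one hGg hg c a, riem]

omit hK in
lemma ric_symm (b e : Fin 4) : ric d g G b e = ric d g G e b := by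
  rw [ric_eq_sum hg hGg, ric_eq_sum hg hGg, Finset.sum_comm]
  refine Finset.sum_congr rfl fun a _ => Finset.sum_congr rfl fun c _ => ?_
  rw [symm_of_mul_eq_one hGg hg, riem_pair hd hg hGg]

omit hK in
lemma weyl_antisymm_left (a b c e : Fin 4) : weyl d g G a b c e = -weyl d g G b a c e := by
  simp only [weyl, riem_antisymm_left hd hg hGg a b c e]; ring

omit hK in
lemma weyl_pair (a b c e : Fin 4) : weyl d g G a b c e = weyl d g G c e a b := by
  simp only [weyl, riem_pair hd hg hGg a b c e, hg c a, hg e b, hg c b, hg e a,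
    ric_symm hd hg hGg c a, ric_symm hd hg hGg e b, ric_symm hd hg hGg c b,
    ric_symm hd hg hGg e a]
  ring

omit hK in
lemma weyl_bianchi (a b c e : Fin 4) :
    weyl d g G a b c e + weyl d g G a c e b + weyl d g G a e b c = 0 := by
  simp only [weyl, hg c b, hg e b, hg e c,
    ric_symm hd hg hGg c b, ric_symm hd hg hGg e b, ric_symm hd hg hGg e c]
  linear_combination riem_bianchi (d := d) (G := G) hg a b c e

omit hK hd in
-- The dimension enters through `tr g = 4`: the Ricci terms cancel because `1 - (4 - 1 - 1)/2 = 0`,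
-- and the scalar terms because `-1/2 + (4 - 1)/6 = 0`.
lemma weyl_trace (b e : Fin 4) : ∑ a, ∑ c, G a c * weyl d g G a b c e = 0 := by
  have hG := symm_of_mul_eq_one hGg hg
  have htr : ∀ x, ∑ a, ∑ c, G a c * (g a c * x) = 4 * x := by
    intro x
    have h : ∀ a, ∑ c, G a c * (g a c * x) = x := by
      intro a
      calc _ = (∑ c, G a c * g c a) * x := by
            rw [Finset.sum_mul]
            exact Finset.sum_congr rfl fun c _ => by rw [hg a c, mul_assoc]
        _ = x := by rw [sum_mul_eq_ite hGg, if_pos rfl, one_mul]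
    simp [h]
  have hδ : ∀ (i : Fin 4) (f : Fin 4 → A), ∑ a, ∑ c, G a c * (g c i * f a) = f i := by
    intro i f
    simp [← mul_assoc, ← Finset.sum_mul, sum_mul_eq_ite hGg]
  have hδ' : ∀ (i : Fin 4) (f : Fin 4 → A), ∑ a, ∑ c, G a c * (g i a * f c) = f i := by
    intro i f
    rw [Finset.sum_comm, ← hδ i f]
    exact Finset.sum_congr rfl fun c _ => Finset.sum_congr rfl fun a _ => by rw [hG, hg i]
  have h3 : ∑ a, ∑ c, G a c * (ric d g G a c * g b e) = scalCurv d g G * g b e := by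
    simp only [← mul_assoc, ← Finset.sum_mul, scalCurv]
  have e1 := hδ' e (fun c => ric d g G b c)
  have e2 := hδ b (fun a => ric d g G a e)
  have e3 := hδ' e (fun c => g b c)
  have expand : ∀ a c, G a c * weyl d g G a b c e = G a c * riem d g G a b c e
      - half * (G a c * (g a c * ric d g G b e) - G a c * (g e a * ric d g G b c)
        - G a c * (g c b * ric d g G a e) + G a c * (ric d g G a c * g b e))
      + algebraMap ℂ A (1 / 6) * scalCurv d g G *
        (G a c * (g a c * g b e) - G a c * (g e a * g b c)) := by
    intro a c; rw [weyl, hg e a, hg c b]; ring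
  simp only [expand, Finset.sum_add_distrib, Finset.sum_sub_distrib, ← Finset.mul_sum]
  rw [← ric_eq_sum hg hGg, htr, e1, e2, h3, htr, e3]
  have h6 : 3 * algebraMap ℂ A (1 / 6) = half := by
    rw [half, ← map_ofNat (algebraMap ℂ A) 3, ← map_mul]; norm_num
  linear_combination (scalCurv d g G * g b e) * h6 - ric d g G b e * two_mul_half (A := A)

end AlgebraTensors

end

/-! ### Contractions of Weyl-like tensors with a null tetrad, and the evolution of the Weyl scalars
-/

section

section AlgebraFrames

open Matrix

variable {A : Type*} [CommRing A]

/-- Contraction of a covector with a vector. -/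
def ctr (S X : Fin 4 → A) : A := ∑ a, S a * X a

/-- Contraction of a covariant four-tensor with four vectors. -/
def ctr4 (W : Fin 4 → Fin 4 → Fin 4 → Fin 4 → A) (X Y Z U : Fin 4 → A) : A :=
  ctr (fun a => ctr (fun b => ctr (fun c => ctr (fun e => W a b c e) U) Z) Y) X

lemma ctr_add_left (S S' X : Fin 4 → A) : ctr (fun a => S a + S' a) X = ctr S X + ctr S' X := by
  simp [ctr, add_mul, Finset.sum_add_distrib]

lemma ctr_sub_left (S S' X : Fin 4 → A) : ctr (fun a => S a - S' a) X = ctr S X - ctr S' X := by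
  simp [ctr, sub_mul, Finset.sum_sub_distrib]

lemma ctr_neg_left (S X : Fin 4 → A) : ctr (fun a => -S a) X = -ctr S X := by
  simp [ctr]

lemma ctr_mul_left (f : A) (S X : Fin 4 → A) : ctr (fun a => f * S a) X = f * ctr S X := by
  simp [ctr, Finset.mul_sum, mul_assoc]

lemma ctr_sum_left (f : Fin 4 → A) (S : Fin 4 → Fin 4 → A) (X : Fin 4 → A) :
    ctr (fun a => ∑ k, f k * S k a) X = ∑ k, f k * ctr (S k) X := by
  simp only [ctr, Finset.sum_mul, Finset.mul_sum]
  rw [Finset.sum_comm]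
  exact Finset.sum_congr rfl fun k _ => Finset.sum_congr rfl fun i _ => by ring

lemma ctr_add_right (S X X' : Fin 4 → A) : ctr S (X + X') = ctr S X + ctr S X' := by
  simp [ctr, mul_add, Finset.sum_add_distrib]

lemma ctr_smul_right (f : A) (S X : Fin 4 → A) : ctr S (f • X) = f * ctr S X := by
  simp only [ctr, Pi.smul_apply, smul_eq_mul, Finset.mul_sum]
  exact Finset.sum_congr rfl fun k _ => by ring

/-- A covariant four-tensor with the algebraic symmetries of the Weyl tensor. -/
structure IsWeylLike (G : Matrix (Fin 4) (Fin 4) A)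
    (W : Fin 4 → Fin 4 → Fin 4 → Fin 4 → A) : Prop where
  antisymm : ∀ a b c e, W a b c e = -W b a c e
  pair : ∀ a b c e, W a b c e = W c e a b
  bianchi : ∀ a b c e, W a b c e + W a c e b + W a e b c = 0
  trace : ∀ b e, ∑ a, ∑ c, G a c * W a b c e = 0

lemma ctr4_eq_sum (W : Fin 4 → Fin 4 → Fin 4 → Fin 4 → A) (X Y Z U : Fin 4 → A) :
    ctr4 W X Y Z U = ∑ a, ∑ b, ∑ c, ∑ e, W a b c e * X a * Y b * Z c * U e := by
  simp only [ctr4, ctr, Finset.sum_mul]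
  exact Finset.sum_congr rfl fun a _ => Finset.sum_congr rfl fun b _ =>
    Finset.sum_congr rfl fun c _ => Finset.sum_congr rfl fun e _ => by ring

variable {G : Matrix (Fin 4) (Fin 4) A} {W : Fin 4 → Fin 4 → Fin 4 → Fin 4 → A}

namespace IsWeylLike

variable
  (hW : IsWeylLike G W)

include hW

lemma ctr4_swap (X Y Z U : Fin 4 → A) : ctr4 W X Y Z U = -ctr4 W Y X Z U := by
  simp only [ctr4_eq_sum, ← Finset.sum_neg_distrib]
  rw [Finset.sum_comm]
  exact Finset.sum_congr rfl fun a _ => Finset.sum_congr rfl fun b _ =>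
    Finset.sum_congr rfl fun c _ => Finset.sum_congr rfl fun e _ => by
      rw [hW.antisymm]; ring

lemma ctr4_pair (X Y Z U : Fin 4 → A) : ctr4 W X Y Z U = ctr4 W Z U X Y := by
  have h : ∀ F : Fin 4 → Fin 4 → Fin 4 → Fin 4 → A, ∑ a, ∑ b, ∑ c, ∑ e, F a b c e =
      ∑ p : Fin 4 × Fin 4, ∑ q : Fin 4 × Fin 4, F p.1 p.2 q.1 q.2 := by
    intro F; simp only [Fintype.sum_prod_type]
  rw [ctr4_eq_sum, ctr4_eq_sum, h, h, Finset.sum_comm]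
  refine Finset.sum_congr rfl fun p _ => Finset.sum_congr rfl fun q _ => ?_
  rw [hW.pair]; ring

lemma ctr4_bianchi (X Y Z U : Fin 4 → A) :
    ctr4 W X Y Z U + ctr4 W X Z U Y + ctr4 W X U Y Z = 0 := by
  have h1 : ctr4 W X Z U Y = ∑ a, ∑ b, ∑ c, ∑ e, W a c e b * X a * Y b * Z c * U e := by
    rw [ctr4_eq_sum]
    refine Finset.sum_congr rfl fun a _ => ?_
    rw [Finset.sum_congr rfl fun b _ => Finset.sum_comm, Finset.sum_comm]
    exact Finset.sum_congr rfl fun b _ =>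
      Finset.sum_congr rfl fun c _ => Finset.sum_congr rfl fun e _ => by ring
  have h2 : ctr4 W X U Y Z = ∑ a, ∑ b, ∑ c, ∑ e, W a e b c * X a * Y b * Z c * U e := by
    rw [ctr4_eq_sum]
    refine Finset.sum_congr rfl fun a _ => ?_
    rw [Finset.sum_comm, Finset.sum_congr rfl fun b _ => Finset.sum_comm]
    exact Finset.sum_congr rfl fun b _ =>
      Finset.sum_congr rfl fun c _ => Finset.sum_congr rfl fun e _ => by ring
  rw [h1, h2, ctr4_eq_sum]
  simp only [← Finset.sum_add_distrib, ← add_mul, hW.bianchi, zero_mul, Finset.sum_const_zero]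

lemma ctr4_self_left (X Z U : Fin 4 → A) (h2 : ∀ x : A, 2 * x = 0 → x = 0) :
    ctr4 W X X Z U = 0 :=
  h2 _ (by linear_combination hW.ctr4_swap X X Z U)

lemma ctr4_self_right (X Z U : Fin 4 → A) (h2 : ∀ x : A, 2 * x = 0 → x = 0) :
    ctr4 W Z U X X = 0 := by
  rw [hW.ctr4_pair, hW.ctr4_self_left X Z U h2]

lemma ctr4_swap_right (X Y Z U : Fin 4 → A) : ctr4 W X Y Z U = -ctr4 W X Y U Z := by
  rw [hW.ctr4_pair, hW.ctr4_swap, hW.ctr4_pair]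

/-- Tracelessness with the inverse metric expanded in the tetrad. It exchanges `m, m̄` contractions
for `l, n` contractions, which is how the surplus components below become Weyl scalars. -/
lemma ctr4_trace {l n m mb : Fin 4 → A}
    (hG : ∀ i j, G i j = l i * n j + n i * l j - m i * mb j - mb i * m j) (Y U : Fin 4 → A) :
    ctr4 W l Y n U + ctr4 W n Y l U - ctr4 W m Y mb U - ctr4 W mb Y m U = 0 := by
  have h : ∀ X Z : Fin 4 → A, ctr4 W X Y Z U =
      ∑ b, ∑ e, (∑ a, ∑ c, X a * Z c * W a b c e) * (Y b * U e) := by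
    intro X Z
    rw [ctr4_eq_sum, Finset.sum_comm]
    refine Finset.sum_congr rfl fun b _ => ?_
    rw [Finset.sum_congr rfl fun b _ => Finset.sum_comm, Finset.sum_comm]
    refine Finset.sum_congr rfl fun e _ => ?_
    simp only [Finset.sum_mul]
    exact Finset.sum_congr rfl fun a _ => Finset.sum_congr rfl fun c _ => by ring
  simp only [h, ← Finset.sum_add_distrib, ← Finset.sum_sub_distrib, ← add_mul, ← sub_mul, ← hG,
    hW.trace, zero_mul, Finset.sum_const_zero]

end IsWeylLike

lemma ctr4_add₁ (X X' Y Z U : Fin 4 → A) :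
    ctr4 W (X + X') Y Z U = ctr4 W X Y Z U + ctr4 W X' Y Z U := ctr_add_right _ _ _

lemma ctr4_smul₁ (f : A) (X Y Z U : Fin 4 → A) :
    ctr4 W (f • X) Y Z U = f * ctr4 W X Y Z U := ctr_smul_right _ _ _

lemma ctr4_add₂ (X Y Y' Z U : Fin 4 → A) :
    ctr4 W X (Y + Y') Z U = ctr4 W X Y Z U + ctr4 W X Y' Z U := by
  simp only [ctr4, ctr_add_right, ctr_add_left]

lemma ctr4_smul₂ (f : A) (X Y Z U : Fin 4 → A) :
    ctr4 W X (f • Y) Z U = f * ctr4 W X Y Z U := by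
  simp only [ctr4, ctr_smul_right, ctr_mul_left]

lemma ctr4_add₃ (X Y Z Z' U : Fin 4 → A) :
    ctr4 W X Y (Z + Z') U = ctr4 W X Y Z U + ctr4 W X Y Z' U := by
  simp only [ctr4, ctr_add_right, ctr_add_left]

lemma ctr4_smul₃ (f : A) (X Y Z U : Fin 4 → A) :
    ctr4 W X Y (f • Z) U = f * ctr4 W X Y Z U := by
  simp only [ctr4, ctr_smul_right, ctr_mul_left]

lemma ctr4_add₄ (X Y Z U U' : Fin 4 → A) :
    ctr4 W X Y Z (U + U') = ctr4 W X Y Z U + ctr4 W X Y Z U' := by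
  simp only [ctr4, ctr_add_right, ctr_add_left]

lemma ctr4_smul₄ (f : A) (X Y Z U : Fin 4 → A) :
    ctr4 W X Y Z (f • U) = f * ctr4 W X Y Z U := by
  simp only [ctr4, ctr_smul_right, ctr_mul_left]


variable [Algebra ℂ A]

/-- The bracket `[v, X]` of vector fields. -/
def vbr (d : Fin 4 → Derivation ℂ A A) (v X : Fin 4 → A) (a : Fin 4) : A :=
  vder d v (X a) - ∑ k, jac d v a k * X k

variable {d : Fin 4 → Derivation ℂ A A} {v : Fin 4 → A}

/-- The Leibniz rule for one slot. The remainder `R` carries the action of `v` on indices that are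
not yet contracted, so the four slots of a tensor can be treated one after the other. -/
lemma ctr_lie {S R : Fin 4 → A} (X : Fin 4 → A)
    (hS : ∀ a, vder d v (S a) = R a - ∑ k, jac d v k a * S k) :
    vder d v (ctr S X) = ctr R X + ctr S (vbr d v X) := by
  have h : ctr (fun a => ∑ k, jac d v k a * S k) X = ∑ a, S a * ∑ k, jac d v a k * X k := by
    simp only [ctr, Finset.sum_mul, Finset.mul_sum]
    rw [Finset.sum_comm]
    exact Finset.sum_congr rfl fun k _ => Finset.sum_congr rfl fun i _ => by ring
  have h2 : vder d v (ctr S X) = ctr (fun a => vder d v (S a)) X + ∑ a, S a * vder d v (X a) := by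
    simp only [ctr, map_sum, Derivation.leibniz, smul_eq_mul, ← Finset.sum_add_distrib]
    exact Finset.sum_congr rfl fun k _ => by ring
  rw [h2]
  simp only [hS, ctr_sub_left, h]
  simp only [ctr, vbr, mul_sub, Finset.sum_sub_distrib]
  ring

lemma ctr4_lie {W : Fin 4 → Fin 4 → Fin 4 → Fin 4 → A}
    (hW : ∀ a b c e, vder d v (W a b c e) =
      -∑ k, (jac d v k a * W k b c e + jac d v k b * W a k c e
        + jac d v k c * W a b k e + jac d v k e * W a b c k)) (X Y Z U : Fin 4 → A) :
    vder d v (ctr4 W X Y Z U) = ctr4 W (vbr d v X) Y Z U + ctr4 W X (vbr d v Y) Z U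
      + ctr4 W X Y (vbr d v Z) U + ctr4 W X Y Z (vbr d v U) := by
  have h1 : ∀ a b c, vder d v (ctr (fun e => W a b c e) U) =
      ctr (fun e => W a b c e) (vbr d v U)
        - ∑ k, jac d v k a * ctr (fun e => W k b c e) U
        - ∑ k, jac d v k b * ctr (fun e => W a k c e) U
        - ∑ k, jac d v k c * ctr (fun e => W a b k e) U := by
    intro a b c
    rw [ctr_lie (R := fun e => -(∑ k, jac d v k a * W k b c e) - (∑ k, jac d v k b * W a k c e)
      - ∑ k, jac d v k c * W a b k e)]
    · simp only [ctr_sub_left, ctr_neg_left, ctr_sum_left]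
      ring
    · intro e
      rw [hW]; simp only [Finset.sum_add_distrib]; ring
  have h2 : ∀ a b, vder d v (ctr (fun c => ctr (fun e => W a b c e) U) Z) =
      ctr (fun c => ctr (fun e => W a b c e) (vbr d v U)) Z
        + ctr (fun c => ctr (fun e => W a b c e) U) (vbr d v Z)
        - ∑ k, jac d v k a * ctr (fun c => ctr (fun e => W k b c e) U) Z
        - ∑ k, jac d v k b * ctr (fun c => ctr (fun e => W a k c e) U) Z := by
    intro a b
    rw [ctr_lie Z (h1 a b)]
    simp only [ctr_sub_left, ctr_sum_left]
    ring
  have h3 : ∀ a, vder d v (ctr (fun b => ctr (fun c => ctr (fun e => W a b c e) U) Z) Y) =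
      ctr (fun b => ctr (fun c => ctr (fun e => W a b c e) (vbr d v U)) Z) Y
        + ctr (fun b => ctr (fun c => ctr (fun e => W a b c e) U) (vbr d v Z)) Y
        + ctr (fun b => ctr (fun c => ctr (fun e => W a b c e) U) Z) (vbr d v Y)
        - ∑ k, jac d v k a * ctr (fun b => ctr (fun c => ctr (fun e => W k b c e) U) Z) Y := by
    intro a
    rw [ctr_lie Y (h2 a)]
    simp only [ctr_sub_left, ctr_add_left, ctr_sum_left]
    ring
  rw [ctr4, ctr_lie X h3]
  simp only [ctr_add_left, ctr4]
  ring


/-- The brackets of a Killing field with a null tetrad. -/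
structure KillingBrackets (d : Fin 4 → Derivation ℂ A A) (v l n m mb : Fin 4 → A)
    (α β γ αb βb A' : A) : Prop where
  bracket_l : vbr d v l = A' • l + (βb • m + β • mb)
  bracket_n : vbr d v n = (-A') • n + (αb • m + α • mb)
  bracket_m : vbr d v m = α • l + (β • n + γ • m)
  bracket_mb : vbr d v mb = αb • l + (βb • n + (-γ) • mb)

section Psi

variable {l n m mb : Fin 4 → A} {α β γ αb βb A' : A}
  (hB : KillingBrackets d v l n m mb α β γ αb βb A')
  (hG : ∀ i j, G i j = l i * n j + n i * l j - m i * mb j - mb i * m j)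
  (hW : IsWeylLike G W)
  (hLW : ∀ a b c e, vder d v (W a b c e) =
      -∑ k, (jac d v k a * W k b c e + jac d v k b * W a k c e
        + jac d v k c * W a b k e + jac d v k e * W a b c k))

include hB hG hW hLW

/-- As the tensor is invariant, only the brackets of the tetrad contribute. Antisymmetry removes the
components along the other vector of each pair, and the trace identity identifies the component `m̄
m l m` with `Ψ₁`, which doubles its coefficient. -/
lemma psi0_lie : vder d v (ctr4 W l m l m) =
    2 * (A' + γ) * ctr4 W l m l m + 4 * β * ctr4 W l n l m := by
  have h0 := fun X Z U => hW.ctr4_self_left X Z U fun x => eq_zero_of_two_mul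
  have h0' := fun X Z U => hW.ctr4_self_right X Z U fun x => eq_zero_of_two_mul
  rw [ctr4_lie hLW, hB.bracket_l, hB.bracket_m]
  simp only [ctr4_add₁, ctr4_smul₁, ctr4_add₂, ctr4_smul₂, ctr4_add₃, ctr4_smul₃, ctr4_add₄,
    ctr4_smul₄, h0, h0', mul_zero, zero_add]
  have t1 := hW.ctr4_trace hG m l
  rw [h0' l, h0 m, hW.ctr4_swap_right l m n l, hW.ctr4_pair l m l n,
    hW.ctr4_swap_right mb m m l] at t1
  rw [hW.ctr4_pair l m mb m, hW.ctr4_pair l m l n]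
  linear_combination (2 * β) * t1

/-- Besides antisymmetry this needs two components that vanish by tracelessness, `l m̄ l m` and `m n
l m`. The trace and Bianchi identities then express all the others through `Ψ₂`. -/
lemma psi1_lie : vder d v (ctr4 W l n l m) =
    (A' + γ) * ctr4 W l n l m + 3 * β * ctr4 W l m mb n + αb * ctr4 W l m l m := by
  have h0 := fun X Z U => hW.ctr4_self_left X Z U fun x => eq_zero_of_two_mul
  have h0' := fun X Z U => hW.ctr4_self_right X Z U fun x => eq_zero_of_two_mul
  rw [ctr4_lie hLW, hB.bracket_l, hB.bracket_m, hB.bracket_n]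
  simp only [ctr4_add₁, ctr4_smul₁, ctr4_add₂, ctr4_smul₂, ctr4_add₃, ctr4_smul₃, ctr4_add₄,
    ctr4_smul₄, h0', mul_zero, zero_add]
  have t1 : ctr4 W l mb l m = 0 := by
    have t := hW.ctr4_trace hG l l
    rw [h0, h0', hW.ctr4_swap m l mb l, hW.ctr4_swap_right l m mb l, hW.ctr4_pair l m l mb,
      hW.ctr4_swap mb l m l, hW.ctr4_swap_right l mb m l] at t
    exact eq_zero_of_two_mul (by linear_combination -t)
  have t2 : ctr4 W m n l m = 0 := by
    have t := hW.ctr4_trace hG m m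
    rw [h0, h0', hW.ctr4_pair l m n m] at t
    have : ctr4 W n m l m = 0 := eq_zero_of_two_mul (by linear_combination t)
    rw [hW.ctr4_swap, this, neg_zero]
  have t3 := hW.ctr4_trace hG l n
  rw [h0, hW.ctr4_swap n l l n, hW.ctr4_swap m l mb n, hW.ctr4_swap mb l m n] at t3
  have t4 := hW.ctr4_bianchi l n mb m
  rw [hW.ctr4_swap_right l m n mb] at t4
  rw [t1, t2, hW.ctr4_swap_right mb n l m, hW.ctr4_swap mb n m l,
    hW.ctr4_pair n mb m l, hW.ctr4_swap m l n mb, hW.ctr4_swap_right l m n mb]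
  linear_combination β * t4 - β * t3

/-- `Ψ₂` has neither boost nor spin weight, so the `A'` and `γ` contributions cancel and no
homogeneous term remains. -/
lemma psi2_lie : vder d v (ctr4 W l m mb n) =
    2 * β * ctr4 W l n mb n + 2 * αb * ctr4 W l n l m := by
  have h0 := fun X Z U => hW.ctr4_self_left X Z U fun x => eq_zero_of_two_mul
  have h0' := fun X Z U => hW.ctr4_self_right X Z U fun x => eq_zero_of_two_mul
  rw [ctr4_lie hLW, hB.bracket_l, hB.bracket_m, hB.bracket_n, hB.bracket_mb]
  simp only [ctr4_add₁, ctr4_smul₁, ctr4_add₂, ctr4_smul₂, ctr4_add₃, ctr4_smul₃, ctr4_add₄,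
    ctr4_smul₄, h0, h0', mul_zero, add_zero, zero_add]
  have t1 := hW.ctr4_trace hG m l
  rw [h0' l, h0 m, hW.ctr4_swap_right l m n l, hW.ctr4_pair l m l n,
    hW.ctr4_swap_right mb m m l] at t1
  have t2 := hW.ctr4_trace hG mb n
  rw [h0' n, h0 mb, hW.ctr4_pair n mb l n, hW.ctr4_swap_right l n n mb,
    hW.ctr4_swap m mb mb n] at t2
  rw [hW.ctr4_pair l m mb m, hW.ctr4_pair l m l n]
  linear_combination αb * t1 + β * t2

end Psi

end AlgebraFrames

end

/-! ### Brackets of a Killing field with the tetrad -/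

section

section AlgebraTetrad

open Matrix

variable {A : Type*} [CommRing A]

/-- The components of the metric in a null tetrad. -/
def nullEta : Matrix (Fin 4) (Fin 4) A :=
  !![0, 1, 0, 0; 1, 0, 0, 0; 0, 0, 0, -1; 0, 0, -1, 0]

lemma nullEta_mul_self : (nullEta : Matrix (Fin 4) (Fin 4) A) * nullEta = 1 := by
  ext i j
  fin_cases i <;> fin_cases j <;> simp [nullEta, Matrix.mul_apply, Fin.sum_univ_four]

lemma nullEta_transpose : (nullEta : Matrix (Fin 4) (Fin 4) A)ᵀ = nullEta := by
  ext i j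
  fin_cases i <;> fin_cases j <;> simp [nullEta]

/-- The matrix whose rows are the tetrad vectors. -/
def frame (U C0 C1 x0 x1 y0 y1 : A) : Matrix (Fin 4) (Fin 4) A :=
  !![0, 1, 0, 0; 1, U, C0, C1; 0, 0, x0, x1; 0, 0, y0, y1]

lemma isUnit_frame {U C0 C1 x0 x1 y0 y1 : A} (h : IsUnit (x0 * y1 - x1 * y0)) :
    IsUnit (frame U C0 C1 x0 x1 y0 y1) := by
  rw [Matrix.isUnit_iff_isUnit_det]
  have : (frame U C0 C1 x0 x1 y0 y1).det = -(x0 * y1 - x1 * y0) := by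
    simp [frame, Matrix.det_succ_row_zero, Fin.sum_univ_succ, Fin.succAbove]
    ring
  rw [this]; exact h.neg

variable {E g : Matrix (Fin 4) (Fin 4) A} (hE : IsUnit E)
  (hGg : Eᵀ * nullEta * E * g = 1)

include hE hGg in
lemma frame_mul_metric : E * g * Eᵀ = nullEta := by
  obtain ⟨F, hEF⟩ := hE.exists_right_inv
  have hFE : F * E = 1 := mul_eq_one_comm.mp hEF
  have h1 : g * (Eᵀ * nullEta * E) = 1 := mul_eq_one_comm.mp hGg
  calc E * g * Eᵀ = E * (g * (Eᵀ * nullEta * E)) * F * nullEta := by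
        have : E * (g * (Eᵀ * nullEta * E)) * F * nullEta
          = E * g * Eᵀ * (nullEta * (E * F) * nullEta) := by noncomm_ring
        rw [this, hEF, mul_one, nullEta_mul_self, mul_one]
    _ = nullEta := by rw [h1, mul_one, hEF, one_mul]

variable [Algebra ℂ A] {d : Fin 4 → Derivation ℂ A A} {v : Fin 4 → A}

include hE hGg in
-- Let `Λ` be the matrix of the brackets in the tetrad. Invariance of the inverse metric `Eᵀ η E`
-- says `Λᵀ η + η Λ = 0`, so `Λ` lies in the Lorentz algebra, and six of its entries determine the
-- rest.
lemma exists_killingBrackets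
    (hK : dmat (vder d v) g = -((jac d v)ᵀ * g + g * jac d v)) :
    ∃ α β γ αb βb A', KillingBrackets d v (E 0) (E 1) (E 2) (E 3) α β γ αb βb A' := by
  have hi := inv_lie hGg hK
  have hη : dmat (vder d v) nullEta = 0 := by
    ext i j
    fin_cases i <;> fin_cases j <;> simp [nullEta, dmat_apply]
  rw [dmat_mul, dmat_mul, hη, dmat_transpose] at hi
  obtain ⟨Z, hZ⟩ : ∃ Z, Z = dmat (vder d v) E - E * (jac d v)ᵀ := ⟨_, rfl⟩
  have hDE : dmat (vder d v) E = Z + E * (jac d v)ᵀ := by rw [hZ]; abel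
  obtain ⟨F, hEF⟩ := hE.exists_right_inv
  have hFE : F * E = 1 := mul_eq_one_comm.mp hEF
  obtain ⟨Λ, hZΛ⟩ : ∃ Λ, Z = Λ * E := ⟨Z * F, by rw [mul_assoc, hFE, mul_one]⟩
  rw [hDE, hZΛ, transpose_add, transpose_mul, transpose_mul, transpose_transpose] at hi
  have h1 : Eᵀ * (Λᵀ * nullEta + nullEta * Λ) * E = 0 := by
    linear_combination (norm := noncomm_ring) hi
  have hEF' : Fᵀ * Eᵀ = 1 := by rw [← transpose_mul, hEF, transpose_one]
  have h2 : Λᵀ * nullEta + nullEta * Λ = 0 := by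
    calc Λᵀ * nullEta + nullEta * Λ
        = (Fᵀ * Eᵀ) * (Λᵀ * nullEta + nullEta * Λ) * (E * F) := by
          rw [hEF, hEF', one_mul, mul_one]
      _ = Fᵀ * (Eᵀ * (Λᵀ * nullEta + nullEta * Λ) * E) * F := by noncomm_ring
      _ = 0 := by rw [h1, mul_zero, zero_mul]
  have ent := fun i j => congrFun (congrFun h2 i) j
  have e00 := ent 0 0
  have e11 := ent 1 1
  have e22 := ent 2 2
  have e33 := ent 3 3
  have e01 := ent 0 1
  have e02 := ent 0 2
  have e03 := ent 0 3
  have e12 := ent 1 2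
  have e13 := ent 1 3
  have e23 := ent 2 3
  simp only [Matrix.add_apply, Matrix.mul_apply, Fin.sum_univ_four, transpose_apply,
    Matrix.zero_apply] at e00 e11 e22 e33 e01 e02 e03 e12 e13 e23
  simp [nullEta] at e00 e11 e22 e33 e01 e02 e03 e12 e13 e23
  have z00 : Λ 1 0 = 0 := eq_zero_of_two_mul (by linear_combination e00)
  have z11 : Λ 0 1 = 0 := eq_zero_of_two_mul (by linear_combination e11)
  have z22 : Λ 3 2 = 0 := eq_zero_of_two_mul (by linear_combination -e22)
  have z33 : Λ 2 3 = 0 := eq_zero_of_two_mul (by linear_combination -e33)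
  have hrow : ∀ i, vbr d v (E i) =
      Λ i 0 • E 0 + Λ i 1 • E 1 + Λ i 2 • E 2 + Λ i 3 • E 3 := by
    intro i
    ext a
    have := congrFun (congrFun hZΛ i) a
    simp only [hZ, Matrix.sub_apply, dmat_apply, Matrix.mul_apply, Fin.sum_univ_four,
      transpose_apply] at this
    simp only [vbr, Fin.sum_univ_four, Pi.add_apply, Pi.smul_apply, smul_eq_mul]
    linear_combination this
  refine ⟨Λ 2 0, Λ 2 1, Λ 2 2, Λ 3 0, Λ 3 1, Λ 0 0, ?_, ?_, ?_, ?_⟩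
  · rw [hrow, z11, (by linear_combination e12 : Λ 0 2 = Λ 3 1),
      (by linear_combination e13 : Λ 0 3 = Λ 2 1)]
    module
  · rw [hrow, z00, (by linear_combination e01 : Λ 1 1 = -Λ 0 0),
      (by linear_combination e02 : Λ 1 2 = Λ 3 0), (by linear_combination e03 : Λ 1 3 = Λ 2 0)]
    module
  · rw [hrow, z33]; module
  · rw [hrow, z22, (by linear_combination -e23 : Λ 3 3 = -Λ 2 2)]; module

end AlgebraTetrad

/-! ### The shear as a structure function of the tetrad, and its evolution -/

section AlgebraShear

open Matrix

variable {A : Type*} [CommRing A] [Algebra ℂ A] {d : Fin 4 → Derivation ℂ A A}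
  (hd : ∀ i j f, d i (d j f) = d j (d i f)) {v : Fin 4 → A}

include hd in
lemma vder_vbr (v X : Fin 4 → A) (f : A) :
    vder d v (vder d X f) = vder d X (vder d v f) + vder d (vbr d v X) f := by
  simp only [vder_apply, Fin.sum_univ_four, vbr, map_add, Derivation.leibniz, smul_eq_mul, jac,
    hd 1 0, hd 2 0, hd 3 0, hd 2 1, hd 3 1, hd 3 2]
  ring

lemma vder_add (X Y : Fin 4 → A) (f : A) : vder d (X + Y) f = vder d X f + vder d Y f := by
  simp only [vder_apply, Pi.add_apply, add_mul, Finset.sum_add_distrib]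

lemma vder_smul (a : A) (X : Fin 4 → A) (f : A) : vder d (a • X) f = a * vder d X f := by
  simp only [vder_apply, Pi.smul_apply, smul_eq_mul, mul_assoc, Finset.mul_sum]

variable {U C0 C1 x0 x1 y0 y1 : A} {α β γ αb βb A' ρ σ μ' μ κ ν' ν : A}

include hd in
/-- The evolution of the shear `σ`, the `m̄` component of `[l, m]`, along a Killing field. -/
lemma shear_lie (z : Fin 4 → A) (hz : ∀ i j, d i (z j) = if i = j then 1 else 0)
    (hΔ : IsUnit (x0 * y1 - x1 * y0)) {l n m mb : Fin 4 → A}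
    (hl : l = ![0, 1, 0, 0]) (hn : n = ![1, U, C0, C1]) (hm : m = ![0, 0, x0, x1])
    (hmb : mb = ![0, 0, y0, y1])
    (hB : KillingBrackets d v l n m mb α β γ αb βb A')
    (hlm : vbr d l m = ρ • m + σ • mb) (hmbm : vbr d mb m = μ' • m + μ • mb)
    (hln : vbr d l n = κ • l + (ν' • m + ν • mb)) :
    vder d v σ = (A' + 2 * γ) * σ - vder d m β + β * μ + β * ν := by
  -- The Jacobi identity for `v`, `l`, `m`, applied to `f` and expanded in the tetrad.
  have key : ∀ f, (vder d v σ - ((A' + 2 * γ) * σ - vder d m β + β * μ + β * ν)) * vder d mb f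
      + (vder d v ρ - (A' * ρ - vder d m βb + β * μ' + vder d l γ + β * ν')) * vder d m f
      + (vder d m A' + ρ * α + σ * αb - vder d l α - β * κ) * vder d l f
      + (ρ * β + σ * βb - vder d l β) * vder d n f = 0 := by
    intro f
    have Ll := fun f => vder_vbr hd v l f
    have Lm := fun f => vder_vbr hd v m f
    have Lmb := fun f => vder_vbr hd v mb f
    have Llm := fun f => vder_vbr hd l m f
    have Lmbm := fun f => vder_vbr hd mb m f
    have Lln := fun f => vder_vbr hd l n f
    simp only [hB.bracket_l, hB.bracket_m, hB.bracket_mb, hlm, hmbm, hln, vder_add, vder_smul]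
      at Ll Lm Lmb Llm Lmbm Lln
    have J := congrArg (vder d v) (Llm f)
    have J2 := congrArg (vder d l) (Lm f)
    have J4 := congrArg (vder d m) (Ll f)
    simp only [map_add, Derivation.leibniz, smul_eq_mul] at J J2 J4
    linear_combination -J + Ll (vder d m f) + J2 + Llm (vder d v f) - Lm (vder d l f) - J4
      + (A' + γ) * Llm f + β * Lmbm f + β * Lln f - ρ * Lm f - σ * Lmb f
  have kz : ∀ X : Fin 4 → A, ∀ i, vder d X (z i) = X i := by
    intro X i; simp [vder_apply, hz]
  -- Testing on `u` kills the coefficient of `n`, the only tetrad vector with a `∂_u` component.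
  -- Testing on the two angles, where `l` does not contribute, leaves a linear system for the
  -- coefficients of `m̄` and `m` whose determinant is a unit.
  have k0 := key (z 0)
  have k2 := key (z 2)
  have k3 := key (z 3)
  simp only [kz, hl, hn, hm, hmb] at k0 k2 k3
  simp at k0 k2 k3
  rw [k0] at k2 k3
  rw [hm]
  refine sub_eq_zero.mp (hΔ.mul_left_eq_zero.mp ?_)
  linear_combination x0 * k3 - x1 * k2

/-- The components of the brackets of a Killing field with a null tetrad. -/
lemma KillingBrackets.components {U x0 x1 y0 y1 : A} {C0 C1 α β γ αb βb A' : A}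
    (hB : KillingBrackets d v ![0, 1, 0, 0] ![1, U, C0, C1] ![0, 0, x0, x1] ![0, 0, y0, y1]
      α β γ αb βb A') :
    (d 1 (v 0) = 0 ∧ d 1 (v 1) = -A' ∧ d 1 (v 2) = -(βb * x0 + β * y0) ∧
      d 1 (v 3) = -(βb * x1 + β * y1)) ∧
    (vder d ![1, U, C0, C1] (v 0) = A' ∧
      vder d v U - vder d ![1, U, C0, C1] (v 1) = -A' * U ∧
      vder d v C0 - vder d ![1, U, C0, C1] (v 2) = -A' * C0 + αb * x0 + α * y0 ∧
      vder d v C1 - vder d ![1, U, C0, C1] (v 3) = -A' * C1 + αb * x1 + α * y1) ∧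
    (vder d ![0, 0, x0, x1] (v 0) = -β ∧ vder d ![0, 0, x0, x1] (v 1) = -(α + β * U) ∧
      vder d v x0 - vder d ![0, 0, x0, x1] (v 2) = β * C0 + γ * x0 ∧
      vder d v x1 - vder d ![0, 0, x0, x1] (v 3) = β * C1 + γ * x1) ∧
    (vder d ![0, 0, y0, y1] (v 0) = -βb ∧ vder d ![0, 0, y0, y1] (v 1) = -(αb + βb * U) ∧
      vder d v y0 - vder d ![0, 0, y0, y1] (v 2) = βb * C0 - γ * y0 ∧
      vder d v y1 - vder d ![0, 0, y0, y1] (v 3) = βb * C1 - γ * y1) := by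
  have hv : ∀ (X : Fin 4 → A) (i : Fin 4),
      vbr d v X i = vder d v (X i) - vder d X (v i) := by
    intro X i
    simp only [vbr, vder_apply, jac, mul_comm]
  have L := fun i => (hv _ i).symm.trans (congrFun hB.bracket_l i)
  have N := fun i => (hv _ i).symm.trans (congrFun hB.bracket_n i)
  have M := fun i => (hv _ i).symm.trans (congrFun hB.bracket_m i)
  have MB := fun i => (hv _ i).symm.trans (congrFun hB.bracket_mb i)
  have hl : ∀ f, vder d ![0, 1, 0, 0] f = d 1 f := by
    intro f; simp [vder_apply, Fin.sum_univ_four]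
  have L0 := L 0
  have L1 := L 1
  have L2 := L 2
  have L3 := L 3
  have N0 := N 0
  have N1 := N 1
  have N2 := N 2
  have N3 := N 3
  have M0 := M 0
  have M1 := M 1
  have M2 := M 2
  have M3 := M 3
  have B0 := MB 0
  have B1 := MB 1
  have B2 := MB 2
  have B3 := MB 3
  simp [hl] at L0 L1 L2 L3 N0 N1 N2 N3 M0 M1 M2 M3 B0 B1 B2 B3
  refine ⟨⟨?_, ?_, ?_, ?_⟩, ⟨?_, ?_, ?_, ?_⟩, ⟨?_, ?_, ?_, ?_⟩, ⟨?_, ?_, ?_, ?_⟩⟩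
  · linear_combination L0
  · linear_combination -L1
  · linear_combination -L2
  · linear_combination -L3
  · linear_combination N0
  · linear_combination N1
  · linear_combination N2
  · linear_combination N3
  · linear_combination -M0
  · linear_combination -M1
  · linear_combination M2
  · linear_combination M3
  · linear_combination -B0
  · linear_combination -B1
  · linear_combination B2
  · linear_combination B3

variable {g : Matrix (Fin 4) (Fin 4) A} (hg : ∀ i j, g i j = g j i)

include hg in
/-- The shear `mᵃ mᵇ ∇_b l_a` is the `m̄` component of `[l, m]`. -/
lemma shear_eq (hΔ : IsUnit (x0 * y1 - x1 * y0)) {E G : Matrix (Fin 4) (Fin 4) A}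
    (hEdef : E = frame U C0 C1 x0 x1 y0 y1) (hGdef : G = Eᵀ * nullEta * E) (hGg : G * g = 1)
    (hlm : vbr d ![0, 1, 0, 0] ![0, 0, x0, x1] = ρ • ![0, 0, x0, x1] + σ • ![0, 0, y0, y1]) :
    ∑ a, ∑ b, E 2 a * E 2 b * (d b (g a 1) - ∑ c, chr d g G b c a * g c 1) = σ := by
  have hE : IsUnit E := hEdef ▸ isUnit_frame hΔ
  have hη := frame_mul_metric (g := g) hE (hGdef ▸ hGg)
  have hgG : g * G = 1 := mul_eq_one_comm.mp hGg
  have hG0 : ∀ i, G i 0 = if i = 1 then 1 else 0 := by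
    intro i
    rw [hGdef, hEdef]
    fin_cases i <;> simp [Matrix.mul_apply, frame, nullEta, Fin.sum_univ_four]
  -- The covector of `l` is `du`, with constant components, so that `∇_b l_a` reduces to `½ ∂_r
  -- g_{ab}`.
  have hg1 : ∀ a, g a 1 = if a = 0 then 1 else 0 := by
    intro a
    have := congrFun (congrFun hgG a) 0
    simpa [Matrix.mul_apply, hG0, Matrix.one_apply] using this
  have hd1 : ∀ b a, d b (g a 1) = 0 := by
    intro b a; rw [hg1]; split_ifs <;> simp
  have hG0' : ∀ i, G 0 i = if i = 1 then 1 else 0 := by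
    intro i
    rw [symm_of_mul_eq_one hGg hg, hG0]
  have hc : ∀ a b, ∑ c, chr d g G b c a * g c 1 = -(half * d 1 (g a b)) := by
    intro a b
    simp only [hg1, mul_ite, mul_one, mul_zero, Finset.sum_ite_eq', Finset.mem_univ, if_true]
    rw [chr, Matrix.mul_apply]
    simp only [hG0', ite_mul, one_mul, zero_mul, Finset.sum_ite_eq', Finset.mem_univ, if_true,
      chrLow, hd1, hg 1 a, hg 1 b, hg b a]
    simp
  have h2 : ∀ a, d 1 (E 2 a) = ρ * E 2 a + σ * E 3 a := by
    intro a
    have := congrFun hlm a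
    rw [hEdef]
    fin_cases a <;> simpa [vbr, vder_apply, jac, frame, Fin.sum_univ_four, dmat_apply] using this
  -- Differentiating `g(m, m) = 0` in `r` trades `½ mᵃmᵇ ∂_r g_{ab}` for `-g(m, ∂_r m)`. As `∂_r m =
  -- ρ m + σ m̄` and `g(m, m̄) = -1`, what is left is `σ`.
  have hm0 := congrArg (d 1) (congrFun (congrFun hη 2) 2)
  have hm1 := congrFun (congrFun hη 2) 2
  have hm2 := congrFun (congrFun hη 2) 3
  simp only [hc, hd1]
  simp only [Matrix.mul_apply, Fin.sum_univ_four, transpose_apply, map_add, Derivation.leibniz,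
    smul_eq_mul, h2, nullEta] at hm0 hm1 hm2 ⊢
  simp at hm0 hm1 hm2 ⊢
  simp only [hg 1 0, hg 2 0, hg 3 0, hg 2 1, hg 3 1, hg 3 2] at *
  linear_combination half * hm0 - 2 * half * ρ * hm1 - 2 * half * σ * hm2
    + σ * two_mul_half (A := A)

end AlgebraShear

end

/-! ### Calculus of partial derivatives -/

section PartialDerivatives

variable {n : ℕ} {E : Type*} [NormedAddCommGroup E] [NormedSpace ℝ E]
  {f g : (Fin n → ℝ) → E} {x : Fin n → ℝ}

lemma pd_congr {i : Fin n} (h : f =ᶠ[𝓝 x] g) : pd i f x = pd i g x := by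
  rw [pd, pd, h.fderiv_eq]

lemma pd_add (i : Fin n) (hf : DifferentiableAt ℝ f x) (hg : DifferentiableAt ℝ g x) :
    pd i (fun y => f y + g y) x = pd i f x + pd i g x := by
  simp [pd, fderiv_fun_add hf hg]

lemma pd_sub (i : Fin n) (hf : DifferentiableAt ℝ f x) (hg : DifferentiableAt ℝ g x) :
    pd i (fun y => f y - g y) x = pd i f x - pd i g x := by
  simp [pd, fderiv_fun_sub hf hg]

lemma pd_const (i : Fin n) (c : E) : pd i (fun _ => c) x = 0 := by
  simp [pd]

lemma pd_mul {f g : (Fin n → ℝ) → ℂ} (i : Fin n) (hf : DifferentiableAt ℝ f x)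
    (hg : DifferentiableAt ℝ g x) :
    pd i (fun y => f y * g y) x = pd i f x * g x + f x * pd i g x := by
  simp [pd, fderiv_fun_mul hf hg]; ring

lemma pd_const_mul {f : (Fin n → ℝ) → ℂ} (i : Fin n) (c : ℂ) (hf : DifferentiableAt ℝ f x) :
    pd i (fun y => c * f y) x = c * pd i f x := by
  rw [pd_mul i (differentiableAt_const c) hf, pd_const, zero_mul, zero_add]

lemma pd_ofReal (i : Fin n) (f : (Fin n → ℝ) → ℝ) :
    pd i (fun y => (f y : ℂ)) x = ((pd i f x : ℝ) : ℂ) := by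
  by_cases hf : DifferentiableAt ℝ f x
  · have := (Complex.ofRealCLM.hasFDerivAt (x := f x)).comp x hf.hasFDerivAt
    rw [pd, show fderiv ℝ (fun y => (f y : ℂ)) x = _ from this.fderiv]
    rfl
  -- Without differentiability both sides take the default value zero, so no hypothesis on `f` is
  -- needed.
  · have h2 : ¬ DifferentiableAt ℝ (fun y => (f y : ℂ)) x := fun h =>
      hf (Complex.reCLM.differentiableAt.comp x h)
    simp [pd, fderiv_zero_of_not_differentiableAt hf, fderiv_zero_of_not_differentiableAt h2]

lemma pd_conj (i : Fin n) (f : (Fin n → ℝ) → ℂ) :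
    pd i (fun y => starRingEnd ℂ (f y)) x = starRingEnd ℂ (pd i f x) := by
  have := Complex.conjCLE.comp_fderiv (f := f) (x := x)
  rw [pd, show (fun y => starRingEnd ℂ (f y)) = Complex.conjCLE ∘ f from rfl, this]
  rfl

lemma pd_re (i : Fin n) {f : (Fin n → ℝ) → ℂ} (hf : DifferentiableAt ℝ f x) :
    pd i (fun y => (f y).re) x = (pd i f x).re := by
  have := (Complex.reCLM.hasFDerivAt (x := f x)).comp x hf.hasFDerivAt
  rw [pd, show fderiv ℝ (fun y => (f y).re) x = _ from this.fderiv]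
  rfl

lemma contDiffOn_pd {s : Set (Fin n → ℝ)} (hs : IsOpen s) (hf : ContDiffOn ℝ ∞ f s) (i : Fin n) :
    ContDiffOn ℝ ∞ (pd i f) s :=
  (hf.fderiv_of_isOpen hs (m := ∞) (by simp)).clm_apply contDiffOn_const

lemma pd_comm (hf : ContDiffAt ℝ ∞ f x) (i j : Fin n) :
    pd i (pd j f) x = pd j (pd i f) x := by
  have hsymm : IsSymmSndFDerivAt ℝ f x := hf.isSymmSndFDerivAt (by
    rw [minSmoothness_of_isRCLikeNormedField]; exact WithTop.coe_le_coe.mpr (le_top : (2 : ℕ∞) ≤ ⊤))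
  have hd : DifferentiableAt ℝ (fderiv ℝ f) x :=
    (hf.fderiv_right (m := 1) (by norm_cast)).differentiableAt (by simp)
  have h : ∀ i j : Fin n, pd i (pd j f) x =
      fderiv ℝ (fderiv ℝ f) x (Pi.single i 1) (Pi.single j 1) := by
    intro i j
    have := fderiv_clm_apply hd (differentiableAt_const (Pi.single j (1 : ℝ) : Fin n → ℝ))
    rw [pd, show pd j f = fun y => fderiv ℝ f y (Pi.single j 1) from rfl, this]
    simp
  rw [h, h, hsymm.eq]

end PartialDerivatives

/-! ### The ring of smooth functions on an open set -/

section SmoothRing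

/-- Smooth complex functions on a subset of the spacetime. -/
def Sm (Ω : Set ST) : Subalgebra ℂ (Ω → ℂ) where
  carrier := {f | ∃ F : ST → ℂ, ContDiffOn ℝ ∞ F Ω ∧ ∀ x : Ω, f x = F x}
  mul_mem' := by
    rintro f g ⟨F, hF, hf⟩ ⟨G, hG, hg⟩
    exact ⟨fun x => F x * G x, hF.mul hG, fun x => by simp [hf, hg]⟩
  add_mem' := by
    rintro f g ⟨F, hF, hf⟩ ⟨G, hG, hg⟩
    exact ⟨fun x => F x + G x, hF.add hG, fun x => by simp [hf, hg]⟩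
  algebraMap_mem' := fun z => ⟨fun _ => z, contDiffOn_const, fun x => rfl⟩

namespace Sm

variable {Ω : Set ST}

/-- The restriction to `Ω` of a function that is smooth there. -/
def mk (F : ST → ℂ) (hF : ContDiffOn ℝ ∞ F Ω) : Sm Ω := ⟨fun x => F x, F, hF, fun _ => rfl⟩

/-- Evaluation at a point. -/
def ev {x : ST} (hx : x ∈ Ω) : Sm Ω →ₐ[ℂ] ℂ :=
  (Pi.evalAlgHom ℂ (fun _ : Ω => ℂ) ⟨x, hx⟩).comp (Sm Ω).val

@[simp] lemma ev_mk (F : ST → ℂ) (hF : ContDiffOn ℝ ∞ F Ω) {x : ST} (hx : x ∈ Ω) :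
    ev hx (mk F hF) = F x := rfl

lemma ext_ev {f g : Sm Ω} (h : ∀ x (hx : x ∈ Ω), ev hx f = ev hx g) : f = g :=
  Subtype.ext (funext fun x => h x.1 x.2)

/-- Extension by zero. -/
def ext (f : Sm Ω) : ST → ℂ := Function.extend Subtype.val f.1 0

lemma ext_apply (f : Sm Ω) {x : ST} (hx : x ∈ Ω) : ext f x = ev hx f :=
  Subtype.val_injective.extend_apply f.1 0 ⟨x, hx⟩

lemma contDiffOn_ext (f : Sm Ω) : ContDiffOn ℝ ∞ (ext f) Ω := by
  obtain ⟨F, hF, h⟩ := f.2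
  exact hF.congr fun x hx => (ext_apply f hx).trans (h ⟨x, hx⟩)

variable (hΩ : IsOpen Ω)

include hΩ in
lemma differentiableAt_ext (f : Sm Ω) {x : ST} (hx : x ∈ Ω) : DifferentiableAt ℝ (ext f) x :=
  ((contDiffOn_ext f).contDiffAt (hΩ.mem_nhds hx)).differentiableAt (by simp)

include hΩ in
lemma ext_eventuallyEq {f : Sm Ω} {F : ST → ℂ} (h : ∀ y (hy : y ∈ Ω), ev hy f = F y) {x : ST}
    (hx : x ∈ Ω) : ext f =ᶠ[𝓝 x] F := by
  filter_upwards [hΩ.mem_nhds hx] with y hy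
  rw [ext_apply f hy, h]

/-- The partial derivatives as derivations of the ring of smooth functions. -/
def d (i : Fin 4) : Derivation ℂ (Sm Ω) (Sm Ω) :=
  Derivation.mk'
    -- The extension by zero is harmless: derivatives are taken only at points of the open set `Ω`,
    -- near which it agrees with a smooth representative.
    { toFun := fun f => mk (pd i (ext f)) (contDiffOn_pd hΩ (contDiffOn_ext f) i)
      map_add' := fun f g => ext_ev fun x hx => by
        simp only [map_add, ev_mk]
        rw [← pd_add i (differentiableAt_ext hΩ f hx) (differentiableAt_ext hΩ g hx)]
        exact pd_congr (ext_eventuallyEq hΩ (fun y hy => by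
          rw [map_add, ext_apply f hy, ext_apply g hy]) hx)
      map_smul' := fun z f => ext_ev fun x hx => by
        simp only [map_smul, ev_mk, RingHom.id_apply, smul_eq_mul]
        rw [← pd_const_mul i z (differentiableAt_ext hΩ f hx)]
        exact pd_congr (ext_eventuallyEq hΩ (fun y hy => by
          rw [map_smul, ext_apply f hy, smul_eq_mul]) hx) }
    fun f g => ext_ev fun x hx => by
      simp only [LinearMap.coe_mk, AddHom.coe_mk, map_add, smul_eq_mul, map_mul, ev_mk]
      rw [← ext_apply f hx, ← ext_apply g hx, add_comm, mul_comm (ext g x), ← pd_mul i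
        (differentiableAt_ext hΩ f hx) (differentiableAt_ext hΩ g hx)]
      exact pd_congr (ext_eventuallyEq hΩ (fun y hy => by
          rw [map_mul, ext_apply f hy, ext_apply g hy]) hx)

lemma ev_d {f : Sm Ω} {F : ST → ℂ} (h : ∀ y (hy : y ∈ Ω), ev hy f = F y) (i : Fin 4) {x : ST}
    (hx : x ∈ Ω) : ev hx (d hΩ i f) = pd i F x :=
  pd_congr (ext_eventuallyEq hΩ h hx)

lemma ev_d_ofReal {f : Sm Ω} {F : ST → ℝ} (h : ∀ y (hy : y ∈ Ω), ev hy f = (F y : ℂ))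
    (i : Fin 4) {x : ST} (hx : x ∈ Ω) : ev hx (d hΩ i f) = ((pd i F x : ℝ) : ℂ) := by
  rw [ev_d hΩ h, pd_ofReal]

lemma d_comm (i j : Fin 4) (f : Sm Ω) : d hΩ i (d hΩ j f) = d hΩ j (d hΩ i f) := by
  refine ext_ev fun x hx => ?_
  have h : ∀ i j, ev hx (d hΩ i (d hΩ j f)) = pd i (pd j (ext f)) x := fun i j =>
    ev_d hΩ (fun y hy => rfl) i hx
  rw [h, h, pd_comm ((contDiffOn_ext f).contDiffAt (hΩ.mem_nhds hx))]

lemma isUnit_of_ev_ne_zero {f : Sm Ω} (h : ∀ x (hx : x ∈ Ω), ev hx f ≠ 0) : IsUnit f := by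
  refine isUnit_iff_exists_inv.mpr ⟨mk (fun x => (ext f x)⁻¹) ?_, ext_ev fun x hx => ?_⟩
  · exact (contDiffOn_ext f).inv fun x hx => by rw [ext_apply f hx]; exact h x hx
  · rw [map_mul, ev_mk, ext_apply f hx, map_one, mul_inv_cancel₀ (h x hx)]

end Sm

end SmoothRing

/-! ### The geometry of the spacetime over the ring of smooth functions -/

section

lemma continuous_toScri : Continuous toScri := by
  refine continuous_pi fun i => ?_
  fin_cases i <;> exact continuous_apply _

lemma isOpen_nearScri {O : Set Scri} (hO : IsOpen O) (r₀ : ℝ) : IsOpen (nearScri O r₀) :=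
  (isOpen_lt continuous_const (continuous_apply 1)).inter (hO.preimage continuous_toScri)

namespace KillingSpacetime

open Matrix Sm

variable (S : KillingSpacetime)

/-- The region covered by the spacetime. -/
abbrev Ω : Set ST := nearScri S.O S.r₀

lemma isOpen_Ω : IsOpen S.Ω := isOpen_nearScri S.isOpen_O S.r₀

/-- The complex conjugate of `ξⁱ`. -/
def xib (i : Fin 2) (x : ST) : ℂ := starRingEnd ℂ (S.T.xi i x)

/-- The complex conjugate of `c`. -/
def cb (x : ST) : ℂ := starRingEnd ℂ (S.c x)

lemma contDiffOn_conj {f : ST → ℂ} {s : Set ST} (hf : ContDiffOn ℝ ∞ f s) :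
    ContDiffOn ℝ ∞ (fun x => starRingEnd ℂ (f x)) s :=
  Complex.conjCLE.contDiff.comp_contDiffOn hf

def sU : Sm S.Ω := Sm.mk (fun x => (S.T.U x : ℂ)) S.U_exp.1
def sC (i : Fin 2) : Sm S.Ω := Sm.mk (fun x => (S.T.C i x : ℂ)) (S.C_exp i).1
def sx (i : Fin 2) : Sm S.Ω := Sm.mk (S.T.xi i) (S.xi_exp i).1
def sy (i : Fin 2) : Sm S.Ω := Sm.mk (S.xib i) (contDiffOn_conj (S.xi_exp i).1)
def sa : Sm S.Ω := Sm.mk (fun x => (S.a x : ℂ)) S.a_exp.1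
def sb : Sm S.Ω := Sm.mk (fun x => (S.b x : ℂ)) S.b_exp.1
def sc : Sm S.Ω := Sm.mk S.c S.c_exp.1
def scb : Sm S.Ω := Sm.mk S.cb (contDiffOn_conj S.c_exp.1)

section

variable {S} {x : ST} (hx : x ∈ S.Ω)

@[simp] lemma ev_sU : ev hx S.sU = (S.T.U x : ℂ) := rfl
@[simp] lemma ev_sC (i : Fin 2) : ev hx (S.sC i) = (S.T.C i x : ℂ) := rfl
@[simp] lemma ev_sx (i : Fin 2) : ev hx (S.sx i) = S.T.xi i x := rfl
@[simp] lemma ev_sy (i : Fin 2) : ev hx (S.sy i) = S.xib i x := rfl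
@[simp] lemma ev_sa : ev hx S.sa = (S.a x : ℂ) := rfl
@[simp] lemma ev_sb : ev hx S.sb = (S.b x : ℂ) := rfl
@[simp] lemma ev_sc : ev hx S.sc = S.c x := rfl
@[simp] lemma ev_scb : ev hx S.scb = S.cb x := rfl

end

/-- The tetrad, over the ring of smooth functions. -/
def E : Matrix (Fin 4) (Fin 4) (Sm S.Ω) := frame S.sU (S.sC 0) (S.sC 1) (S.sx 0) (S.sx 1) (S.sy 0) (S.sy 1)

/-- The contravariant metric, over the ring of smooth functions. -/
def G : Matrix (Fin 4) (Fin 4) (Sm S.Ω) := S.Eᵀ * nullEta * S.E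

/-- The metric, over the ring of smooth functions. -/
def gm : Matrix (Fin 4) (Fin 4) (Sm S.Ω) := S.G⁻¹

/-- The Killing field, over the ring of smooth functions. -/
def sv : Fin 4 → Sm S.Ω :=
  ![S.sb, S.sa + S.sb * S.sU, S.sb * S.sC 0 - S.sc * S.sx 0 - S.scb * S.sy 0,
    S.sb * S.sC 1 - S.sc * S.sx 1 - S.scb * S.sy 1]

/-- The coordinate functions. -/
def sz (i : Fin 4) : Sm S.Ω :=
  Sm.mk (fun x => (x i : ℂ)) (Complex.ofRealCLM.contDiff.comp (contDiff_apply ℝ ℝ i)).contDiffOn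

/-- The partial derivatives of smooth functions. -/
def D : Fin 4 → Derivation ℂ (Sm S.Ω) (Sm S.Ω) := Sm.d S.isOpen_Ω

lemma D_comm (i j : Fin 4) (f : Sm S.Ω) : S.D i (S.D j f) = S.D j (S.D i f) :=
  d_comm S.isOpen_Ω i j f

variable {S} in
lemma ev_D {f : Sm S.Ω} {F : ST → ℂ} (h : ∀ y (hy : y ∈ S.Ω), ev hy f = F y) (i : Fin 4) {x : ST}
    (hx : x ∈ S.Ω) : ev hx (S.D i f) = pd i F x :=
  ev_d S.isOpen_Ω h i hx

variable {S} in
lemma ev_D_ofReal {f : Sm S.Ω} {F : ST → ℝ} (h : ∀ y (hy : y ∈ S.Ω), ev hy f = (F y : ℂ))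
    (i : Fin 4) {x : ST} (hx : x ∈ S.Ω) : ev hx (S.D i f) = ((pd i F x : ℝ) : ℂ) :=
  ev_d_ofReal S.isOpen_Ω h i hx

lemma D_sz (i j : Fin 4) : S.D i (S.sz j) = if i = j then 1 else 0 := by
  refine ext_ev fun x hx => ?_
  rw [ev_D_ofReal (F := fun x => x j) (fun y hy => rfl)]
  have : pd i (fun x : ST => x j) x = if i = j then 1 else 0 := by
    rw [pd, (hasFDerivAt_apply j x).fderiv]
    simp [Pi.single_apply, eq_comm]
  rw [this]; split_ifs <;> simp

/-- This determinant takes the value `-2i Im(ξ⁰ ξ̄¹)` up to sign, so it has no zero exactly when `m`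
and `m̄` are independent at every point. -/
lemma isUnit_delta : IsUnit (S.sx 0 * S.sy 1 - S.sx 1 * S.sy 0) := by
  refine isUnit_of_ev_ne_zero fun x hx h => S.nondeg x hx ?_
  simp only [map_sub, map_mul, ev_sx, ev_sy, xib] at h
  have := congrArg Complex.im h
  simp at this ⊢
  linarith

lemma isUnit_E : IsUnit S.E := isUnit_frame S.isUnit_delta

lemma gm_mul_G : S.gm * S.G = 1 := by
  refine Matrix.nonsing_inv_mul _ ?_
  rw [← Matrix.isUnit_iff_isUnit_det]
  have hη : IsUnit (nullEta : Matrix (Fin 4) (Fin 4) (Sm S.Ω)) :=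
    IsUnit.of_mul_eq_one _ nullEta_mul_self
  have : IsUnit S.Eᵀ := by
    rw [Matrix.isUnit_iff_isUnit_det, Matrix.det_transpose, ← Matrix.isUnit_iff_isUnit_det]
    exact S.isUnit_E
  exact (this.mul hη).mul S.isUnit_E

lemma G_mul_gm : S.G * S.gm = 1 := mul_eq_one_comm.mp S.gm_mul_G

lemma G_symm (i j : Fin 4) : S.G i j = S.G j i := by
  have : S.Gᵀ = S.G := by
    rw [G, transpose_mul, transpose_mul, transpose_transpose, nullEta_transpose, mul_assoc]
  exact (congrFun (congrFun this i) j).symm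

lemma gm_symm (i j : Fin 4) : S.gm i j = S.gm j i :=
  symm_of_mul_eq_one S.gm_mul_G S.G_symm i j

lemma G_apply (i j : Fin 4) : S.G i j =
    S.E 0 i * S.E 1 j + S.E 1 i * S.E 0 j - S.E 2 i * S.E 3 j - S.E 3 i * S.E 2 j := by
  simp only [G, Matrix.mul_apply, Fin.sum_univ_four, transpose_apply, nullEta]
  simp
  ring

variable {x : ST} (hx : x ∈ S.Ω)

lemma ev_E0 (i : Fin 4) : ev hx (S.E 0 i) = S.T.l x i := by
  fin_cases i <;> simp [E, frame, Tetrad.l]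

lemma ev_E1 (i : Fin 4) : ev hx (S.E 1 i) = S.T.n x i := by
  fin_cases i <;> simp [E, frame, Tetrad.n]

lemma ev_E2 (i : Fin 4) : ev hx (S.E 2 i) = S.T.m x i := by
  fin_cases i <;> simp [E, frame, Tetrad.m]

lemma ev_E3 (i : Fin 4) : ev hx (S.E 3 i) = S.T.mbar x i := by
  fin_cases i <;> simp [E, frame, Tetrad.mbar, Tetrad.m, xib]

lemma conj_l (i : Fin 4) : starRingEnd ℂ (S.T.l x i) = S.T.l x i := by
  fin_cases i <;> simp [Tetrad.l]

lemma conj_n (i : Fin 4) : starRingEnd ℂ (S.T.n x i) = S.T.n x i := by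
  fin_cases i <;> simp [Tetrad.n]

lemma ev_G (i j : Fin 4) : ev hx (S.G i j) = (S.T.ginv x i j : ℂ) := by
  rw [G_apply]
  simp only [map_add, map_sub, map_mul, ev_E0, ev_E1, ev_E2, ev_E3]
  refine (Complex.conj_eq_iff_re.mp ?_).symm
  simp only [map_add, map_sub, map_mul, conj_l, conj_n, Tetrad.mbar, Complex.conj_conj]
  ring

/-- The inverse over the ring and the pointwise inverse invert the same complex matrix, one from the
left and one from the right, hence they agree. -/
lemma ev_gm (i j : Fin 4) : ev hx (S.gm i j) = (S.T.g x i j : ℂ) := by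
  have h1 : (S.gm.map (ev hx)) * ((S.T.ginv x).map Complex.ofRealHom) = 1 := by
    have : (S.T.ginv x).map Complex.ofRealHom = S.G.map (ev hx) := by
      ext i j; exact (S.ev_G hx i j).symm
    rw [this]
    have := congrArg (fun M => M.map (ev hx)) S.gm_mul_G
    simp only [Matrix.map_mul] at this
    rw [this]
    exact Matrix.map_one _ (map_zero _) (map_one _)
  have hu : IsUnit (S.T.ginv x).det := by
    have := congrArg Matrix.det h1
    rw [Matrix.det_mul, Matrix.det_one] at this
    rw [isUnit_iff_ne_zero]
    intro h0
    have h3 : ((S.T.ginv x).map Complex.ofRealHom).det = 0 := by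
      have := Complex.ofRealHom.map_det (S.T.ginv x)
      rw [h0, map_zero] at this
      exact this.symm
    rw [h3, mul_zero] at this
    exact zero_ne_one this
  have h2 : ((S.T.ginv x).map Complex.ofRealHom) * ((S.T.g x).map Complex.ofRealHom) = 1 := by
    rw [← Matrix.map_mul, Tetrad.g, Matrix.mul_nonsing_inv _ hu]
    exact Matrix.map_one _ (map_zero _) (map_one _)
  have h3 := left_inv_eq_right_inv h1 h2
  exact congrFun (congrFun h3 i) j

lemma ev_D_gm (k i j : Fin 4) :
    ev hx (S.D k (S.gm i j)) = ((pd k (fun y => S.T.g y i j) x : ℝ) : ℂ) :=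
  ev_D_ofReal (fun _ hy => S.ev_gm hy i j) k hx

lemma ev_half : ev hx (half : Sm S.Ω) = 1 / 2 := by
  simp [half]

/-- The Christoffel symbols, over the ring of smooth functions. -/
def Γ : Fin 4 → Matrix (Fin 4) (Fin 4) (Sm S.Ω) := chr S.D S.gm S.G

lemma ev_chr (a b c : Fin 4) : ev hx (S.Γ b a c) = (S.T.Gam a b c x : ℂ) := by
  simp only [Γ, chr, Matrix.mul_apply, chrLow, map_sum, map_mul, map_add, map_sub, ev_half, ev_G,
    ev_D_gm, Tetrad.Gam]
  push_cast
  rw [Finset.mul_sum]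
  exact Finset.sum_congr rfl fun e _ => by ring

lemma ev_curv (a b c e : Fin 4) :
    ev hx (curv S.D S.Γ c e a b) = (S.T.RiemUp a b c e x : ℂ) := by
  simp only [curv, Matrix.add_apply, Matrix.sub_apply, Matrix.mul_apply, dmat_apply, map_add,
    map_sub, map_sum, map_mul, S.ev_chr hx,
    ev_D_ofReal (fun _ hy => S.ev_chr hy _ _ _), Tetrad.RiemUp]
  push_cast
  rw [Finset.sum_sub_distrib]

lemma ev_riem (a b c e : Fin 4) :
    ev hx (riem S.D S.gm S.G a b c e) = (S.T.Riem a b c e x : ℂ) := by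
  have h := fun a => S.ev_curv hx a b c e
  simp only [Γ] at h
  simp only [riem, Matrix.mul_apply, map_sum, map_mul, h, S.ev_gm hx, Tetrad.Riem]
  push_cast
  rfl

lemma ev_ric (b e : Fin 4) : ev hx (ric S.D S.gm S.G b e) = (S.T.Ric b e x : ℂ) := by
  have h := fun a => S.ev_curv hx a b a e
  simp only [Γ] at h
  simp only [ric, map_sum, h, Tetrad.Ric]
  push_cast
  rfl

lemma ev_scal : ev hx (scalCurv S.D S.gm S.G) = (S.T.scal x : ℂ) := by
  simp only [scalCurv, map_sum, map_mul, S.ev_ric hx, S.ev_G hx, Tetrad.scal]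
  push_cast
  rfl

/-- The Weyl tensor, over the ring of smooth functions. -/
def W : Fin 4 → Fin 4 → Fin 4 → Fin 4 → Sm S.Ω := weyl S.D S.gm S.G

lemma ev_weyl (a b c e : Fin 4) : ev hx (S.W a b c e) = (S.T.Weyl a b c e x : ℂ) := by
  have h6 : ev hx (algebraMap ℂ (Sm S.Ω) (1 / 6)) = 1 / 6 := (ev hx).commutes _
  simp only [W, weyl, map_add, map_sub, map_mul, S.ev_riem hx, S.ev_ric hx, S.ev_scal hx,
    S.ev_gm hx, ev_half, Tetrad.Weyl, h6]
  push_cast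
  ring

lemma ev_ctr4 (X Y Z U : Fin 4 → Sm S.Ω) :
    ev hx (ctr4 S.W X Y Z U) = S.T.weylC x (fun i => ev hx (X i)) (fun i => ev hx (Y i))
      (fun i => ev hx (Z i)) (fun i => ev hx (U i)) := by
  simp only [ctr4_eq_sum, map_sum, map_mul, S.ev_weyl hx, Tetrad.weylC]

/-- The Weyl scalars, over the ring of smooth functions. -/
def sPsi : Fin 4 → Sm S.Ω :=
  ![ctr4 S.W (S.E 0) (S.E 2) (S.E 0) (S.E 2), ctr4 S.W (S.E 0) (S.E 1) (S.E 0) (S.E 2),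
    ctr4 S.W (S.E 0) (S.E 2) (S.E 3) (S.E 1), ctr4 S.W (S.E 0) (S.E 1) (S.E 3) (S.E 1)]

lemma ev_sPsi (i : Fin 4) : ev hx (S.sPsi i) = S.T.Psi i x := by
  fin_cases i <;> simp [sPsi, Tetrad.Psi, ev_ctr4, ev_E0, ev_E1, ev_E2, ev_E3]

lemma ev_sv (k : Fin 4) : ev hx (S.sv k) = (S.field x k : ℂ) := by
  have h : ev hx (S.sv k) = S.a x * S.T.l x k + S.b x * S.T.n x k - S.c x * S.T.m x k
      - starRingEnd ℂ (S.c x) * S.T.mbar x k := by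
    fin_cases k <;> simp [sv, Tetrad.l, Tetrad.n, Tetrad.m, Tetrad.mbar, cb, xib]
  rw [h]
  refine (Complex.conj_eq_iff_re.mp ?_).symm
  simp only [map_add, map_sub, map_mul, conj_l, conj_n, Tetrad.mbar, Complex.conj_conj,
    Complex.conj_ofReal]
  ring

lemma killing_sm : dmat (vder S.D S.sv) S.gm = -((jac S.D S.sv)ᵀ * S.gm + S.gm * jac S.D S.sv) := by
  refine Matrix.ext fun i j => ext_ev fun x hx => ?_
  have h := congrArg (fun r : ℝ => (r : ℂ)) (S.killing x hx i j)
  have hv : ∀ k l, ev hx (S.D k (S.sv l)) = ((pd k (fun y => S.field y l) x : ℝ) : ℂ) :=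
    fun k l => ev_D_ofReal (fun _ hy => S.ev_sv hy l) k hx
  simp only [dmat_apply, vder_apply, Matrix.neg_apply, Matrix.add_apply, Matrix.mul_apply,
    transpose_apply, jac, map_sum, map_mul, map_neg, map_add, S.ev_gm hx, S.ev_D_gm hx, hv,
    S.ev_sv hx]
  simp only [field] at h ⊢
  push_cast at h
  simp only [Finset.sum_add_distrib] at h
  rw [← sub_eq_zero, sub_neg_eq_add, ← h, add_assoc]
  congr 2
  exact Finset.sum_congr rfl fun k _ => mul_comm _ _

lemma isWeylLike : IsWeylLike S.G S.W where
  antisymm := weyl_antisymm_left (S.D_comm) S.gm_symm S.G_mul_gm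
  pair := weyl_pair (S.D_comm) S.gm_symm S.G_mul_gm
  bianchi := weyl_bianchi (S.D_comm) S.gm_symm S.G_mul_gm
  trace := weyl_trace S.gm_symm S.G_mul_gm

lemma W_lie (a b c e : Fin 4) : vder S.D S.sv (S.W a b c e) =
    -∑ k, (jac S.D S.sv k a * S.W k b c e + jac S.D S.sv k b * S.W a k c e
      + jac S.D S.sv k c * S.W a b k e + jac S.D S.sv k e * S.W a b c k) :=
  weyl_lie (S.D_comm) S.gm_symm S.G_mul_gm S.killing_sm a b c e

end KillingSpacetime

end

/-! ### The system of bracket equations for a Killing spacetime -/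

section

namespace KillingSpacetime

open Matrix Sm

variable (S : KillingSpacetime)

/-- The shear, over the ring of smooth functions. -/
def sSigma : Sm S.Ω := Sm.mk S.T.shear S.sigma_exp.1

/-- Derivative in the direction of `m`. -/
def dm (f : Sm S.Ω) : Sm S.Ω := S.sx 0 * S.D 2 f + S.sx 1 * S.D 3 f

/-- Derivative in the direction of `m̄`. -/
def dmb (f : Sm S.Ω) : Sm S.Ω := S.sy 0 * S.D 2 f + S.sy 1 * S.D 3 f

/-- Derivative in the direction of `n`. -/
def dn (f : Sm S.Ω) : Sm S.Ω :=
  S.D 0 f + S.sU * S.D 1 f + S.sC 0 * S.D 2 f + S.sC 1 * S.D 3 f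

/-- Derivative along the Killing field. -/
def dv (f : Sm S.Ω) : Sm S.Ω := vder S.D S.sv f

/-- The angular components of the Killing field. -/
def sw (i : Fin 2) : Sm S.Ω := S.sb * S.sC i - S.sc * S.sx i - S.scb * S.sy i

lemma dv_eq (f : Sm S.Ω) : S.dv f = S.sb * S.D 0 f + (S.sa + S.sb * S.sU) * S.D 1 f
    + S.sw 0 * S.D 2 f + S.sw 1 * S.D 3 f := by
  simp [dv, vder_apply, Fin.sum_univ_four, sv, sw]

/-- `α, β, γ, A'` (and the conjugates `αb, βb`) are the components of the brackets of the Killing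
field with the tetrad; `μ`, `ν` are the `m̄` components of `[m̄, m]` and `[l, n]`. -/
structure Brackets (α β γ αb βb A' μ ν : Sm S.Ω) : Prop where
  b_r : S.D 1 S.sb = 0
  A_eq : A' = -S.D 1 (S.sa + S.sb * S.sU)
  A_eq' : A' = S.dn S.sb
  β_eq : β = -S.dm S.sb
  βb_eq : βb = -S.dmb S.sb
  α_eq : α + β * S.sU = -S.dm (S.sa + S.sb * S.sU)
  αb_eq : αb + βb * S.sU = -S.dmb (S.sa + S.sb * S.sU)
  γ_eq : ∀ i, γ * S.sx i + β * S.sC i = S.dv (S.sx i) - S.dm (S.sw i)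
  γb_eq : ∀ i, -γ * S.sy i + βb * S.sC i = S.dv (S.sy i) - S.dmb (S.sw i)
  ang_eq : ∀ i, S.D 1 (S.sw i) = -(βb * S.sx i + β * S.sy i)
  U_eq : S.dv S.sU - S.dn (S.sa + S.sb * S.sU) = -A' * S.sU
  C_eq : ∀ i, S.dv (S.sC i) - S.dn (S.sw i) = -A' * S.sC i + αb * S.sx i + α * S.sy i
  μ_eq : (S.sx 0 * S.sy 1 - S.sx 1 * S.sy 0) * μ =
    S.sx 0 * (S.dmb (S.sx 1) - S.dm (S.sy 1)) - S.sx 1 * (S.dmb (S.sx 0) - S.dm (S.sy 0))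
  ν_eq : (S.sx 0 * S.sy 1 - S.sx 1 * S.sy 0) * ν =
    S.sx 0 * S.D 1 (S.sC 1) - S.sx 1 * S.D 1 (S.sC 0)
  psi0_eq : S.dv (S.sPsi 0) = (2 : ℂ) • (A' + γ) * S.sPsi 0 + (4 : ℂ) • (β * S.sPsi 1)
  psi1_eq : S.dv (S.sPsi 1) = (A' + γ) * S.sPsi 1 + ((3 : ℂ) • (β * S.sPsi 2) + αb * S.sPsi 0)
  psi2_eq : S.dv (S.sPsi 2) = 0 * S.sPsi 2 + ((2 : ℂ) • (β * S.sPsi 3) + (2 : ℂ) • (αb * S.sPsi 1))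
  shear_eq : S.dv S.sSigma = (A' + (2 : ℂ) • γ) * S.sSigma + (-S.dm β + β * μ + β * ν)

lemma sSigma_eq {ρ σ : Sm S.Ω} (h : vbr S.D ![0, 1, 0, 0] ![0, 0, S.sx 0, S.sx 1] =
    ρ • ![0, 0, S.sx 0, S.sx 1] + σ • ![0, 0, S.sy 0, S.sy 1]) : S.sSigma = σ := by
  have h1 := shear_eq S.gm_symm S.isUnit_delta rfl rfl S.G_mul_gm h
  rw [← h1]
  refine ext_ev fun x hx => ?_
  have hE : ∀ i, ev hx (frame S.sU (S.sC 0) (S.sC 1) (S.sx 0) (S.sx 1) (S.sy 0) (S.sy 1) 2 i) =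
      S.T.m x i := fun i => S.ev_E2 hx i
  have hl : ∀ y (hy : y ∈ S.Ω) a, ev hy (S.gm a 1) = (S.T.lcov y a : ℂ) := by
    intro y hy a
    rw [S.ev_gm hy]
    simp [Tetrad.lcov, Tetrad.l, Fin.sum_univ_four]
  have hΓ : ∀ a b c, ev hx (chr S.D S.gm S.G b a c) = (S.T.Gam a b c x : ℂ) := S.ev_chr hx
  rw [sSigma, ev_mk, Tetrad.shear]
  have hG : (frame S.sU (S.sC 0) (S.sC 1) (S.sx 0) (S.sx 1) (S.sy 0) (S.sy 1))ᵀ * nullEta *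
      frame S.sU (S.sC 0) (S.sC 1) (S.sx 0) (S.sx 1) (S.sy 0) (S.sy 1) = S.G := rfl
  simp only [hG, map_sum, map_mul, map_sub, hE, ev_D_ofReal (fun y hy => hl y hy _), hl x hx, hΓ]
  push_cast
  rfl

set_option maxHeartbeats 1000000 in
lemma exists_brackets : ∃ α β γ αb βb A' μ ν, S.Brackets α β γ αb βb A' μ ν := by
  obtain ⟨α, β, γ, αb, βb, A', hB⟩ :=
    exists_killingBrackets (g := S.gm) S.isUnit_E S.G_mul_gm S.killing_sm
  obtain ⟨Δi, hΔi⟩ := S.isUnit_delta.exists_right_inv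
  have hl : S.E 0 = ![0, 1, 0, 0] := rfl
  have hn : S.E 1 = ![1, S.sU, S.sC 0, S.sC 1] := rfl
  have hm : S.E 2 = ![0, 0, S.sx 0, S.sx 1] := rfl
  have hmb : S.E 3 = ![0, 0, S.sy 0, S.sy 1] := rfl
  -- Cramer's rule in the plane of the angular directions gives the components along `m` and `m̄`.
  have hsplit : ∀ w0 w1 : Sm S.Ω, (![0, 0, w0, w1] : Fin 4 → Sm S.Ω) =
      ((w0 * S.sy 1 - w1 * S.sy 0) * Δi) • ![0, 0, S.sx 0, S.sx 1]
      + ((S.sx 0 * w1 - S.sx 1 * w0) * Δi) • ![0, 0, S.sy 0, S.sy 1] := by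
    intro w0 w1
    ext i : 1
    fin_cases i <;> simp
    · linear_combination -w0 * hΔi
    · linear_combination -w1 * hΔi
  have vlm : vbr S.D (S.E 0) (S.E 2) = ![0, 0, S.D 1 (S.sx 0), S.D 1 (S.sx 1)] := by
    rw [hl, hm]; ext i : 1
    fin_cases i <;> simp [vbr, vder_apply, jac, Fin.sum_univ_four]
  have vmbm : vbr S.D (S.E 3) (S.E 2) = ![0, 0, S.dmb (S.sx 0) - S.dm (S.sy 0),
      S.dmb (S.sx 1) - S.dm (S.sy 1)] := by
    rw [hm, hmb]; ext i : 1
    fin_cases i <;> simp [vbr, vder_apply, jac, Fin.sum_univ_four, dm, dmb] <;> ring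
  have vln : vbr S.D (S.E 0) (S.E 1) = S.D 1 S.sU • S.E 0 +
      ![0, 0, S.D 1 (S.sC 0), S.D 1 (S.sC 1)] := by
    rw [hl, hn]; ext i : 1
    fin_cases i <;> simp [vbr, vder_apply, jac, Fin.sum_univ_four]
  rw [hsplit] at vlm vmbm vln
  have hσ := S.sSigma_eq (hm ▸ hl ▸ vlm)
  have hsh := shear_lie S.D_comm S.sz S.D_sz S.isUnit_delta hl hn hm hmb hB
    (hm ▸ hmb ▸ vlm) (hm ▸ hmb ▸ vmbm) (hm ▸ hmb ▸ vln)
  rw [← hσ] at hsh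
  have p0 := psi0_lie hB S.G_apply S.isWeylLike S.W_lie
  have p1 := psi1_lie hB S.G_apply S.isWeylLike S.W_lie
  have p2 := psi2_lie hB S.G_apply S.isWeylLike S.W_lie
  have P0 : ctr4 S.W (S.E 0) (S.E 2) (S.E 0) (S.E 2) = S.sPsi 0 := by simp [sPsi]
  have P1 : ctr4 S.W (S.E 0) (S.E 1) (S.E 0) (S.E 2) = S.sPsi 1 := by simp [sPsi]
  have P2 : ctr4 S.W (S.E 0) (S.E 2) (S.E 3) (S.E 1) = S.sPsi 2 := by simp [sPsi]
  have P3 : ctr4 S.W (S.E 0) (S.E 1) (S.E 3) (S.E 1) = S.sPsi 3 := by simp [sPsi]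
  simp only [P0, P1, P2, P3] at p0 p1 p2
  obtain ⟨⟨l0, l1, l2, l3⟩, ⟨n0, n1, n2, n3⟩, ⟨m0, m1, m2, m3⟩, ⟨b0, b1, b2, b3⟩⟩ :=
    KillingBrackets.components (hm ▸ hmb ▸ hn ▸ hl ▸ hB)
  have s0 : S.sv 0 = S.sb := rfl
  have s1 : S.sv 1 = S.sa + S.sb * S.sU := rfl
  have s2 : S.sv 2 = S.sw 0 := rfl
  have s3 : S.sv 3 = S.sw 1 := rfl
  have hdm : ∀ f, vder S.D ![0, 0, S.sx 0, S.sx 1] f = S.dm f := by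
    intro f; simp only [vder_apply, Fin.sum_univ_four, dm]; simp
  have hdmb : ∀ f, vder S.D ![0, 0, S.sy 0, S.sy 1] f = S.dmb f := by
    intro f; simp only [vder_apply, Fin.sum_univ_four, dmb]; simp
  have hdn : ∀ f, vder S.D ![1, S.sU, S.sC 0, S.sC 1] f = S.dn f := by
    intro f; simp only [vder_apply, Fin.sum_univ_four, dn]; simp
  have hdv : ∀ f, vder S.D S.sv f = S.dv f := fun f => rfl
  rw [hm, hdm] at hsh
  simp only [hdm, hdmb, hdn, hdv, s0, s1, s2, s3] at l0 l1 l2 l3 n0 n1 n2 n3 m0 m1 m2 m3 b0 b1 b2 b3 p0 p1 p2 hsh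
  have h2 : (algebraMap ℂ (Sm S.Ω) 2) = 2 := map_ofNat _ 2
  have h3 : (algebraMap ℂ (Sm S.Ω) 3) = 3 := map_ofNat _ 3
  have h4 : (algebraMap ℂ (Sm S.Ω) 4) = 4 := map_ofNat _ 4
  -- The witnesses for `μ` and `ν` are the Cramer expressions for the `m̄` components of `[m̄, m]`
  -- and `[l, n]`.
  refine ⟨α, β, γ, αb, βb, A', (S.sx 0 * (S.dmb (S.sx 1) - S.dm (S.sy 1))
    - S.sx 1 * (S.dmb (S.sx 0) - S.dm (S.sy 0))) * Δi,
    (S.sx 0 * S.D 1 (S.sC 1) - S.sx 1 * S.D 1 (S.sC 0)) * Δi, l0, ?_, n0.symm, ?_, ?_, ?_, ?_,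
    ?_, ?_, ?_, n1, ?_, ?_, ?_, ?_, ?_, ?_, ?_⟩
  · rw [l1, neg_neg]
  · rw [m0, neg_neg]
  · rw [b0, neg_neg]
  · rw [m1, neg_neg]
  · rw [b1, neg_neg]
  · exact Fin.forall_fin_two.mpr ⟨by rw [m2]; ring, by rw [m3]; ring⟩
  · exact Fin.forall_fin_two.mpr ⟨by rw [b2]; ring, by rw [b3]; ring⟩
  · exact Fin.forall_fin_two.mpr ⟨l2, l3⟩
  · exact Fin.forall_fin_two.mpr ⟨n2, n3⟩
  · rw [mul_comm, mul_assoc, mul_comm Δi, hΔi, mul_one]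
  · rw [mul_comm, mul_assoc, mul_comm Δi, hΔi, mul_one]
  · rw [p0, Algebra.smul_def, Algebra.smul_def, h2, h4]; ring
  · rw [p1, Algebra.smul_def, h3]; ring
  · rw [p2, Algebra.smul_def, Algebra.smul_def, h2]; ring
  · rw [hsh, Algebra.smul_def, h2]; ring

end KillingSpacetime

end

section

open Filter Asymptotics Polynomial

/-! ### Asymptotics in one variable -/

/-- `f = O(r⁻ᵏ (ln r)ᴹ)` for some `M`. -/
def PB (k : ℤ) (f : ℝ → ℂ) : Prop :=
  ∃ M : ℕ, f =O[atTop] fun r : ℝ => r ^ (-k) * Real.log r ^ M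

/-- `r⁻ᵏ q(ln r)`. -/
def polyTerm (k : ℤ) (q : ℂ[X]) (r : ℝ) : ℂ := ((r ^ (-k) : ℝ) : ℂ) * q.eval (Real.log r : ℂ)

lemma eventually_one_le_log : ∀ᶠ r : ℝ in atTop, 0 < r ∧ 1 ≤ Real.log r :=
  (eventually_gt_atTop 0).and (Real.tendsto_log_atTop.eventually_ge_atTop 1)

namespace PB

variable {k l : ℤ} {f g : ℝ → ℂ}

lemma congr (h : PB k f) (hfg : f =ᶠ[atTop] g) : PB k g :=
  h.imp fun _ hM => hM.congr' hfg EventuallyEq.rfl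

lemma isBigO_log_le (k : ℤ) {M N : ℕ} (h : M ≤ N) :
    (fun r : ℝ => r ^ (-k) * Real.log r ^ M) =O[atTop] fun r : ℝ => r ^ (-k) * Real.log r ^ N := by
  refine (isBigO_refl _ _).mul (IsBigO.of_bound 1 ?_)
  filter_upwards [eventually_one_le_log] with r hr
  rw [one_mul, norm_pow, norm_pow]
  refine pow_le_pow_right₀ ?_ h
  rw [Real.norm_of_nonneg (by linarith [hr.2])]; exact hr.2

lemma add (hf : PB k f) (hg : PB k g) : PB k (f + g) := by
  obtain ⟨M, hM⟩ := hf
  obtain ⟨N, hN⟩ := hg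
  exact ⟨max M N, (hM.trans (isBigO_log_le k (le_max_left _ _))).add
    (hN.trans (isBigO_log_le k (le_max_right _ _)))⟩

lemma neg (hf : PB k f) : PB k (-f) := hf.imp fun _ h => h.neg_left

lemma sub (hf : PB k f) (hg : PB k g) : PB k (f - g) := sub_eq_add_neg f g ▸ hf.add hg.neg

lemma mul (hf : PB k f) (hg : PB l g) : PB (k + l) (f * g) := by
  obtain ⟨M, hM⟩ := hf
  obtain ⟨N, hN⟩ := hg
  refine ⟨M + N, (hM.mul hN).congr' EventuallyEq.rfl ?_⟩
  filter_upwards [eventually_one_le_log] with r hr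
  rw [neg_add, zpow_add₀ hr.1.ne', pow_add]; ring

lemma mono (hf : PB k f) (h : l ≤ k) : PB l f := by
  obtain ⟨M, hM⟩ := hf
  refine ⟨M, hM.trans (IsBigO.mul (IsBigO.of_bound 1 ?_) (isBigO_refl _ _))⟩
  filter_upwards [eventually_ge_atTop 1] with r hr
  rw [one_mul, Real.norm_of_nonneg (zpow_nonneg (by linarith) _),
    Real.norm_of_nonneg (zpow_nonneg (by linarith) _)]
  exact zpow_le_zpow_right₀ hr (by omega)

lemma const (z : ℂ) : PB 0 (fun _ => z) :=
  ⟨0, by simpa using isBigO_const_const z (one_ne_zero (α := ℝ)) atTop⟩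

lemma zero : PB k 0 := ⟨0, isBigO_zero _ _⟩

lemma smul (z : ℂ) (hf : PB k f) : PB k (z • f) := by
  have := (const z).mul hf
  rwa [zero_add] at this

lemma sum {ι : Type*} {s : Finset ι} {f : ι → ℝ → ℂ} (h : ∀ i ∈ s, PB k (f i)) :
    PB k (∑ i ∈ s, f i) := by
  classical
  induction s using Finset.induction_on with
  | empty => simpa using zero
  | insert a s ha ih =>
    rw [Finset.sum_insert ha]
    exact (h a (by simp)).add (ih fun i hi => h i (by simp [hi]))

lemma conj (hf : PB k f) : PB k (fun r => starRingEnd ℂ (f r)) :=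
  hf.imp fun _ h => (IsBigO.of_norm_left (h.norm_left.congr_left fun _ => (RCLike.norm_conj _).symm))

lemma polyEval (q : ℂ[X]) : PB 0 (fun r => q.eval (Real.log r : ℂ)) := by
  induction q using Polynomial.induction_on' with
  | add p q hp hq => simpa using! hp.add hq
  | monomial n a =>
    refine ⟨n, ?_⟩
    simp only [eval_monomial, neg_zero, zpow_zero, one_mul]
    refine IsBigO.const_mul_left (IsBigO.of_bound 1 (Eventually.of_forall fun r => ?_)) a
    simp

lemma polyTerm (k : ℤ) (q : ℂ[X]) : PB k (polyTerm k q) := by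
  have : PB k (fun r : ℝ => ((r ^ (-k) : ℝ) : ℂ)) :=
    ⟨0, IsBigO.of_bound 1 (Eventually.of_forall fun r => by simp)⟩
  have h := this.mul (polyEval q)
  rwa [add_zero] at h

lemma tendsto_zero (hf : PB 1 f) : Tendsto f atTop (𝓝 0) := by
  obtain ⟨M, hM⟩ := hf
  refine hM.trans_tendsto ?_
  have := (Real.isLittleO_pow_log_id_atTop (n := M)).tendsto_div_nhds_zero
  refine this.congr fun r => ?_
  rw [zpow_neg, zpow_one, div_eq_inv_mul]; rfl

end PB

lemma polyTerm_add (k : ℤ) (q q' : ℂ[X]) : polyTerm k (q + q') = polyTerm k q + polyTerm k q' := by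
  ext r; simp [polyTerm, mul_add]

lemma polyTerm_sub (k : ℤ) (q q' : ℂ[X]) : polyTerm k (q - q') = polyTerm k q - polyTerm k q' := by
  ext r; simp [polyTerm, mul_sub]

lemma polyTerm_zero (k : ℤ) : polyTerm k 0 = 0 := by
  ext r; simp [polyTerm]

lemma polyTerm_mul (k l : ℤ) (q q' : ℂ[X]) :
    polyTerm k q * polyTerm l q' =ᶠ[atTop] polyTerm (k + l) (q * q') := by
  filter_upwards [eventually_gt_atTop 0] with r hr
  simp only [polyTerm, Pi.mul_apply, neg_add, zpow_add₀ hr.ne', eval_mul]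
  push_cast; ring

/-- Uniqueness of leading terms. After multiplication by `rᵏ` the hypothesis says `q(ln r) → 0`;
since `ln r → ∞`, a nonconstant `q` would be unbounded, and a constant one must be zero. -/
lemma eq_zero_of_polyTerm {k : ℤ} {q : ℂ[X]} (h : PB (k + 1) (polyTerm k q)) : q = 0 := by
  have h1 : PB 1 (fun r => q.eval (Real.log r : ℂ)) := by
    have h2 : PB (-k) (polyTerm (-k) 1) := PB.polyTerm _ _
    have h3 := h2.mul h
    rw [show -k + (k + 1) = 1 by ring] at h3
    refine h3.congr ?_
    filter_upwards [eventually_gt_atTop 0] with r hr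
    have : ((r ^ k : ℝ) : ℂ) ≠ 0 := by exact_mod_cast (zpow_pos hr k).ne'
    simp only [Pi.mul_apply, polyTerm, eval_one, neg_neg, mul_one, zpow_neg]
    push_cast at this ⊢
    field_simp
  have h2 := h1.tendsto_zero
  by_cases hd : 0 < q.degree
  · have h3 := q.tendsto_norm_atTop hd (z := fun r : ℝ => (Real.log r : ℂ)) (l := atTop)
      (by simpa using! tendsto_abs_atTop_atTop.comp Real.tendsto_log_atTop)
    have h4 := h2.norm
    exact absurd h4 (not_tendsto_nhds_of_tendsto_atTop h3 _)
  · rw [eq_C_of_degree_le_zero (not_lt.mp hd)] at h2 ⊢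
    simp only [eval_C] at h2
    rw [tendsto_nhds_unique tendsto_const_nhds h2, C_0]

/-- `f = r⁻ᵏ q(ln r) + O(r⁻ᵏ⁻¹ (ln r)ᴹ)`. -/
def HasLead (k : ℤ) (q : ℂ[X]) (f : ℝ → ℂ) : Prop := PB (k + 1) (f - polyTerm k q)

namespace HasLead

variable {k l : ℤ} {f g : ℝ → ℂ} {q q' : ℂ[X]}

lemma congr (h : HasLead k q f) (hfg : f =ᶠ[atTop] g) : HasLead k q g :=
  PB.congr h (hfg.sub EventuallyEq.rfl)

lemma pb (h : HasLead k q f) : PB k f := by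
  have := (PB.mono h (by omega : k ≤ k + 1)).add (PB.polyTerm k q)
  rwa [sub_add_cancel] at this

lemma of_pb (h : PB (k + 1) f) : HasLead k 0 f := by
  rwa [HasLead, polyTerm_zero, sub_zero]

lemma add (hf : HasLead k q f) (hg : HasLead k q' g) : HasLead k (q + q') (f + g) := by
  have := PB.add hf hg
  rwa [HasLead, polyTerm_add, add_sub_add_comm]

lemma neg (hf : HasLead k q f) : HasLead k (-q) (-f) := by
  have := PB.neg hf
  rw [HasLead]; convert this using 1
  ext r; simp [polyTerm]; ring

lemma sub (hf : HasLead k q f) (hg : HasLead k q' g) : HasLead k (q - q') (f - g) := by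
  rw [sub_eq_add_neg, sub_eq_add_neg]; exact hf.add hg.neg

lemma mul (hf : HasLead k q f) (hg : HasLead l q' g) : HasLead (k + l) (q * q') (f * g) := by
  have h1 := PB.mul hf hg.pb
  have h2 := (PB.polyTerm k q).mul hg
  rw [show k + 1 + l = k + l + 1 by ring] at h1
  rw [show k + (l + 1) = k + l + 1 by ring] at h2
  refine (h1.add h2).congr ?_
  filter_upwards [polyTerm_mul k l q q'] with r hr
  simp only [Pi.add_apply, Pi.mul_apply, Pi.sub_apply] at hr ⊢
  rw [← hr]; ring

lemma const (z : ℂ) : HasLead 0 (C z) (fun _ => z) := by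
  rw [HasLead]; convert PB.zero (k := 0 + 1) using 1
  ext r; simp [polyTerm]

lemma smul (z : ℂ) (hf : HasLead k q f) : HasLead k (C z * q) (z • f) := by
  have := (const z).mul hf
  rwa [zero_add] at this

lemma unique (h : HasLead k q f) (h' : HasLead k q' f) : q = q' := by
  have := PB.sub h' h
  rw [sub_sub_sub_cancel_left, ← polyTerm_sub] at this
  exact sub_eq_zero.mp (eq_zero_of_polyTerm this)

lemma eq_zero (h : HasLead k q f) (h' : PB (k + 1) f) : q = 0 := h.unique (of_pb h')

lemma tendsto {z : ℂ} (h : HasLead 0 (C z) f) : Tendsto f atTop (𝓝 z) := by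
  have := (PB.tendsto_zero (by simpa [HasLead] using h)).add (tendsto_const_nhds (x := z))
  simpa [polyTerm] using this

end HasLead

/-- `f` has, along a ray, the polyhomogeneous expansion with coefficients `a`. -/
def RayExp (f : ℝ → ℂ) (k₀ : ℤ) (a : ℤ → ℕ → ℂ) : Prop :=
  ∃ P : ℤ → ℂ[X], (∀ k j, (P k).coeff j = a k j) ∧
    ∀ K, PB (K + 1) (f - ∑ k ∈ Finset.Icc k₀ K, polyTerm k (P k))

namespace RayExp

variable {f g : ℝ → ℂ} {k₀ : ℤ} {a a' : ℤ → ℕ → ℂ}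

lemma congr (h : RayExp f k₀ a) (hfg : f =ᶠ[atTop] g) : RayExp g k₀ a := by
  obtain ⟨P, hP, hK⟩ := h
  exact ⟨P, hP, fun K => (hK K).congr (hfg.sub EventuallyEq.rfl)⟩

/-- The defining estimate of an expansion is the weaker `O(r⁻ᴷ)`. Using it at the next order and
absorbing the surplus terms gives the bound required. The freedom `K' ≥ K` is needed because the
radial derivative shifts the truncation by one. -/
lemma of_bounds {P : ℤ → ℂ[X]} (hP : ∀ k j, (P k).coeff j = a k j)
    (h : ∀ K, ∃ K' ≥ K, PB K (f - ∑ k ∈ Finset.Icc k₀ K', polyTerm k (P k))) : RayExp f k₀ a := by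
  refine ⟨P, hP, fun K => ?_⟩
  obtain ⟨K', hK', hb⟩ := h (K + 1)
  have hs : Finset.Icc k₀ K ⊆ Finset.Icc k₀ K' := Finset.Icc_subset_Icc le_rfl (by omega)
  have h2 : PB (K + 1) (∑ k ∈ Finset.Icc k₀ K' \ Finset.Icc k₀ K, polyTerm k (P k)) := by
    refine PB.sum fun k hk => (PB.polyTerm k (P k)).mono ?_
    simp only [Finset.mem_sdiff, Finset.mem_Icc] at hk
    omega
  have := hb.add h2
  rwa [← Finset.sum_sdiff hs, sub_add_eq_sub_sub, sub_right_comm, sub_add_cancel] at this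

lemma lead (h : RayExp f k₀ a) {K : ℤ} (hK : k₀ ≤ K) (h0 : ∀ k < K, ∀ j, a k j = 0) :
    ∃ q : ℂ[X], (∀ j, q.coeff j = a K j) ∧ HasLead K q f := by
  obtain ⟨P, hP, hb⟩ := h
  refine ⟨P K, hP K, ?_⟩
  have := hb K
  rwa [Finset.sum_eq_single_of_mem K (by simp [hK])] at this
  intro k hk hne
  have : P k = 0 := by
    ext j
    rw [hP, h0 k (by simp at hk; omega), coeff_zero]
  rw [this, polyTerm_zero]

lemma lead_C (h : RayExp f k₀ a) {K : ℤ} (hK : k₀ ≤ K) (h0 : ∀ k < K, ∀ j, a k j = 0)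
    (h1 : ∀ j, a K (j + 1) = 0) : HasLead K (C (a K 0)) f := by
  obtain ⟨q, hq, hl⟩ := h.lead hK h0
  convert hl
  ext j
  cases j with
  | zero => simp [hq]
  | succ j => simp [hq, h1]

lemma pb (h : RayExp f k₀ a) {K : ℤ} (hK : k₀ ≤ K) (h0 : ∀ k < K, ∀ j, a k j = 0) : PB K f :=
  let ⟨_, _, hl⟩ := h.lead hK h0
  hl.pb

lemma sub (h : RayExp f k₀ a) (h' : RayExp g k₀ a') :
    RayExp (f - g) k₀ (fun k j => a k j - a' k j) := by
  obtain ⟨P, hP, hb⟩ := h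
  obtain ⟨P', hP', hb'⟩ := h'
  refine ⟨fun k => P k - P' k, fun k j => by simp [hP, hP'], fun K => ?_⟩
  have := (hb K).sub (hb' K)
  simp only [polyTerm_sub, Finset.sum_sub_distrib]
  rwa [sub_sub_sub_comm] at this

end RayExp

end

/-! ### Restriction of polyhomogeneous expansions to rays -/

section

open Filter Asymptotics Polynomial

/-- The coordinate of the spacetime that restricts to the given coordinate of null infinity. -/
def emb : Fin 3 → Fin 4 := ![0, 2, 3]

@[simp] lemma toScri_lift (p : Scri) (r : ℝ) : toScri (lift p r) = p := by
  ext i; fin_cases i <;> rfl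

@[simp] lemma lift_one (p : Scri) (r : ℝ) : lift p r 1 = r := rfl

lemma lift_mem {O : Set Scri} {r₀ r : ℝ} {p : Scri} (hp : p ∈ O) (hr : r₀ < r) :
    lift p r ∈ nearScri O r₀ := ⟨hr, by rwa [toScri_lift]⟩

lemma lift_toScri (x : ST) : lift (toScri x) (x 1) = x := by
  ext i; fin_cases i <;> rfl

lemma toScri_single_emb (i : Fin 3) : toScri (Pi.single (emb i) 1) = Pi.single i 1 := by
  ext j; fin_cases i <;> fin_cases j <;> simp [toScri, emb]

lemma single_emb_one (i : Fin 3) : (Pi.single (emb i) 1 : ST) 1 = 0 := by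
  fin_cases i <;> simp [emb]

lemma toScri_single_one : toScri (Pi.single 1 1) = 0 := by
  ext j; fin_cases j <;> simp [toScri]

/-- `toScri` as a linear map. -/
def toScriL : ST →L[ℝ] Scri :=
  LinearMap.toContinuousLinearMap
    { toFun := toScri
      map_add' := fun x y => by ext i; fin_cases i <;> rfl
      map_smul' := fun a x => by ext i; fin_cases i <;> rfl }

lemma toScriL_apply (x : ST) : toScriL x = toScri x := rfl

lemma hasFDerivAt_comp_toScri {e : Scri → ℂ} {x : ST} (he : DifferentiableAt ℝ e (toScri x)) :
    HasFDerivAt (fun x => e (toScri x)) ((fderiv ℝ e (toScri x)).comp toScriL) x :=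
  HasFDerivAt.comp x (g := e) (f := toScriL) he.hasFDerivAt toScriL.hasFDerivAt

lemma pd_comp_toScri {e : Scri → ℂ} {x : ST} (he : DifferentiableAt ℝ e (toScri x)) (i : Fin 3) :
    pd (emb i) (fun x => e (toScri x)) x = pd i e (toScri x) := by
  rw [pd, (hasFDerivAt_comp_toScri he).fderiv]
  simp [toScriL_apply, toScri_single_emb, pd]

lemma hasFDerivAt_radial {h : ℝ → ℝ} {h' : ℝ} {x : ST} (hh : HasDerivAt h h' (x 1)) :
    HasFDerivAt (fun x : ST => ((h (x 1) : ℝ) : ℂ))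
      (Complex.ofRealCLM.comp (h' • ContinuousLinearMap.proj (R := ℝ) (φ := fun _ : Fin 4 => ℝ) 1)) x :=
  (Complex.ofRealCLM.hasFDerivAt).comp x (hh.comp_hasFDerivAt x (hasFDerivAt_apply 1 x))

lemma differentiableAt_term {e : Scri → ℂ} {h : ℝ → ℝ} {h' : ℝ} {x : ST}
    (he : DifferentiableAt ℝ e (toScri x)) (hh : HasDerivAt h h' (x 1)) :
    DifferentiableAt ℝ (fun x => e (toScri x) * ((h (x 1) : ℝ) : ℂ)) x :=
  (hasFDerivAt_comp_toScri he).differentiableAt.mul (hasFDerivAt_radial hh).differentiableAt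

lemma pd_term {e : Scri → ℂ} {h : ℝ → ℝ} {h' : ℝ} {x : ST}
    (he : DifferentiableAt ℝ e (toScri x)) (hh : HasDerivAt h h' (x 1)) (i : Fin 4) :
    pd i (fun x => e (toScri x) * ((h (x 1) : ℝ) : ℂ)) x =
      fderiv ℝ e (toScri x) (toScri (Pi.single i 1)) * h (x 1)
        + e (toScri x) * ((h' * (Pi.single i 1 : ST) 1 : ℝ) : ℂ) := by
  rw [pd_mul i (hasFDerivAt_comp_toScri he).differentiableAt (hasFDerivAt_radial hh).differentiableAt]
  rw [pd, (hasFDerivAt_comp_toScri he).fderiv, pd, (hasFDerivAt_radial hh).fderiv]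
  simp [toScriL_apply]

lemma hasDerivAt_radial (k : ℤ) (j : ℕ) {r : ℝ} (hr : 0 < r) :
    HasDerivAt (fun r : ℝ => r ^ (-k) * Real.log r ^ j)
      (r ^ (-(k + 1)) * (-k * Real.log r ^ j + j * Real.log r ^ (j - 1))) r := by
  have h1 := hasDerivAt_zpow (-k) r (Or.inl hr.ne')
  have h2 := (Real.hasDerivAt_log hr.ne').pow j
  convert! h1.mul h2 using 1
  rw [show -(k + 1) = -k - 1 by ring, zpow_sub₀ hr.ne']
  simp only [zpow_one]
  push_cast
  field_simp
  simp

namespace HasPolyExpansion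

variable {O : Set Scri} {r₀ : ℝ} {f : ST → ℂ} {k₀ : ℤ} {e : Coeffs}

/-- The coefficients of `r⁻ᵏ`, as a polynomial in `ln r`. -/
def poly (N : ℤ → ℕ) (e : Coeffs) (p : Scri) (k : ℤ) : ℂ[X] :=
  ∑ j ∈ Finset.range (N k + 1), C (e k j p) * X ^ j

lemma coeff_poly {N : ℤ → ℕ} {e : Coeffs} {p : Scri} (h : ∀ k j, N k < j → e k j p = 0) (k : ℤ)
    (j : ℕ) : (poly N e p k).coeff j = e k j p := by
  simp only [poly, finsetSum_coeff, coeff_C_mul, coeff_X_pow, mul_ite, mul_one, mul_zero]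
  rw [Finset.sum_ite_eq]
  split_ifs with hj
  · rfl
  · exact (h k j (by simpa using hj)).symm

lemma polyTerm_poly (N : ℤ → ℕ) (e : Coeffs) (p : Scri) (k : ℤ) (r : ℝ) :
    polyTerm k (poly N e p k) r =
      ∑ j ∈ Finset.range (N k + 1), e k j p * ((r ^ (-k) * Real.log r ^ j : ℝ) : ℂ) := by
  simp only [polyTerm, poly, eval_finsetSum, eval_mul, eval_C, eval_pow, eval_X, Finset.mul_sum]
  refine Finset.sum_congr rfl fun j _ => ?_
  push_cast; ring

lemma rayExp (hf : HasPolyExpansion O r₀ f k₀ e) {p : Scri} (hp : p ∈ O) :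
    RayExp (fun r => f (lift p r)) k₀ (fun k j => e k j p) := by
  obtain ⟨-, -, -, N, hN, hb⟩ := hf
  refine RayExp.of_bounds (coeff_poly fun k j h => hN k j h p hp) fun K => ⟨K, le_rfl, ?_⟩
  obtain ⟨B, r₁, h⟩ := hb K [] {p} isCompact_singleton (by simpa using hp)
  refine ⟨0, IsBigO.of_bound B ?_⟩
  filter_upwards [eventually_ge_atTop r₁, eventually_gt_atTop 0] with r hr hr0
  have := h r hr p rfl
  simp only [pdList, List.foldr_nil, toScri_lift, lift_one] at this
  rw [pow_zero, mul_one, Real.norm_of_nonneg (zpow_pos hr0 _).le]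
  simpa only [Pi.sub_apply, Finset.sum_apply, polyTerm_poly] using this

lemma eventually_pd (hO : IsOpen O) (hf : HasPolyExpansion O r₀ f k₀ e) {p : Scri} (hp : p ∈ O)
    (N : ℤ → ℕ) (K : ℤ) (i : Fin 4) : ∀ᶠ r in atTop,
    pd i (fun x => f x - ∑ k ∈ Finset.Icc k₀ K, ∑ j ∈ Finset.range (N k + 1),
      e k j (toScri x) * ((x 1 ^ (-k) * Real.log (x 1) ^ j : ℝ) : ℂ)) (lift p r) =
    pd i f (lift p r) - ∑ k ∈ Finset.Icc k₀ K, ∑ j ∈ Finset.range (N k + 1),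
      (fderiv ℝ (e k j) p (toScri (Pi.single i 1)) * ((r ^ (-k) * Real.log r ^ j : ℝ) : ℂ)
        + e k j p * ((r ^ (-(k + 1)) * (-k * Real.log r ^ j + j * Real.log r ^ (j - 1))
          * (Pi.single i 1 : ST) 1 : ℝ) : ℂ)) := by
  filter_upwards [eventually_gt_atTop r₀, eventually_gt_atTop 0] with r hr hr0
  have hd : DifferentiableAt ℝ f (lift p r) :=
    (hf.1.contDiffAt ((isOpen_nearScri hO r₀).mem_nhds (lift_mem hp hr))).differentiableAt (by simp)
  have he : ∀ k j, DifferentiableAt ℝ (e k j) (toScri (lift p r)) := fun k j => by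
    rw [toScri_lift]
    exact ((hf.2.1 k j).contDiffAt (hO.mem_nhds hp)).differentiableAt (by simp)
  have ht := fun k j => differentiableAt_term (x := lift p r) (he k j) (hasDerivAt_radial k j hr0)
  have hs : ∀ k, DifferentiableAt ℝ (fun x : ST => ∑ j ∈ Finset.range (N k + 1),
      e k j (toScri x) * ((x 1 ^ (-k) * Real.log (x 1) ^ j : ℝ) : ℂ)) (lift p r) := fun k =>
    DifferentiableAt.fun_sum fun j _ => ht k j
  rw [pd_sub i hd (DifferentiableAt.fun_sum fun k _ => hs k)]
  congr 1
  rw [pd, fderiv_fun_sum fun k _ => hs k, sum_apply]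
  refine Finset.sum_congr rfl fun k _ => ?_
  rw [fderiv_fun_sum fun j _ => ht k j, sum_apply]
  refine Finset.sum_congr rfl fun j _ => ?_
  have := pd_term (x := lift p r) (he k j) (hasDerivAt_radial k j hr0) i
  rw [pd] at this
  rw [this, toScri_lift, lift_one]

lemma rayExp_pd (hO : IsOpen O) (hf : HasPolyExpansion O r₀ f k₀ e) {p : Scri} (hp : p ∈ O)
    (i : Fin 3) :
    RayExp (fun r => pd (emb i) f (lift p r)) k₀ (fun k j => pd i (e k j) p) := by
  have hf' := hf
  obtain ⟨-, -, -, N, hN, hb⟩ := hf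
  have hN' : ∀ k j, N k < j → pd i (e k j) p = 0 := fun k j h => by
    rw [pd_congr (g := fun _ => 0), pd_const]
    filter_upwards [hO.mem_nhds hp] with q hq using hN k j h q hq
  refine RayExp.of_bounds (coeff_poly (e := fun k j => pd i (e k j)) hN') fun K => ⟨K, le_rfl, ?_⟩
  obtain ⟨B, r₁, h⟩ := hb K [emb i] {p} isCompact_singleton (by simpa using hp)
  refine ⟨0, IsBigO.of_bound B ?_⟩
  filter_upwards [eventually_ge_atTop r₁, eventually_gt_atTop 0,
    hf'.eventually_pd hO hp N K (emb i)] with r hr hr0 he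
  have := h r hr p rfl
  simp only [pdList, List.foldr_cons, List.foldr_nil] at this
  rw [he] at this
  rw [pow_zero, mul_one, Real.norm_of_nonneg (zpow_pos hr0 _).le]
  simpa only [Pi.sub_apply, Finset.sum_apply, polyTerm_poly, single_emb_one, toScri_single_emb,
    mul_zero, Complex.ofReal_zero, add_zero, pd] using this

/-- The derivative of `r⁻ᵏ q(ln r)` is `r⁻ᵏ⁻¹ (-k q + q')(ln r)`. The term `q'` couples each power
of the logarithm to the next higher one. -/
lemma rayExp_pd_r (hO : IsOpen O) (hf : HasPolyExpansion O r₀ f k₀ e) {p : Scri} (hp : p ∈ O) :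
    RayExp (fun r => pd 1 f (lift p r)) (k₀ + 1)
      (fun k j => -(k - 1) * e (k - 1) j p + (j + 1) * e (k - 1) (j + 1) p) := by
  have hf' := hf
  obtain ⟨-, -, -, N, hN, hb⟩ := hf
  have hc := coeff_poly (N := N) (e := e) fun k j h => hN k j h p hp
  refine RayExp.of_bounds (P := fun k => C (-((k - 1 : ℤ) : ℂ)) * poly N e p (k - 1) +
    derivative (poly N e p (k - 1))) (fun k j => ?_) fun K => ⟨K + 1, by omega, ?_⟩
  · rw [coeff_add, coeff_C_mul, coeff_derivative, hc, hc]; push_cast; ring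
  obtain ⟨B, r₁, h⟩ := hb K [1] {p} isCompact_singleton (by simpa using hp)
  refine ⟨0, IsBigO.of_bound B ?_⟩
  filter_upwards [eventually_ge_atTop r₁, eventually_gt_atTop 0,
    hf'.eventually_pd hO hp N K 1] with r hr hr0 he
  have := h r hr p rfl
  simp only [pdList, List.foldr_cons, List.foldr_nil] at this
  rw [he] at this
  rw [pow_zero, mul_one, Real.norm_of_nonneg (zpow_pos hr0 _).le]
  convert this using 3
  rw [Pi.sub_apply, Finset.sum_apply, ← Finset.map_add_right_Icc, Finset.sum_map]
  congr 1
  refine Finset.sum_congr rfl fun k _ => ?_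
  simp only [addRightEmbedding_apply, add_sub_cancel_right, toScri_single_one, map_zero, zero_mul,
    zero_add, Pi.single_eq_same, mul_one, polyTerm, poly, derivative_sum, eval_add, eval_mul,
    eval_C, eval_finsetSum, Finset.mul_sum, mul_add]
  rw [← Finset.sum_add_distrib]
  refine Finset.sum_congr rfl fun j _ => ?_
  simp only [derivative_C_mul, derivative_X_pow, eval_mul, eval_C, eval_pow, eval_X]
  push_cast
  ring

end HasPolyExpansion

end

/-! ### Leading terms, with first derivatives, of smooth functions along a ray -/

section

open Filter Asymptotics Polynomial

lemma HasLead.conj {k : ℤ} {q : ℂ[X]} {f : ℝ → ℂ} (h : HasLead k q f) :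
    HasLead k (q.map (starRingEnd ℂ)) (fun r => starRingEnd ℂ (f r)) := by
  refine (PB.conj h).congr (Eventually.of_forall fun r => ?_)
  simp only [Pi.sub_apply, map_sub, polyTerm, map_mul, Complex.conj_ofReal]
  rw [Polynomial.eval_map, ← Polynomial.eval₂_at_apply, Complex.conj_ofReal]

lemma HasLead.congr_poly {k : ℤ} {q q' : ℂ[X]} {f : ℝ → ℂ} (h : HasLead k q f) (hq : q = q') :
    HasLead k q' f := hq ▸ h

lemma HasLead.congr_order {k l : ℤ} {q : ℂ[X]} {f : ℝ → ℂ} (h : HasLead k q f) (hk : k = l) :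
    HasLead l q f := hk ▸ h

lemma PB.congr_order {k l : ℤ} {f : ℝ → ℂ} (h : PB k f) (hk : k = l) : PB l f := hk ▸ h

namespace Sm

variable {Ω : Set ST}

/-- The values along the ray over a point of null infinity. -/
def ray (p : Scri) (f : Sm Ω) (r : ℝ) : ℂ := ext f (lift p r)

lemma ext_of_notMem (f : Sm Ω) {x : ST} (hx : x ∉ Ω) : ext f x = 0 :=
  Function.extend_apply' _ _ _ (by rintro ⟨y, rfl⟩; exact hx y.2)

/-- The condition `op 0 0 = 0` takes care of the points of the ray outside `Ω`, where the extensions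
vanish. -/
lemma ray_ext {p : Scri} {f g h : Sm Ω} {op : ℂ → ℂ → ℂ} (h0 : op 0 0 = 0)
    (hop : ∀ x (hx : x ∈ Ω), ev hx f = op (ev hx g) (ev hx h)) (r : ℝ) :
    ray p f r = op (ray p g r) (ray p h r) := by
  by_cases hx : lift p r ∈ Ω
  · simp only [ray, ext_apply _ hx, hop]
  · simp only [ray, ext_of_notMem _ hx, h0]

variable (p : Scri) (f g : Sm Ω)

@[simp] lemma ray_add : ray p (f + g) = ray p f + ray p g :=
  funext (ray_ext (op := (· + ·)) (by simp) fun x hx => map_add (ev hx) f g)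

@[simp] lemma ray_sub : ray p (f - g) = ray p f - ray p g :=
  funext (ray_ext (op := (· - ·)) (by simp) fun x hx => map_sub (ev hx) f g)

@[simp] lemma ray_mul : ray p (f * g) = ray p f * ray p g :=
  funext (ray_ext (op := (· * ·)) (by simp) fun x hx => map_mul (ev hx) f g)

@[simp] lemma ray_smul (z : ℂ) : ray p (z • f) = z • ray p f :=
  funext (ray_ext (h := f) (op := fun a _ => z • a) (by simp) fun x hx => map_smul (ev hx) z f)

@[simp] lemma ray_zero : ray p (0 : Sm Ω) = 0 :=
  funext (ray_ext (g := 0) (h := 0) (op := fun _ _ => 0) (by simp) fun x hx => map_zero (ev hx))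

@[simp] lemma ray_neg : ray p (-f) = -ray p f :=
  funext (ray_ext (h := f) (op := fun a _ => -a) (by simp) fun x hx => map_neg (ev hx) f)

variable {p f}

lemma ray_eventuallyEq {O : Set Scri} {r₀ : ℝ} {f : Sm (nearScri O r₀)} {F : ST → ℂ}
    (h : ∀ y (hy : y ∈ nearScri O r₀), ev hy f = F y) {p : Scri} (hp : p ∈ O) :
    ray p f =ᶠ[atTop] fun r => F (lift p r) := by
  filter_upwards [eventually_gt_atTop r₀] with r hr
  rw [ray, ext_apply _ (lift_mem hp hr), h]

/-- `g` is the complex conjugate of `f`. -/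
def ConjPair (f g : Sm Ω) : Prop := ∀ x (hx : x ∈ Ω), ev hx g = starRingEnd ℂ (ev hx f)

lemma ConjPair.ray {f g : Sm Ω} (h : ConjPair f g) (p : Scri) :
    ray p g = fun r => starRingEnd ℂ (ray p f r) :=
  funext (ray_ext (h := f) (op := fun a _ => starRingEnd ℂ a) (by simp) h)

end Sm

namespace KillingSpacetime

open Sm

variable (S : KillingSpacetime)

variable {S} in
lemma conjPair_D {f g : Sm S.Ω} (h : ConjPair f g) (i : Fin 4) : ConjPair (S.D i f) (S.D i g) := by
  intro x hx
  rw [ev_D (F := fun y => starRingEnd ℂ (ext f y)) (fun y hy => by rw [ext_apply f hy, h]), pd_conj,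
    ev_D (F := ext f) (fun y hy => (ext_apply f hy).symm)]

lemma conjPair_sx (i : Fin 2) : ConjPair (S.sx i) (S.sy i) := fun _ _ => rfl

lemma conjPair_sc : ConjPair S.sc S.scb := fun _ _ => rfl

/-- Expansions of a function and of its first derivatives along the ray over `p`. -/
structure Exp (p : Scri) (f : Sm S.Ω) (k₀ : ℤ) (e : Coeffs) : Prop where
  val : RayExp (ray p f) k₀ (fun k j => e k j p)
  d : ∀ i : Fin 3, RayExp (ray p (S.D (emb i) f)) k₀ (fun k j => pd i (e k j) p)
  dr : RayExp (ray p (S.D 1 f)) (k₀ + 1)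
    (fun k j => -(k - 1) * e (k - 1) j p + (j + 1) * e (k - 1) (j + 1) p)

/-- The leading term `z r⁻ᵏ` of a function, together with its first derivatives. -/
structure JetLead (p : Scri) (f : Sm S.Ω) (k : ℤ) (z : Scri → ℂ) : Prop where
  diff : DifferentiableAt ℝ z p
  val : HasLead k (C (z p)) (ray p f)
  d : ∀ i : Fin 3, HasLead k (C (pd i z p)) (ray p (S.D (emb i) f))
  dr : HasLead (k + 1) (C (-k * z p)) (ray p (S.D 1 f))

variable {S} {p : Scri}

lemma Exp.of_hasPolyExpansion {F : ST → ℂ} {k₀ : ℤ} {e : Coeffs}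
    (hF : HasPolyExpansion S.O S.r₀ F k₀ e) {f : Sm S.Ω} (h : ∀ y (hy : y ∈ S.Ω), ev hy f = F y)
    (hp : p ∈ S.O) : S.Exp p f k₀ e where
  val := (hF.rayExp hp).congr (ray_eventuallyEq h hp).symm
  d i := (hF.rayExp_pd S.isOpen_O hp i).congr
    (ray_eventuallyEq (fun _ hy => ev_D h (emb i) hy) hp).symm
  dr := (hF.rayExp_pd_r S.isOpen_O hp).congr
    (ray_eventuallyEq (fun _ hy => ev_D h 1 hy) hp).symm

namespace JetLead

variable {f g : Sm S.Ω} {k l : ℤ} {z w : Scri → ℂ}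

lemma of_exp {k₀ : ℤ} {e : Coeffs} (h : S.Exp p f k₀ e) (hk : k₀ ≤ k)
    (h0 : ∀ l < k, ∀ j, e l j =ᶠ[𝓝 p] fun _ => 0) (h1 : ∀ j, e k (j + 1) =ᶠ[𝓝 p] fun _ => 0)
    (hz : e k 0 =ᶠ[𝓝 p] z) (hd : DifferentiableAt ℝ z p) : S.JetLead p f k z where
  diff := hd
  val := (h.val.lead_C hk (fun l hl j => (h0 l hl j).eq_of_nhds)
    fun j => (h1 j).eq_of_nhds).congr_poly (by rw [hz.eq_of_nhds])
  d i := ((h.d i).lead_C hk (fun l hl j => by rw [pd_congr (h0 l hl j), pd_const])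
    fun j => by rw [pd_congr (h1 j), pd_const]).congr_poly (by rw [pd_congr hz])
  dr := by
    refine (h.dr.lead_C (K := k + 1) (by omega) (fun l hl j => ?_) fun j => ?_).congr_poly ?_
    · rw [(h0 (l - 1) (by omega) j).eq_of_nhds, (h0 (l - 1) (by omega) (j + 1)).eq_of_nhds]; simp
    · rw [add_sub_cancel_right, (h1 j).eq_of_nhds, (h1 (j + 1)).eq_of_nhds]; simp
    · rw [add_sub_cancel_right, hz.eq_of_nhds, (h1 0).eq_of_nhds]; simp

lemma congr (h : S.JetLead p f k z) (hz : z =ᶠ[𝓝 p] w) : S.JetLead p f k w where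
  diff := h.diff.congr_of_eventuallyEq hz.symm
  val := hz.eq_of_nhds ▸ h.val
  d i := pd_congr (i := i) hz ▸ h.d i
  dr := hz.eq_of_nhds ▸ h.dr

lemma neg (h : S.JetLead p f k z) : S.JetLead p (-f) k (fun q => -z q) where
  diff := h.diff.neg
  val := by simpa using h.val.neg
  d i := by
    have := (h.d i).neg
    rw [map_neg, ray_neg]
    exact this.congr_poly (by simp [pd, fderiv_fun_neg])
  dr := by
    rw [map_neg, ray_neg]
    exact h.dr.neg.congr_poly (by simp)

lemma add (hf : S.JetLead p f k z) (hg : S.JetLead p g k w) :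
    S.JetLead p (f + g) k (fun q => z q + w q) where
  diff := hf.diff.add hg.diff
  val := by simpa using hf.val.add hg.val
  d i := by
    rw [map_add, ray_add, pd_add i hf.diff hg.diff, C_add]
    exact (hf.d i).add (hg.d i)
  dr := by
    rw [map_add, ray_add, mul_add, C_add]
    exact hf.dr.add hg.dr

lemma sub (hf : S.JetLead p f k z) (hg : S.JetLead p g k w) :
    S.JetLead p (f - g) k (fun q => z q - w q) := by
  simpa only [sub_eq_add_neg] using hf.add hg.neg

lemma mul (hf : S.JetLead p f k z) (hg : S.JetLead p g l w) :
    S.JetLead p (f * g) (k + l) (fun q => z q * w q) where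
  diff := hf.diff.mul hg.diff
  val := by simpa using hf.val.mul hg.val
  d i := by
    rw [Derivation.leibniz, smul_eq_mul, smul_eq_mul, ray_add, ray_mul, ray_mul,
      pd_mul i hf.diff hg.diff]
    exact ((hf.val.mul (hg.d i)).add
      (((hg.val.mul (hf.d i)).congr_order (add_comm l k)))).congr_poly (by
        simp only [← C_mul, ← C_add]; ring_nf)
  dr := by
    rw [Derivation.leibniz, smul_eq_mul, smul_eq_mul, ray_add, ray_mul, ray_mul]
    exact (((hf.val.mul hg.dr).congr_order (by ring)).add
      (((hg.val.mul hf.dr).congr_order (by ring)))).congr_poly (by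
        simp only [← C_mul, ← C_add]; push_cast; ring_nf)

lemma conj (h : S.JetLead p f k z) (hfg : ConjPair f g) :
    S.JetLead p g k (fun q => starRingEnd ℂ (z q)) where
  diff := Complex.conjCLE.differentiableAt.comp p h.diff
  val := by
    rw [hfg.ray]
    exact h.val.conj.congr_poly (by simp)
  d i := by
    rw [(conjPair_D hfg _).ray, pd_conj]
    exact (h.d i).conj.congr_poly (by simp)
  dr := by
    rw [(conjPair_D hfg _).ray]
    exact h.dr.conj.congr_poly (by simp)

lemma lower (h : S.JetLead p f k z) (hl : l < k) : S.JetLead p f l (fun _ => 0) where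
  diff := differentiableAt_const _
  val := by simpa using HasLead.of_pb (h.val.pb.mono (by omega : l + 1 ≤ k))
  d i := by simpa [pd_const] using HasLead.of_pb ((h.d i).pb.mono (by omega : l + 1 ≤ k))
  dr := by simpa using HasLead.of_pb (h.dr.pb.mono (by omega : l + 1 + 1 ≤ k + 1))

end JetLead

lemma exp_sU (hp : p ∈ S.O) : S.Exp p S.sU 0 S.UE := .of_hasPolyExpansion S.U_exp (fun _ _ => rfl) hp
lemma exp_sC (hp : p ∈ S.O) (i : Fin 2) : S.Exp p (S.sC i) 2 (S.CE i) :=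
  .of_hasPolyExpansion (S.C_exp i) (fun _ _ => rfl) hp
lemma exp_sx (hp : p ∈ S.O) (i : Fin 2) : S.Exp p (S.sx i) 1 (S.xiE i) :=
  .of_hasPolyExpansion (S.xi_exp i) (fun _ _ => rfl) hp
lemma exp_sa (hp : p ∈ S.O) : S.Exp p S.sa (-1) S.aE :=
  .of_hasPolyExpansion S.a_exp (fun _ _ => rfl) hp
lemma exp_sb (hp : p ∈ S.O) : S.Exp p S.sb (-1) S.bE :=
  .of_hasPolyExpansion S.b_exp (fun _ _ => rfl) hp
lemma exp_sc (hp : p ∈ S.O) : S.Exp p S.sc (-1) S.cE :=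
  .of_hasPolyExpansion S.c_exp (fun _ _ => rfl) hp
lemma exp_sPsi (hp : p ∈ S.O) (i : Fin 4) :
    S.Exp p (S.sPsi i) ((![4, 4, 3, 2] : Fin 4 → ℤ) i) (S.PsiE i) :=
  .of_hasPolyExpansion (S.Psi_exp i) (fun _ hy => S.ev_sPsi hy i) hp
lemma exp_sSigma (hp : p ∈ S.O) : S.Exp p S.sSigma 2 S.sigmaE :=
  .of_hasPolyExpansion S.sigma_exp (fun _ _ => rfl) hp

lemma eventually_mem (hp : p ∈ S.O) : ∀ᶠ q in 𝓝 p, q ∈ S.O := S.isOpen_O.mem_nhds hp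

lemma jetLead_sU (hp : p ∈ S.O) : S.JetLead p S.sU 0 (fun _ => -1 / 2) :=
  .of_exp (exp_sU hp) le_rfl
    (fun l hl j => (eventually_mem hp).mono fun q hq => S.U_exp.2.2.1 l j hl q hq)
    (fun j => (eventually_mem hp).mono fun q hq => S.U_log j q hq)
    ((eventually_mem hp).mono fun q hq => S.U_lead q hq) (differentiableAt_const _)

/-- The leading coefficients of `ξ`. -/
def xi1 : Fin 2 → Scri → ℂ :=
  ![fun _ => 1 / (Real.sqrt 2 : ℂ), fun p => -Complex.I / ((Real.sqrt 2 * Real.sin (p 1) : ℝ) : ℂ)]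

lemma sin_pos_of_mem (hp : p ∈ S.O) : 0 < Real.sin (p 1) :=
  Real.sin_pos_of_pos_of_lt_pi (S.theta_mem p hp).1 (S.theta_mem p hp).2

lemma contDiffAt_xi1 (hp : p ∈ S.O) (i : Fin 2) : ContDiffAt ℝ ∞ (xi1 i) p := by
  have h : ContDiffAt ℝ ∞ (S.xiE i 1 0) p :=
    ((S.xi_exp i).2.1 1 0).contDiffAt (S.isOpen_O.mem_nhds hp)
  refine h.congr_of_eventuallyEq ((eventually_mem hp).mono fun q hq => ?_)
  fin_cases i
  · exact (S.xi_lead q hq).1.symm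
  · exact (S.xi_lead q hq).2.symm

lemma jetLead_sx (hp : p ∈ S.O) (i : Fin 2) : S.JetLead p (S.sx i) 1 (xi1 i) := by
  refine .of_exp (exp_sx hp i) le_rfl
    (fun l hl j => (eventually_mem hp).mono fun q hq => (S.xi_exp i).2.2.1 l j hl q hq)
    (fun j => (eventually_mem hp).mono fun q hq => S.xi_log i j q hq)
    ((eventually_mem hp).mono fun q hq => ?_) ((contDiffAt_xi1 hp i).differentiableAt (by simp))
  fin_cases i
  · exact (S.xi_lead q hq).1
  · exact (S.xi_lead q hq).2

/-- Although `Cⁱ` starts at order two, it is recorded at order one with zero leading coefficient,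
the same order as `ξⁱ`, so that both enter the tetrad derivatives on an equal footing. -/
lemma jetLead_sC (hp : p ∈ S.O) (i : Fin 2) : S.JetLead p (S.sC i) 1 (fun _ => 0) := by
  have h : ∀ l < 2, ∀ j, S.CE i l j =ᶠ[𝓝 p] fun _ => 0 := fun l hl j =>
    (eventually_mem hp).mono fun q hq => (S.C_exp i).2.2.1 l j hl q hq
  have := exp_sC hp i
  refine ⟨differentiableAt_const _, ?_, fun k => ?_, ?_⟩
  · rw [C_0]
    exact .of_pb (this.val.pb le_rfl fun l hl j => (h l hl j).eq_of_nhds)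
  · rw [pd_const, C_0]
    exact .of_pb ((this.d k).pb le_rfl fun l hl j => by rw [pd_congr (h l hl j), pd_const])
  · rw [mul_zero, C_0]
    exact .of_pb (this.dr.pb le_rfl fun l hl j => by
      rw [(h _ (by omega) j).eq_of_nhds, (h _ (by omega) (j + 1)).eq_of_nhds]; simp)

end KillingSpacetime

end

/-! ### The leading coefficients of the Killing field -/

section

open Filter Asymptotics Polynomial

namespace KillingSpacetime

open Sm

variable {S : KillingSpacetime} {p : Scri} {α β γ αb βb A' μ ν : Sm S.Ω}

section

variable (hB : S.Brackets α β γ αb βb A' μ ν)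

include hB

lemma b_lift_eq (hp : p ∈ S.O) {r s : ℝ} (hr : S.r₀ < r) (hs : S.r₀ < s) :
    (S.b (lift p r) : ℂ) = S.b (lift p s) := by
  have hd : ∀ r ∈ Set.Ioi S.r₀, HasDerivAt (fun r => (S.b (lift p r) : ℂ)) 0 r := by
    intro r hr
    have hx : lift p r ∈ S.Ω := lift_mem hp hr
    have h0 := congrArg (ev hx) hB.b_r
    rw [ev_D (F := fun x => (S.b x : ℂ)) (fun _ _ => rfl), map_zero] at h0
    have h1 := ((S.b_exp.1.contDiffAt (S.isOpen_Ω.mem_nhds hx)).differentiableAt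
      (by simp)).hasFDerivAt
    have h2 : HasDerivAt (lift p) (Pi.single 1 1) r := by
      rw [hasDerivAt_pi]
      intro i
      fin_cases i
      · simpa [lift] using hasDerivAt_const r (p 0)
      · simpa [lift] using hasDerivAt_id' r
      · simpa [lift] using hasDerivAt_const r (p 1)
      · simpa [lift] using hasDerivAt_const r (p 2)
    have := h1.comp_hasDerivAt r h2
    rwa [← pd, h0] at this
  exact isOpen_Ioi.is_const_of_deriv_eq_zero isPreconnected_Ioi
    (fun r hr => (hd r hr).differentiableAt.differentiableWithinAt)
    (fun r hr => (hd r hr).deriv) hr hs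

/-- The `l` component of the Killing equation makes `b` constant along each ray. Uniqueness of
leading terms then removes the order `-1` part of its expansion and identifies the constant with the
order-zero coefficient. -/
lemma b_eq {x : ST} (hx : x ∈ S.Ω) : (S.b x : ℂ) = S.b0 (toScri x) := by
  have h := exp_sb (S := S) hx.2
  have h1 : ray (toScri x) S.sb =ᶠ[atTop] fun _ => (S.b x : ℂ) := by
    refine (ray_eventuallyEq (F := fun x => (S.b x : ℂ)) (fun _ _ => rfl) hx.2).trans ?_
    filter_upwards [eventually_gt_atTop S.r₀] with r hr
    rw [b_lift_eq hB hx.2 hr hx.1, lift_toScri]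
  have h2 : HasLead 0 (C (S.b x : ℂ)) (ray (toScri x) S.sb) := (HasLead.const _).congr h1.symm
  obtain ⟨q, hq, hl⟩ := h.val.lead le_rfl fun k hk j => S.b_exp.2.2.1 k j hk _ hx.2
  have hq0 : q = 0 := hl.eq_zero (by simpa using h2.pb)
  obtain ⟨q', hq', hl'⟩ := h.val.lead (K := 0) (by norm_num) fun k hk j => by
    rcases lt_or_eq_of_le (show k ≤ -1 by omega) with h3 | rfl
    · exact S.b_exp.2.2.1 k j h3 _ hx.2
    · rw [← hq, hq0, coeff_zero]
  rw [b0, ← hq', hl'.unique h2, coeff_C_zero]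

omit hB in
lemma contDiffAt_coeff {f : ST → ℂ} {k₀ : ℤ} {e : Coeffs}
    (h : HasPolyExpansion S.O S.r₀ f k₀ e) (hp : p ∈ S.O) (k : ℤ) (j : ℕ) :
    ContDiffAt ℝ ∞ (e k j) p :=
  (h.2.1 k j).contDiffAt (S.isOpen_O.mem_nhds hp)

omit hB in
lemma ev_D_of_scri {f : Sm S.Ω} {z : Scri → ℂ} (hz : ContDiffOn ℝ ∞ z S.O)
    (h : ∀ x (hx : x ∈ S.Ω), ev hx f = z (toScri x)) (i : Fin 3) {x : ST} (hx : x ∈ S.Ω) :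
    ev hx (S.D (emb i) f) = pd i z (toScri x) := by
  rw [ev_D h, pd_comp_toScri]
  exact (hz.contDiffAt (S.isOpen_O.mem_nhds hx.2)).differentiableAt (by simp)

omit hB in
lemma ray_of_scri {f : Sm S.Ω} {z : Scri → ℂ} (h : ∀ x (hx : x ∈ S.Ω), ev hx f = z (toScri x))
    (hp : p ∈ S.O) : HasLead 0 (C (z p)) (ray p f) :=
  (HasLead.const (z p)).congr ((ray_eventuallyEq h hp).trans (by simp)).symm

omit hB in
lemma jetLead_of_scri {f : Sm S.Ω} {z : Scri → ℂ} (hz : ContDiffOn ℝ ∞ z S.O)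
    (h : ∀ x (hx : x ∈ S.Ω), ev hx f = z (toScri x)) (h1 : S.D 1 f = 0) (hp : p ∈ S.O) :
    S.JetLead p f 0 z where
  diff := (hz.contDiffAt (S.isOpen_O.mem_nhds hp)).differentiableAt (by simp)
  val := ray_of_scri h hp
  d i := ray_of_scri (fun _ hx => ev_D_of_scri hz h i hx) hp
  dr := by rw [h1, ray_zero]; exact HasLead.of_pb PB.zero |>.congr_poly (by simp)

lemma jetLead_sb (hp : p ∈ S.O) : S.JetLead p S.sb 0 S.b0 :=
  jetLead_of_scri (S.b_exp.2.1 0 0) (fun _ hx => b_eq hB hx) hB.b_r hp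

lemma A_lead (hp : p ∈ S.O) : HasLead 0 (C (pd 0 S.b0 p)) (ray p A') := by
  have hb := jetLead_sb hB hp
  rw [hB.A_eq', dn, hB.b_r, mul_zero, add_zero]
  simp only [ray_add, ray_mul]
  have h := fun i j => ((jetLead_sC hp i).val.mul (hb.d j)).pb
  exact (((hb.d 0).add (.of_pb (h 0 1))).add (.of_pb (h 1 2))).congr_poly (by simp)

omit hB in
lemma eq_zero_of_add_derivative {q : ℂ[X]} (h : q + derivative q = 0) : q = 0 := by
  by_contra hq
  have h1 := degree_add_eq_left_of_degree_lt (degree_derivative_lt hq)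
  rw [h, degree_zero] at h1
  exact hq (degree_eq_bot.mp h1.symm)

/-- `A'` has two expressions: `n(b)`, which tends to `∂_u b`, and `-∂_r(a + bU)`. If `r q(ln r)` is
the leading term of `a`, its radial derivative starts with `(q + q')(ln r)`. Hence `q + q'` is
constant, which forces `q' = 0` by degree, and `q = -∂_u b`. -/
lemma a_leading (hp : p ∈ S.O) : pd 0 S.b0 p = -S.am1 p ∧ ∀ j, S.aE (-1) (j + 1) p = 0 := by
  have he := exp_sa hp
  have h0 : ∀ k < -1, ∀ j, S.aE k j p = 0 := fun k hk j => S.a_exp.2.2.1 k j hk p hp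
  obtain ⟨q, hq, -⟩ := he.val.lead le_rfl h0
  obtain ⟨q', hq', hl'⟩ := he.dr.lead (K := 0) le_rfl fun k hk j => by
    rw [h0 _ (by omega), h0 _ (by omega)]; simp
  have h1 : q' = q + derivative q := by
    ext j; rw [hq', coeff_add, coeff_derivative, hq, hq]; simp; ring
  have hA := A_lead hB hp
  rw [hB.A_eq, map_add, ray_neg, ray_add] at hA
  have h2 : HasLead 0 0 (ray p (S.D 1 (S.sb * S.sU))) :=
    .of_pb (((jetLead_sb hB hp).mul (jetLead_sU hp)).dr.pb)
  have h3 := hA.unique (hl'.add h2).neg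
  rw [add_zero, h1] at h3
  have h4 : derivative q = 0 := eq_zero_of_add_derivative (by
    have := congrArg derivative h3
    rw [derivative_C, derivative_neg, derivative_add] at this
    exact neg_eq_zero.mp this.symm)
  refine ⟨?_, fun j => ?_⟩
  · have := congrArg (fun q => coeff q 0) h3
    simpa [h4, hq, am1] using this
  · have := congrArg (fun q => coeff q j) h4
    rw [coeff_derivative, hq, coeff_zero] at this
    exact (mul_eq_zero.mp this).resolve_right (by exact_mod_cast j.succ_ne_zero)

lemma jetLead_sa (hp : p ∈ S.O) : S.JetLead p S.sa (-1) S.am1 :=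
  .of_exp (exp_sa hp) le_rfl
    (fun l hl j => (eventually_mem hp).mono fun q hq => S.a_exp.2.2.1 l j hl q hq)
    (fun j => (eventually_mem hp).mono fun q hq => (a_leading hB hq).2 j) EventuallyEq.rfl
    ((contDiffAt_coeff S.a_exp hp _ _).differentiableAt (by simp))

omit hB in
/-- A vector is zero if its components along the leading `ξ`, `ξ̄` are. -/
lemma eq_zero_of_xi1 (hp : p ∈ S.O) {a b : ℂ}
    (h : ∀ i, xi1 i p * a + starRingEnd ℂ (xi1 i p) * b = 0) : a = 0 := by
  have h0 := h 0
  have h1 := h 1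
  have hs := (sin_pos_of_mem hp).ne'
  have hs' : ((Real.sin (p 1) : ℝ) : ℂ) ≠ 0 := by exact_mod_cast hs
  have h2 : ((Real.sqrt 2 : ℝ) : ℂ) ≠ 0 := by simp
  simp only [xi1, Matrix.cons_val_zero, Matrix.cons_val_one, map_div₀, map_one, map_neg,
    Complex.conj_ofReal, Complex.conj_I, Complex.ofReal_mul, map_mul] at h0 h1
  field_simp at h0 h1
  have h3 : a - b = 0 := by
    have : Complex.I * (a - b) = 0 := by linear_combination -h1
    simpa using this
  linear_combination h0 / 2 + h3 / 2

lemma β_lead (hp : p ∈ S.O) : PB 1 (ray p β) ∧ PB 1 (ray p βb) := by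
  have hb := fun i => ((jetLead_sb hB hp).d i).pb
  have hx := fun i => (jetLead_sx (S := S) hp i).val.pb
  have hy := fun i => ((jetLead_sx (S := S) hp i).conj (S.conjPair_sx i)).val.pb
  rw [hB.β_eq, hB.βb_eq, dm, dmb]
  simp only [ray_neg, ray_add, ray_mul]
  exact ⟨(((hx 0).mul (hb 1)).add ((hx 1).mul (hb 2))).neg,
    (((hy 0).mul (hb 1)).add ((hy 1).mul (hb 2))).neg⟩

/-- The radial derivative of the angular components of `v` is `O(r⁻²)` up to logarithms, because `β`
and `ξ` are both of order one. A logarithm in the leading term `r q(ln r)` of `c` would contribute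
`-(ξ q' + ξ̄ q̄') r⁻¹`. As `ξ` and `ξ̄` are independent, `q' = 0`. -/
lemma c_leading (hp : p ∈ S.O) (j : ℕ) : S.cE (-1) (j + 1) p = 0 := by
  have he := exp_sc hp
  have h0 : ∀ k < -1, ∀ j, S.cE k j p = 0 := fun k hk j => S.c_exp.2.2.1 k j hk p hp
  obtain ⟨q, hq, hl⟩ := he.val.lead le_rfl h0
  obtain ⟨q', hq', hl'⟩ := he.dr.lead (K := 0) le_rfl fun k hk j => by
    rw [h0 _ (by omega), h0 _ (by omega)]; simp
  have h1 : q' = q + derivative q := by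
    ext j; rw [hq', coeff_add, coeff_derivative, hq, hq]; simp; ring
  have h2 : ∀ i, C (xi1 i p) * derivative q
      + C (starRingEnd ℂ (xi1 i p)) * (derivative q).map (starRingEnd ℂ) = 0 := by
    intro i
    have hx := jetLead_sx (S := S) hp i
    have hcx : HasLead 1 (C (xi1 i p) * derivative q) (ray p (S.D 1 (S.sc * S.sx i))) := by
      rw [Derivation.leibniz, smul_eq_mul, smul_eq_mul, ray_add, ray_mul, ray_mul]
      exact ((hl.mul hx.dr).congr_order (by norm_num)).add (hx.val.mul hl') |>.congr_poly (by
        rw [h1]; simp; ring)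
    have hcp : ConjPair (S.sc * S.sx i) (S.scb * S.sy i) := fun x hx => by
      simp only [map_mul, S.conjPair_sc x hx, S.conjPair_sx i x hx]
    have hcy : HasLead 1 ((C (xi1 i p) * derivative q).map (starRingEnd ℂ))
        (ray p (S.D 1 (S.scb * S.sy i))) := by
      rw [(conjPair_D hcp 1).ray]; exact hcx.conj
    have hbC : PB 2 (ray p (S.D 1 (S.sb * S.sC i))) :=
      ((jetLead_sb hB hp).mul (jetLead_sC hp i)).dr.pb
    have hr : PB 2 (ray p (S.D 1 (S.sw i))) := by
      rw [hB.ang_eq]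
      simp only [ray_neg, ray_add, ray_mul]
      exact (((β_lead hB hp).2.mul hx.val.pb).add
        ((β_lead hB hp).1.mul (hx.conj (S.conjPair_sx i)).val.pb)).neg
    have hsum := hcx.add hcy
    rw [Polynomial.map_mul, map_C] at hsum
    refine hsum.eq_zero ?_
    have := hbC.sub hr
    rwa [sw, map_sub, map_sub, ray_sub, ray_sub, sub_sub, sub_sub_cancel] at this
  have h3 : (derivative q).coeff j = 0 := eq_zero_of_xi1 hp fun i => by
    have := congrArg (fun q => coeff q j) (h2 i)
    simpa only [coeff_add, coeff_C_mul, coeff_zero] using this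
  rw [coeff_derivative, hq] at h3
  exact (mul_eq_zero.mp h3).resolve_right (by exact_mod_cast j.succ_ne_zero)

lemma jetLead_sc (hp : p ∈ S.O) : S.JetLead p S.sc (-1) S.cm1 :=
  .of_exp (exp_sc hp) le_rfl
    (fun l hl j => (eventually_mem hp).mono fun q hq => S.c_exp.2.2.1 l j hl q hq)
    (fun j => (eventually_mem hp).mono fun q hq => c_leading hB hq j) EventuallyEq.rfl
    ((contDiffAt_coeff S.c_exp hp _ _).differentiableAt (by simp))

omit hB in
variable (S) in
/-- The leading angular components of the Killing field. -/
def w (i : Fin 2) (q : Scri) : ℂ :=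
  -(S.cm1 q * xi1 i q) - starRingEnd ℂ (S.cm1 q) * starRingEnd ℂ (xi1 i q)

lemma jetLead_sw (hp : p ∈ S.O) (i : Fin 2) : S.JetLead p (S.sw i) 0 (S.w i) := by
  have hx := jetLead_sx (S := S) hp i
  have hc := jetLead_sc hB hp
  have h1 : S.JetLead p (S.sb * S.sC i) 0 (fun _ => 0) :=
    ((jetLead_sb hB hp).mul (jetLead_sC hp i)).lower (by norm_num)
  have := (h1.sub (hc.mul hx)).sub ((hc.conj S.conjPair_sc).mul (hx.conj (S.conjPair_sx i)))
  exact this.congr (Eventually.of_forall fun q => by simp [w])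

lemma jetLead_vr (hp : p ∈ S.O) : S.JetLead p (S.sa + S.sb * S.sU) (-1) S.am1 :=
  ((jetLead_sa hB hp).add (((jetLead_sb hB hp).mul (jetLead_sU hp)).lower (by norm_num))).congr
    (Eventually.of_forall fun q => by simp)

end

end KillingSpacetime

end

/-! ### Division of expansions, ð in coordinates, and the limit of the spin coefficient `γ` -/

section

open Filter Asymptotics Polynomial

/-- Only a logarithm-free leading term is inverted. This suffices for `ξ` and for the determinant of
`m`, `m̄`, the only divisors used. -/
lemma HasLead.inv {l : ℤ} {z : ℂ} {g : ℝ → ℂ} (hg : HasLead l (C z) g) (hz : z ≠ 0) :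
    PB (-l) (fun r => (g r)⁻¹) ∧ ∀ᶠ r in atTop, g r ≠ 0 := by
  have h1 : HasLead 0 (C z) (g * polyTerm (-l) 1) := by
    have h : HasLead (-l) 1 (polyTerm (-l) 1) := by
      rw [HasLead, sub_self]; exact PB.zero
    exact ((hg.mul h).congr_order (by ring)).congr_poly (by simp)
  have h2 := h1.tendsto
  have h3 : PB 0 (fun r => ((g * polyTerm (-l) 1) r)⁻¹) := by
    refine ⟨0, ?_⟩
    simpa using! (h2.inv₀ hz).isBigO_one ℝ
  refine ⟨?_, ?_⟩
  · refine (((PB.polyTerm (-l) 1).mul h3).congr_order (add_zero _)).congr ?_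
    filter_upwards [eventually_gt_atTop 0] with r hr
    have : ((r ^ l : ℝ) : ℂ) ≠ 0 := by exact_mod_cast (zpow_pos hr l).ne'
    simp only [Pi.mul_apply, polyTerm, eval_one, neg_neg, mul_one]
    rw [mul_inv, mul_comm, mul_assoc, inv_mul_cancel₀ this, mul_one]
  · filter_upwards [h2.eventually_ne hz] with r hr
    exact left_ne_zero_of_mul hr

lemma PB.of_mul {k l : ℤ} {z : ℂ} {f g : ℝ → ℂ} (h : PB (k + l) (f * g)) (hg : HasLead l (C z) g)
    (hz : z ≠ 0) : PB k f := by
  refine ((h.mul (hg.inv hz).1).congr_order (add_neg_cancel_right k l)).congr ?_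
  filter_upwards [(hg.inv hz).2] with r hr
  simp [hr]

lemma HasLead.of_mul {k l : ℤ} {u z : ℂ} {f g : ℝ → ℂ} (h : HasLead (k + l) (C u) (f * g))
    (hg : HasLead l (C z) g) (hz : z ≠ 0) : HasLead k (C (u / z)) f := by
  have h1 : HasLead k (C (u / z)) (polyTerm k (C (u / z))) := by
    rw [HasLead, sub_self]; exact PB.zero
  have h2 := h.sub (h1.mul hg)
  rw [← C_mul, div_mul_cancel₀ _ hz, sub_self, ← sub_mul] at h2
  refine PB.of_mul (l := l) ?_ hg hz
  have := PB.congr_order h2 (show k + l + 1 = k + 1 + l by ring)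
  rwa [polyTerm_zero, sub_zero] at this

lemma pd_comp_coord {n : ℕ} {h : ℝ → ℂ} {h' : ℂ} {p : Fin n → ℝ} {k : Fin n}
    (hh : HasDerivAt h h' (p k)) (i : Fin n) :
    pd i (fun q => h (q k)) p = if i = k then h' else 0 := by
  have := hh.hasFDerivAt.comp p (hasFDerivAt_apply (𝕜 := ℝ) k p)
  rw [pd, show (fun q : Fin n → ℝ => h (q k)) = h ∘ fun q => q k from rfl, this.fderiv]
  by_cases hik : i = k
  · simp [hik]
  · simp [hik, Ne.symm hik]

lemma pd_sin_zpow_mul (t : ℤ) {X : Scri → ℂ} {p : Scri} (hX : DifferentiableAt ℝ X p)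
    (hs : Real.sin (p 1) ≠ 0) (i : Fin 3) :
    pd i (fun q => ((Real.sin (q 1) ^ t : ℝ) : ℂ) * X q) p =
      ((Real.sin (p 1) ^ t : ℝ) : ℂ) * (pd i X p +
        if i = 1 then t * (Real.cos (p 1) / Real.sin (p 1) : ℝ) * X p else 0) := by
  have h1 : HasDerivAt (fun θ : ℝ => Real.sin θ ^ t)
      (t * Real.sin (p 1) ^ (t - 1) * Real.cos (p 1)) (p 1) :=
    (hasDerivAt_zpow t _ (Or.inl hs)).comp (p 1) (Real.hasDerivAt_sin (p 1))
  have h2 := h1.ofReal_comp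
  have h3 : DifferentiableAt ℝ (fun q : Scri => ((Real.sin (q 1) ^ t : ℝ) : ℂ)) p :=
    (h2.hasFDerivAt.comp p (hasFDerivAt_apply (𝕜 := ℝ) 1 p)).differentiableAt
  rw [pd_mul i h3 hX, pd_comp_coord h2, zpow_sub_one₀ hs]
  split_ifs
  · push_cast; ring
  · ring

lemma eth_eq (s : ℤ) {X : Scri → ℂ} {p : Scri} (hX : DifferentiableAt ℝ X p)
    (hs : Real.sin (p 1) ≠ 0) : eth s X p =
      (pd 1 X p - s * (Real.cos (p 1) / Real.sin (p 1) : ℝ) * X p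
        - Complex.I / Real.sin (p 1) * pd 2 X p) / (Real.sqrt 2 : ℂ) := by
  have h : ((Real.sin (p 1) ^ s : ℝ) : ℂ) ≠ 0 := by exact_mod_cast zpow_ne_zero s hs
  rw [eth, pd_sin_zpow_mul _ hX hs, pd_sin_zpow_mul _ hX hs, zpow_neg]
  simp only [if_true, show (2 : Fin 3) ≠ 1 by decide, if_false]
  push_cast at h ⊢
  field_simp
  ring

lemma ethbar_eq (s : ℤ) {X : Scri → ℂ} {p : Scri} (hX : DifferentiableAt ℝ X p)
    (hs : Real.sin (p 1) ≠ 0) : ethbar s X p =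
      (pd 1 X p + s * (Real.cos (p 1) / Real.sin (p 1) : ℝ) * X p
        + Complex.I / Real.sin (p 1) * pd 2 X p) / (Real.sqrt 2 : ℂ) := by
  have h : ((Real.sin (p 1) ^ s : ℝ) : ℂ) ≠ 0 := by exact_mod_cast zpow_ne_zero s hs
  rw [ethbar, pd_sin_zpow_mul _ hX hs, pd_sin_zpow_mul _ hX hs, zpow_neg]
  simp only [if_true, show (2 : Fin 3) ≠ 1 by decide, if_false]
  push_cast at h ⊢
  field_simp
  ring

namespace KillingSpacetime

open Sm

variable {S : KillingSpacetime} {p : Scri} {α β γ αb βb A' μ ν : Sm S.Ω}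

lemma pd_xi1_zero (i : Fin 3) : pd i (xi1 0) p = 0 := pd_const i _

lemma pd_xi1_one (hs : Real.sin (p 1) ≠ 0) (i : Fin 3) : pd i (xi1 1) p =
    if i = 1 then Complex.I * Real.cos (p 1) / (Real.sqrt 2 * Real.sin (p 1) ^ 2) else 0 := by
  have h1 := ((Real.hasDerivAt_sin (p 1)).const_mul (Real.sqrt 2)).ofReal_comp
  have h2 : ((Real.sqrt 2 * Real.sin (p 1) : ℝ) : ℂ) ≠ 0 := by
    exact_mod_cast mul_ne_zero (by simp) hs
  have h3 := (h1.inv h2).const_mul (-Complex.I)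
  have h4 : xi1 1 = fun q : Scri => -Complex.I * ((Real.sqrt 2 * Real.sin (q 1) : ℝ) : ℂ)⁻¹ := rfl
  rw [h4]
  refine (pd_comp_coord h3 i).trans ?_
  split_ifs
  · have h5 : ((Real.sqrt 2 : ℝ) : ℂ) ≠ 0 := by simp
    have h6 : ((Real.sin (p 1) : ℝ) : ℂ) ≠ 0 := by exact_mod_cast hs
    push_cast at h5 h6 ⊢
    field_simp
  · rfl

lemma xi1_ne_zero (hs : Real.sin (p 1) ≠ 0) (i : Fin 2) : xi1 i p ≠ 0 := by
  have h6 : ((Real.sin (p 1) : ℝ) : ℂ) ≠ 0 := by exact_mod_cast hs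
  fin_cases i
  · simp [xi1]
  · simp only [xi1, Fin.mk_one, Matrix.cons_val_one, Matrix.cons_val_fin_one]
    exact div_ne_zero (by simp) (by exact_mod_cast mul_ne_zero (by simp) hs)

lemma pd_w (hp : p ∈ S.O) (j : Fin 3) (i : Fin 2) : pd j (S.w i) p =
    -(pd j S.cm1 p * xi1 i p + S.cm1 p * pd j (xi1 i) p)
    - (starRingEnd ℂ (pd j S.cm1 p) * starRingEnd ℂ (xi1 i p)
      + starRingEnd ℂ (S.cm1 p) * starRingEnd ℂ (pd j (xi1 i) p)) := by
  have hc : DifferentiableAt ℝ S.cm1 p := (contDiffAt_coeff S.c_exp hp _ _).differentiableAt (by simp)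
  have hx := (contDiffAt_xi1 hp i).differentiableAt (by simp)
  have hc' : DifferentiableAt ℝ (fun q => starRingEnd ℂ (S.cm1 q)) p :=
    Complex.conjCLE.differentiableAt.comp p hc
  have hx' : DifferentiableAt ℝ (fun q => starRingEnd ℂ (xi1 i q)) p :=
    Complex.conjCLE.differentiableAt.comp p hx
  have h1 : DifferentiableAt ℝ (fun q => S.cm1 q * xi1 i q) p := hc.mul hx
  have h2 : pd j (fun q => -(S.cm1 q * xi1 i q)) p = -pd j (fun q => S.cm1 q * xi1 i q) p := by
    simp [pd, fderiv_fun_neg]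
  have h3 := pd_sub j (f := fun q => -(S.cm1 q * xi1 i q))
    (g := fun q => starRingEnd ℂ (S.cm1 q) * starRingEnd ℂ (xi1 i q)) h1.neg (hc'.mul hx')
  rwa [h2, pd_mul j hc hx, pd_mul j hc' hx', pd_conj, pd_conj] at h3

section

variable {f : Sm S.Ω} {k : ℤ} {z : Scri → ℂ}

lemma dm_lead (hp : p ∈ S.O) (hf : S.JetLead p f k z) :
    HasLead (k + 1) (C (xi1 0 p * pd 1 z p + xi1 1 p * pd 2 z p)) (ray p (S.dm f)) := by
  rw [dm, ray_add, ray_mul, ray_mul]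
  exact ((((jetLead_sx hp 0).val.mul (hf.d 1)).add
    ((jetLead_sx hp 1).val.mul (hf.d 2))).congr_order (add_comm _ _)).congr_poly (by simp)

lemma dmb_lead (hp : p ∈ S.O) (hf : S.JetLead p f k z) :
    HasLead (k + 1) (C (starRingEnd ℂ (xi1 0 p) * pd 1 z p + starRingEnd ℂ (xi1 1 p) * pd 2 z p))
      (ray p (S.dmb f)) := by
  rw [dmb, ray_add, ray_mul, ray_mul]
  have h := fun i => (jetLead_sx (S := S) hp i).conj (S.conjPair_sx i)
  exact ((((h 0).val.mul (hf.d 1)).add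
    ((h 1).val.mul (hf.d 2))).congr_order (add_comm _ _)).congr_poly (by simp)

variable (hB : S.Brackets α β γ αb βb A' μ ν)

include hB

lemma dv_lead (hp : p ∈ S.O) (hf : S.JetLead p f k z) :
    HasLead k (C (S.b0 p * pd 0 z p - k * S.am1 p * z p + S.w 0 p * pd 1 z p + S.w 1 p * pd 2 z p))
      (ray p (S.dv f)) := by
  rw [dv_eq]
  rw [ray_add, ray_add, ray_add, ray_mul, ray_mul, ray_mul, ray_mul]
  have h0 := ((jetLead_sb hB hp).val.mul (hf.d 0)).congr_order (zero_add k)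
  have h1 := ((jetLead_vr hB hp).val.mul hf.dr).congr_order (show -1 + (k + 1) = k by ring)
  have h2 := ((jetLead_sw hB hp 0).val.mul (hf.d 1)).congr_order (zero_add k)
  have h3 := ((jetLead_sw hB hp 1).val.mul (hf.d 2)).congr_order (zero_add k)
  exact (((h0.add h1).add h2).add h3).congr_poly (by simp only [← C_mul, ← C_add]; ring_nf)

lemma α_pb (hp : p ∈ S.O) : PB 0 (ray p α) ∧ PB 0 (ray p αb) := by
  have h1 := (dm_lead hp (jetLead_vr hB hp)).pb
  have h2 := (dmb_lead hp (jetLead_vr hB hp)).pb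
  have h3 := fun f (h : PB 1 f) => (h.mul (jetLead_sU hp).val.pb).mono (by norm_num : (0 : ℤ) ≤ 1 + 0)
  have e1 := eq_sub_of_add_eq hB.α_eq
  have e2 := eq_sub_of_add_eq hB.αb_eq
  constructor
  · rw [e1, ray_sub, ray_neg, ray_mul]; exact h1.neg.sub (h3 _ (β_lead hB hp).1)
  · rw [e2, ray_sub, ray_neg, ray_mul]; exact h2.neg.sub (h3 _ (β_lead hB hp).2)

/-- In the radial component of `[v, n]` every term except `∂_u vʳ` is of order zero, whereas `∂_u
vʳ` grows like `r ∂_u a_{-1}`. -/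
lemma pd_zero_am1 (hp : p ∈ S.O) : pd 0 S.am1 p = 0 := by
  have hU := jetLead_sU (S := S) hp
  have hV := jetLead_vr hB hp
  have hUe := hB.U_eq
  generalize S.sa + S.sb * S.sU = V at hV hUe
  have e : S.D 0 V = S.dv S.sU + A' * S.sU - S.sU * S.D 1 V - S.sC 0 * S.D 2 V
      - S.sC 1 * S.D 3 V := by
    rw [dn] at hUe
    linear_combination -hUe
  have h1 : PB 0 (ray p (S.D 0 V)) := by
    rw [e]
    simp only [ray_sub, ray_add, ray_mul]
    have hC := fun i j => ((jetLead_sC hp i).val.pb.mul (hV.d j).pb)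
    have hd := (dv_lead hB hp hU).pb
    have hA := (A_lead hB hp).pb.mul hU.val.pb
    have hD := hU.val.pb.mul hV.dr.pb
    exact (((hd.add hA).sub hD).sub (hC 0 1)).sub (hC 1 2)
  exact C_eq_zero.mp ((hV.d 0).eq_zero h1)

/-- In the angular components of `[v, n]` every term except `∂_u vⁱ` is `O(1/r)` up to logarithms.
So the limit of `vⁱ` does not depend on `u`; neither does the leading `ξ`, and independence of `ξ`,
`ξ̄` gives the claim. -/
lemma pd_zero_cm1 (hp : p ∈ S.O) : pd 0 S.cm1 p = 0 := by
  have hs := (sin_pos_of_mem hp).ne'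
  refine eq_zero_of_xi1 hp (b := starRingEnd ℂ (pd 0 S.cm1 p)) fun i => ?_
  have hx := jetLead_sx (S := S) hp i
  have hw := jetLead_sw hB hp i
  have e : S.D 0 (S.sw i) = S.dv (S.sC i) + A' * S.sC i - αb * S.sx i - α * S.sy i
      - S.sU * S.D 1 (S.sw i) - S.sC 0 * S.D 2 (S.sw i) - S.sC 1 * S.D 3 (S.sw i) := by
    have := hB.C_eq i
    rw [dn] at this
    linear_combination -this
  have h1 : PB (0 + 1) (ray p (S.D 0 (S.sw i))) := by
    rw [e]
    simp only [ray_sub, ray_add, ray_mul]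
    have hC := fun i j => ((jetLead_sC hp i).val.pb.mul (hw.d j).pb)
    have hd := (dv_lead hB hp (jetLead_sC hp i)).pb
    have hA := (A_lead hB hp).pb.mul (jetLead_sC hp i).val.pb
    have h2 := (α_pb hB hp).2.mul hx.val.pb
    have h3 := (α_pb hB hp).1.mul (hx.conj (S.conjPair_sx i)).val.pb
    have hD := (jetLead_sU hp).val.pb.mul hw.dr.pb
    exact (((((hd.add hA).sub h2).sub h3).sub hD).sub (hC 0 1)).sub (hC 1 2)
  have h2 := C_eq_zero.mp ((hw.d 0).eq_zero h1)
  have h3 : pd 0 (xi1 i) p = 0 := by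
    fin_cases i
    · exact pd_xi1_zero 0
    · exact pd_xi1_one hs 0
  rw [pd_w hp, h3, map_zero] at h2
  linear_combination -h2

/-- Dividing the `θ` component of `[v, m]` by `ξ^θ` shows that `γ` has a limit. Uniqueness of
leading terms then gives the relation for both angular components. -/
lemma γ_lead (hp : p ∈ S.O) : ∃ g : ℂ, HasLead 0 (C g) (ray p γ) ∧
    ∀ i, g * xi1 i p = -S.am1 p * xi1 i p + S.w 0 p * pd 1 (xi1 i) p + S.w 1 p * pd 2 (xi1 i) p
      + S.b0 p * pd 0 (xi1 i) p - (xi1 0 p * pd 1 (S.w i) p + xi1 1 p * pd 2 (S.w i) p) := by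
  have hs := (sin_pos_of_mem hp).ne'
  have h : ∀ i, HasLead 1 (C (-S.am1 p * xi1 i p + S.w 0 p * pd 1 (xi1 i) p
      + S.w 1 p * pd 2 (xi1 i) p + S.b0 p * pd 0 (xi1 i) p
      - (xi1 0 p * pd 1 (S.w i) p + xi1 1 p * pd 2 (S.w i) p))) (ray p γ * ray p (S.sx i)) := by
    intro i
    have e := eq_sub_of_add_eq (hB.γ_eq i)
    rw [← ray_mul, e, ray_sub, ray_sub, ray_mul]
    have hd := dv_lead hB hp (jetLead_sx hp i)
    have hm := dm_lead hp (jetLead_sw hB hp i)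
    have hC := HasLead.of_pb (k := 1) ((β_lead hB hp).1.mul (jetLead_sC hp i).val.pb)
    exact ((hd.sub hm).sub hC).congr_poly (by simp only [sub_zero, ← C_sub]; push_cast; ring_nf)
  have hg := ((h 0).congr_order (zero_add 1).symm).of_mul (jetLead_sx hp 0).val (xi1_ne_zero hs 0)
  refine ⟨_, hg, fun i => ?_⟩
  have := (hg.mul (jetLead_sx hp i).val).unique ((h i).congr_order (zero_add 1).symm)
  rw [← C_mul] at this
  exact C_injective this

lemma γb_lead (hp : p ∈ S.O) : ∃ g : ℂ, HasLead 0 (C g) (ray p γ) ∧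
    ∀ i, -g * starRingEnd ℂ (xi1 i p) = -S.am1 p * starRingEnd ℂ (xi1 i p)
      + S.w 0 p * starRingEnd ℂ (pd 1 (xi1 i) p) + S.w 1 p * starRingEnd ℂ (pd 2 (xi1 i) p)
      + S.b0 p * starRingEnd ℂ (pd 0 (xi1 i) p)
      - (starRingEnd ℂ (xi1 0 p) * pd 1 (S.w i) p + starRingEnd ℂ (xi1 1 p) * pd 2 (S.w i) p) := by
  obtain ⟨g, hg, -⟩ := γ_lead hB hp
  refine ⟨g, hg, fun i => ?_⟩
  have hy := (jetLead_sx (S := S) hp i).conj (S.conjPair_sx i)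
  have e := eq_sub_of_add_eq (hB.γb_eq i)
  have hd := dv_lead hB hp hy
  have hm := dmb_lead hp (jetLead_sw hB hp i)
  have hC := HasLead.of_pb (k := 1) ((β_lead hB hp).2.mul (jetLead_sC hp i).val.pb)
  have h1 := (hg.neg.mul hy.val).congr_order (zero_add 1)
  rw [← ray_neg, ← ray_mul, e, ray_sub, ray_sub, ray_mul] at h1
  have := h1.unique ((hd.sub hm).sub hC)
  rw [sub_zero, ← C_sub, ← C_neg, ← C_mul, pd_conj, pd_conj, pd_conj] at this
  have := C_injective this
  rw [this]; push_cast; ring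

/-- The brackets with `m` and with `m̄` give two formulas, for `γ` and for `-γ`. The first is the
limit asserted; adding the two gives the conformal Killing relation on the sphere. -/
lemma γ_lead_eq (hp : p ∈ S.O) : ∃ g : ℂ, HasLead 0 (C g) (ray p γ) ∧
    g = -S.am1 p + S.ethc p + (Real.cos (p 1) / (Real.sqrt 2 * Real.sin (p 1)) : ℝ)
      * (starRingEnd ℂ (S.cm1 p) - S.cm1 p) ∧
    2 * S.am1 p = S.ethc p + S.ethbarcbar p := by
  obtain ⟨g, hg, h1⟩ := γ_lead hB hp
  obtain ⟨g', hg', h2⟩ := γb_lead hB hp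
  obtain rfl := C_injective (hg'.unique hg)
  have hs := (sin_pos_of_mem hp).ne'
  have hc : DifferentiableAt ℝ S.cm1 p := (contDiffAt_coeff S.c_exp hp _ _).differentiableAt (by simp)
  have hc' : DifferentiableAt ℝ (fun q => starRingEnd ℂ (S.cm1 q)) p :=
    Complex.conjCLE.differentiableAt.comp p hc
  have h5 : ((Real.sqrt 2 : ℝ) : ℂ) ≠ 0 := by simp
  have h6 : ((Real.sin (p 1) : ℝ) : ℂ) ≠ 0 := by exact_mod_cast hs
  have h7 : ((Real.sqrt 2 : ℝ) : ℂ) ^ 2 = 2 := by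
    rw [← Complex.ofReal_pow, Real.sq_sqrt (by norm_num)]; norm_num
  rw [ethc, ethbarcbar, eth_eq _ hc hs, ethbar_eq _ hc' hs, pd_conj, pd_conj]
  have a0 := h1 0
  have a1 := h1 1
  have b0 := h2 0
  have b1 := h2 1
  simp only [pd_w hp, pd_xi1_zero, pd_xi1_one hs, w, if_true, show (2 : Fin 3) ≠ 1 by decide,
    show (0 : Fin 3) ≠ 1 by decide, if_false] at a0 a1 b0 b1
  simp only [xi1, Matrix.cons_val_zero, Matrix.cons_val_one, map_div₀, map_one, map_neg,
    Complex.conj_ofReal, Complex.conj_I, Complex.ofReal_mul, map_mul, map_pow, map_zero] at a0 a1 b0 b1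
  -- The multipliers are the components of the covector dual to `ξ`: it is one on the leading `ξ`
  -- and zero on `ξ̄`. For `g2` the conjugate covector is used.
  have g1 : g' = -S.am1 p + (pd 1 S.cm1 p - Complex.I / Real.sin (p 1) * pd 2 S.cm1 p
      + Real.cos (p 1) / Real.sin (p 1) * starRingEnd ℂ (S.cm1 p)) / (Real.sqrt 2 : ℂ) := by
    linear_combination (norm := skip) ((Real.sqrt 2 : ℝ) : ℂ) / 2 * a0 +
      Complex.I * ((Real.sqrt 2 : ℝ) : ℂ) * ((Real.sin (p 1) : ℝ) : ℂ) / 2 * a1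
    field_simp
    ring_nf
    simp only [Complex.I_sq, Complex.I_pow_three]
    ring_nf
  have g2 : -g' = -S.am1 p + (starRingEnd ℂ (pd 1 S.cm1 p)
      + Complex.I / Real.sin (p 1) * starRingEnd ℂ (pd 2 S.cm1 p)
      + Real.cos (p 1) / Real.sin (p 1) * S.cm1 p) / (Real.sqrt 2 : ℂ) := by
    linear_combination (norm := skip) ((Real.sqrt 2 : ℝ) : ℂ) / 2 * b0 -
      Complex.I * ((Real.sqrt 2 : ℝ) : ℂ) * ((Real.sin (p 1) : ℝ) : ℂ) / 2 * b1
    field_simp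
    ring_nf
    simp only [Complex.I_sq, Complex.I_pow_three]
    ring_nf
  refine ⟨g', hg, ?_, ?_⟩
  · rw [g1]; push_cast at h5 h6 ⊢; field_simp; ring
  · rw [g1] at g2; push_cast at h5 h6 g2 ⊢; linear_combination g2

end

end KillingSpacetime

end

/-! ### Comparison of two spacetimes up to a given relative order -/

section

open Filter Asymptotics Polynomial

/-- Two functions of order `r⁻ᵏ` that differ by terms of order `r⁻ᵏ⁻ˢ`. -/
structure Pair (k s : ℤ) (f f' : ℝ → ℂ) : Prop where
  left : PB k f
  right : PB k f'
  diff : PB (k + s) (f - f')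

namespace Pair

variable {k l s : ℤ} {f f' g g' : ℝ → ℂ}

lemma of_eq (h : PB k f) (hf : f =ᶠ[atTop] f') : Pair k s f f' :=
  ⟨h, h.congr hf, PB.zero.congr (by filter_upwards [hf] with r hr; simp [hr])⟩

lemma congr_order (h : Pair k s f f') (hk : k = l) : Pair l s f f' := hk ▸ h

lemma lower (h : Pair k s f f') (hk : l ≤ k) : Pair l s f f' :=
  ⟨h.left.mono hk, h.right.mono hk, h.diff.mono (by omega)⟩

lemma add (hf : Pair k s f f') (hg : Pair k s g g') : Pair k s (f + g) (f' + g') :=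
  ⟨hf.left.add hg.left, hf.right.add hg.right, by
    rw [add_sub_add_comm]; exact hf.diff.add hg.diff⟩

lemma neg (hf : Pair k s f f') : Pair k s (-f) (-f') :=
  ⟨hf.left.neg, hf.right.neg, by rw [neg_sub_neg, ← neg_sub]; exact hf.diff.neg⟩

lemma sub (hf : Pair k s f f') (hg : Pair k s g g') : Pair k s (f - g) (f' - g') := by
  simpa only [sub_eq_add_neg] using hf.add hg.neg

lemma smul (z : ℂ) (hf : Pair k s f f') : Pair k s (z • f) (z • f') :=
  ⟨hf.left.smul z, hf.right.smul z, by rw [← smul_sub]; exact hf.diff.smul z⟩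

lemma mul (hf : Pair k s f f') (hg : Pair l s g g') : Pair (k + l) s (f * g) (f' * g') :=
  ⟨hf.left.mul hg.left, hf.right.mul hg.right, by
    have h1 := (hf.left.mul hg.diff).congr_order (add_assoc k l s).symm
    have h2 := (hf.diff.mul hg.right).congr_order (show k + s + l = k + l + s by ring)
    have h3 := h1.add h2
    rwa [mul_sub, sub_mul, sub_add_sub_cancel] at h3⟩

lemma conj (hf : Pair k s f f') :
    Pair k s (fun r => starRingEnd ℂ (f r)) (fun r => starRingEnd ℂ (f' r)) :=
  ⟨hf.left.conj, hf.right.conj, hf.diff.conj.congr (Eventually.of_forall fun _ => map_sub _ _ _)⟩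

/-- The quotient inherits the relative accuracy, because `(f - f') g = (f g - f' g') - f' (g - g')`.
-/
lemma of_mul {z z' : ℂ} (h : Pair (k + l) s (f * g) (f' * g')) (hg : Pair l s g g')
    (hz : HasLead l (C z) g) (hz' : HasLead l (C z') g') (h0 : z ≠ 0) (h0' : z' ≠ 0) :
    Pair k s f f' := by
  have hr : PB k f' := h.right.of_mul hz' h0'
  refine ⟨h.left.of_mul hz h0, hr, PB.of_mul (l := l) ?_ hz h0⟩
  have := (h.diff.congr_order (show k + l + s = k + s + l by ring)).sub
    ((hr.mul hg.diff).congr_order (show k + (l + s) = k + s + l by ring))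
  rwa [mul_sub, sub_sub_sub_cancel_right, ← sub_mul] at this
lemma of_rayExp {k₀ : ℤ} {a a' : ℤ → ℕ → ℂ} (h : RayExp f k₀ a) (h' : RayExp f' k₀ a') (hk : k₀ ≤ k)
    (hs : 0 ≤ s) (h0 : ∀ l < k, ∀ j, a l j = 0) (heq : ∀ l < k + s, ∀ j, a l j = a' l j) :
    Pair k s f f' :=
  ⟨h.pb hk h0, h'.pb hk fun l hl j => by rw [← heq l (by omega) j, h0 l hl j],
    (h.sub h').pb (by omega) fun l hl j => by rw [heq l hl j, sub_self]⟩

end Pair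

namespace KillingSpacetime

open Sm

variable {S S' : KillingSpacetime} {p : Scri}

/-- `Pair` for a function and its first derivatives. -/
structure JetPair (p : Scri) (k s : ℤ) (f : Sm S.Ω) (f' : Sm S'.Ω) : Prop where
  val : Pair k s (ray p f) (ray p f')
  d : ∀ i : Fin 3, Pair k s (ray p (S.D (emb i) f)) (ray p (S'.D (emb i) f'))
  dr : Pair (k + 1) s (ray p (S.D 1 f)) (ray p (S'.D 1 f'))

namespace JetPair

variable {f g : Sm S.Ω} {f' g' : Sm S'.Ω} {k l s : ℤ}

lemma of_exp {k₀ : ℤ} {e e' : Coeffs} (h : S.Exp p f k₀ e) (h' : S'.Exp p f' k₀ e') (hk : k₀ ≤ k)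
    (hs : 0 ≤ s) (h0 : ∀ l < k, ∀ j, e l j =ᶠ[𝓝 p] fun _ => 0)
    (heq : ∀ l < k + s, ∀ j, e l j = e' l j) : JetPair p k s f f' where
  val := .of_rayExp h.val h'.val hk hs (fun l hl j => (h0 l hl j).eq_of_nhds)
    fun l hl j => by rw [heq l hl]
  d i := .of_rayExp (h.d i) (h'.d i) hk hs
    (fun l hl j => by rw [pd_congr (h0 l hl j), pd_const]) fun l hl j => by rw [heq l hl]
  dr := .of_rayExp h.dr h'.dr (by omega) hs
    (fun l hl j => by
      rw [(h0 (l - 1) (by omega) j).eq_of_nhds, (h0 (l - 1) (by omega) (j + 1)).eq_of_nhds]; simp)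
    fun l hl j => by rw [heq (l - 1) (by omega), heq (l - 1) (by omega)]

lemma lower (h : JetPair p k s f f') (hk : l ≤ k) : JetPair p l s f f' :=
  ⟨h.val.lower hk, fun i => (h.d i).lower hk, h.dr.lower (by omega)⟩

lemma neg (h : JetPair p k s f f') : JetPair p k s (-f) (-f') where
  val := by simpa using h.val.neg
  d i := by simpa using (h.d i).neg
  dr := by simpa using h.dr.neg

lemma add (hf : JetPair p k s f f') (hg : JetPair p k s g g') :
    JetPair p k s (f + g) (f' + g') where
  val := by simpa using hf.val.add hg.val
  d i := by simpa using (hf.d i).add (hg.d i)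
  dr := by simpa using hf.dr.add hg.dr

lemma sub (hf : JetPair p k s f f') (hg : JetPair p k s g g') :
    JetPair p k s (f - g) (f' - g') := by
  simpa only [sub_eq_add_neg] using hf.add hg.neg

lemma mul (hf : JetPair p k s f f') (hg : JetPair p l s g g') :
    JetPair p (k + l) s (f * g) (f' * g') where
  val := by simpa using hf.val.mul hg.val
  d i := by
    simp only [Derivation.leibniz, smul_eq_mul, ray_add, ray_mul]
    exact (hf.val.mul (hg.d i)).add ((hg.val.mul (hf.d i)).congr_order (add_comm l k))
  dr := by
    simp only [Derivation.leibniz, smul_eq_mul, ray_add, ray_mul]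
    exact ((hf.val.mul hg.dr).congr_order (by ring)).add
      ((hg.val.mul hf.dr).congr_order (by ring))

lemma conj (h : JetPair p k s f f') (hfg : ConjPair f g) (hfg' : ConjPair f' g') :
    JetPair p k s g g' where
  val := by rw [hfg.ray, hfg'.ray]; exact h.val.conj
  d i := by rw [(conjPair_D hfg _).ray, (conjPair_D hfg' _).ray]; exact (h.d i).conj
  dr := by rw [(conjPair_D hfg _).ray, (conjPair_D hfg' _).ray]; exact h.dr.conj



end JetPair

/-- The leading coefficients agree, those of the Killing field up to relative order `s`, and those
of the tetrad too. -/
structure Agree (S S' : KillingSpacetime) (s : ℤ) : Prop where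
  pos : 1 ≤ s
  b0 : S.b0 = S'.b0
  aE : ∀ l < s - 1, ∀ j, S.aE l j = S'.aE l j
  cE : ∀ l < s - 1, ∀ j, S.cE l j = S'.cE l j
  UE : ∀ l < s + 1, ∀ j, S.UE l j = S'.UE l j
  CE : ∀ i, ∀ l < s + 1, ∀ j, S.CE i l j = S'.CE i l j
  xiE : ∀ i, ∀ l < s + 1, ∀ j, S.xiE i l j = S'.xiE i l j

section

variable {s : ℤ} (h : Agree S S' s) (hp : p ∈ S.O) (hp' : p ∈ S'.O)

include h hp hp'

lemma pair_sU : JetPair p 0 s S.sU S'.sU :=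
  .of_exp (exp_sU hp) (exp_sU hp') le_rfl (by linarith [h.pos])
    (fun l hl j => (eventually_mem hp).mono fun q hq => S.U_exp.2.2.1 l j hl q hq)
    fun l hl j => h.UE l (by omega) j

lemma pair_sx (i : Fin 2) : JetPair p 1 s (S.sx i) (S'.sx i) :=
  .of_exp (exp_sx hp i) (exp_sx hp' i) le_rfl (by linarith [h.pos])
    (fun l hl j => (eventually_mem hp).mono fun q hq => (S.xi_exp i).2.2.1 l j hl q hq)
    fun l hl j => h.xiE i l (by omega) j

lemma pair_sy (i : Fin 2) : JetPair p 1 s (S.sy i) (S'.sy i) :=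
  (pair_sx h hp hp' i).conj (S.conjPair_sx i) (S'.conjPair_sx i)

lemma pair_sC (i : Fin 2) : JetPair p 1 s (S.sC i) (S'.sC i) := by
  have hz : ∀ (S : KillingSpacetime), p ∈ S.O → ∀ l < 2, ∀ j, S.CE i l j =ᶠ[𝓝 p] fun _ => 0 :=
    fun S hp l hl j => (eventually_mem hp).mono fun q hq => (S.C_exp i).2.2.1 l j hl q hq
  -- Agreement through order `s` is relative accuracy `s - 1` for a function starting at order two,
  -- and relative accuracy `s` when it is counted from order one.
  have h2 : JetPair p 2 (s - 1) (S.sC i) (S'.sC i) :=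
    .of_exp (exp_sC hp i) (exp_sC hp' i) le_rfl (by linarith [h.pos]) (hz S hp)
      fun l hl j => h.CE i l (by omega) j
  exact ⟨⟨h2.val.left.mono (by norm_num), h2.val.right.mono (by norm_num),
      h2.val.diff.congr_order (by ring)⟩,
    fun k => ⟨(h2.d k).left.mono (by norm_num), (h2.d k).right.mono (by norm_num),
      (h2.d k).diff.congr_order (by ring)⟩,
    ⟨h2.dr.left.mono (by norm_num), h2.dr.right.mono (by norm_num),
      h2.dr.diff.congr_order (by ring)⟩⟩

lemma pair_sa : JetPair p (-1) s S.sa S'.sa :=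
  .of_exp (exp_sa hp) (exp_sa hp') le_rfl (by linarith [h.pos])
    (fun l hl j => (eventually_mem hp).mono fun q hq => S.a_exp.2.2.1 l j hl q hq)
    fun l hl j => h.aE l (by omega) j

lemma pair_sc : JetPair p (-1) s S.sc S'.sc :=
  .of_exp (exp_sc hp) (exp_sc hp') le_rfl (by linarith [h.pos])
    (fun l hl j => (eventually_mem hp).mono fun q hq => S.c_exp.2.2.1 l j hl q hq)
    fun l hl j => h.cE l (by omega) j

variable {α β γ αb βb A' μ ν : Sm S.Ω} (hB : S.Brackets α β γ αb βb A' μ ν)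
  {α' β' γ' αb' βb' A'' μ' ν' : Sm S'.Ω} (hB' : S'.Brackets α' β' γ' αb' βb' A'' μ' ν')

include hB hB'

omit h hp hp' hB hB' in
lemma pair_of_scri {f : Sm S.Ω} {f' : Sm S'.Ω} {z : Scri → ℂ}
    (hf : ∀ x (hx : x ∈ S.Ω), ev hx f = z (toScri x))
    (hf' : ∀ x (hx : x ∈ S'.Ω), ev hx f' = z (toScri x)) (hp : p ∈ S.O) (hp' : p ∈ S'.O) :
    Pair 0 s (ray p f) (ray p f') :=
  .of_eq (ray_of_scri hf hp).pb ((ray_eventuallyEq hf hp).trans (ray_eventuallyEq hf' hp').symm)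

omit h hp hp' hB hB' in
lemma jetPair_of_scri {f : Sm S.Ω} {f' : Sm S'.Ω} {z : Scri → ℂ}
    (hz : ContDiffOn ℝ ∞ z S.O) (hz' : ContDiffOn ℝ ∞ z S'.O)
    (hf : ∀ x (hx : x ∈ S.Ω), ev hx f = z (toScri x))
    (hf' : ∀ x (hx : x ∈ S'.Ω), ev hx f' = z (toScri x)) (h1 : S.D 1 f = 0) (h1' : S'.D 1 f' = 0)
    (hp : p ∈ S.O) (hp' : p ∈ S'.O) : JetPair p 0 s f f' where
  val := pair_of_scri hf hf' hp hp'
  d i := pair_of_scri (fun _ hx => ev_D_of_scri hz hf i hx) (fun _ hx => ev_D_of_scri hz' hf' i hx)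
    hp hp'
  dr := by rw [h1, h1', ray_zero, ray_zero]; exact .of_eq .zero EventuallyEq.rfl

/-- As `b` equals its order-zero coefficient exactly, agreement of that one coefficient gives
agreement to every order. -/
lemma pair_sb : JetPair p 0 s S.sb S'.sb :=
  jetPair_of_scri (z := S.b0) (S.b_exp.2.1 0 0) (h.b0 ▸ S'.b_exp.2.1 0 0)
    (fun _ hx => b_eq hB hx) (fun _ hx => h.b0 ▸ b_eq hB' hx) hB.b_r hB'.b_r hp hp'

/-- Second derivatives of `b` have to be compared too: the shear equation contains `m(β)`, and `β =
-m(b)`. -/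
lemma pair_D_sb (i : Fin 3) : JetPair p 0 s (S.D (emb i) S.sb) (S'.D (emb i) S'.sb) := by
  have hs := S.b_exp.2.1 0 0
  have hs' : ContDiffOn ℝ ∞ S.b0 S'.O := h.b0 ▸ S'.b_exp.2.1 0 0
  have hb' : ∀ x (hx : x ∈ S'.Ω), ev hx S'.sb = S.b0 (toScri x) := fun _ hx => h.b0 ▸ b_eq hB' hx
  exact jetPair_of_scri (contDiffOn_pd S.isOpen_O hs i) (contDiffOn_pd S'.isOpen_O hs' i)
    (fun _ hx => ev_D_of_scri hs (fun _ hx => b_eq hB hx) i hx)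
    (fun _ hx => ev_D_of_scri hs' hb' i hx)
    (by rw [D_comm, hB.b_r, map_zero]) (by rw [D_comm, hB'.b_r, map_zero]) hp hp'

lemma pair_vr : JetPair p (-1) s (S.sa + S.sb * S.sU) (S'.sa + S'.sb * S'.sU) :=
  (pair_sa h hp hp').add (((pair_sb h hp hp' hB hB').mul (pair_sU h hp hp')).lower (by norm_num))

lemma pair_sw (i : Fin 2) : JetPair p 0 s (S.sw i) (S'.sw i) := by
  have hc := pair_sc h hp hp'
  have h1 := ((pair_sb h hp hp' hB hB').mul (pair_sC h hp hp' i)).lower (l := 0) (by norm_num)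
  exact (h1.sub (hc.mul (pair_sx h hp hp' i))).sub
    ((hc.conj S.conjPair_sc S'.conjPair_sc).mul (pair_sy h hp hp' i))

omit hB hB' in
lemma pair_dm {f : Sm S.Ω} {f' : Sm S'.Ω} {k : ℤ} (hf : JetPair p k s f f') :
    Pair (k + 1) s (ray p (S.dm f)) (ray p (S'.dm f')) := by
  simp only [dm, ray_add, ray_mul]
  exact (((pair_sx h hp hp' 0).val.mul (hf.d 1)).add
    ((pair_sx h hp hp' 1).val.mul (hf.d 2))).congr_order (add_comm _ _)

omit hB hB' in
lemma pair_dmb {f : Sm S.Ω} {f' : Sm S'.Ω} {k : ℤ} (hf : JetPair p k s f f') :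
    Pair (k + 1) s (ray p (S.dmb f)) (ray p (S'.dmb f')) := by
  simp only [dmb, ray_add, ray_mul]
  exact (((pair_sy h hp hp' 0).val.mul (hf.d 1)).add
    ((pair_sy h hp hp' 1).val.mul (hf.d 2))).congr_order (add_comm _ _)

lemma pair_dv {f : Sm S.Ω} {f' : Sm S'.Ω} {k : ℤ} (hf : JetPair p k s f f') :
    Pair k s (ray p (S.dv f)) (ray p (S'.dv f')) := by
  have hv := (pair_vr h hp hp' hB hB').val
  have hw := fun i => (pair_sw h hp hp' hB hB' i).val
  rw [dv_eq, dv_eq]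
  simp only [ray_add, ray_mul] at hv ⊢
  exact (((((pair_sb h hp hp' hB hB').val.mul (hf.d 0)).congr_order (zero_add k)).add
    ((hv.mul hf.dr).congr_order (by ring))).add
    (((hw 0).mul (hf.d 1)).congr_order (zero_add k))).add
    (((hw 1).mul (hf.d 2)).congr_order (zero_add k))

lemma pair_β : JetPair p 1 s β β' := by
  rw [hB.β_eq, hB'.β_eq]
  exact (((pair_sx h hp hp' 0).mul (pair_D_sb h hp hp' hB hB' 1)).add
    ((pair_sx h hp hp' 1).mul (pair_D_sb h hp hp' hB hB' 2))).neg

lemma pair_βb : JetPair p 1 s βb βb' := by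
  rw [hB.βb_eq, hB'.βb_eq]
  exact (((pair_sy h hp hp' 0).mul (pair_D_sb h hp hp' hB hB' 1)).add
    ((pair_sy h hp hp' 1).mul (pair_D_sb h hp hp' hB hB' 2))).neg

lemma pair_A : Pair 0 s (ray p A') (ray p A'') := by
  rw [hB.A_eq, hB'.A_eq, ray_neg, ray_neg]
  exact (pair_vr h hp hp' hB hB').dr.neg

lemma pair_αb : Pair 0 s (ray p αb) (ray p αb') := by
  rw [eq_sub_of_add_eq hB.αb_eq, eq_sub_of_add_eq hB'.αb_eq]
  have h1 := (pair_dmb h hp hp' (pair_vr h hp hp' hB hB')).neg.sub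
    (((pair_βb h hp hp' hB hB').mul (pair_sU h hp hp')).val.lower (by norm_num))
  simpa only [ray_sub, ray_neg] using h1.congr_order (neg_add_cancel 1)

lemma pair_γ : Pair 0 s (ray p γ) (ray p γ') := by
  have hx := pair_sx h hp hp' 0
  refine Pair.of_mul (k := 0) (l := 1) ?_ hx.val (jetLead_sx hp 0).val (jetLead_sx hp' 0).val
    (xi1_ne_zero (sin_pos_of_mem hp).ne' 0) (xi1_ne_zero (sin_pos_of_mem hp).ne' 0)
  rw [← ray_mul, ← ray_mul, eq_sub_of_add_eq (hB.γ_eq 0), eq_sub_of_add_eq (hB'.γ_eq 0)]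
  simp only [ray_sub]
  exact ((pair_dv h hp hp' hB hB' hx).sub (pair_dm h hp hp' (pair_sw h hp hp' hB hB' 0))).sub
    (((pair_β h hp hp' hB hB').mul (pair_sC h hp hp' 0)).val.lower (by norm_num))

end

end KillingSpacetime

end

/-! ### The leading part of the difference of two transport equations -/

section

open Filter Asymptotics Polynomial

namespace KillingSpacetime

open Sm

variable {S S' : KillingSpacetime} {p : Scri}

lemma xi1_det_ne_zero (hp : p ∈ S.O) :
    xi1 0 p * starRingEnd ℂ (xi1 1 p) - xi1 1 p * starRingEnd ℂ (xi1 0 p) ≠ 0 := by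
  intro h
  have := eq_zero_of_xi1 hp (a := starRingEnd ℂ (xi1 0 p)) (b := -xi1 0 p) fun i => by
    fin_cases i
    · simp; ring
    · simp; linear_combination -h
  rw [map_eq_zero] at this
  exact xi1_ne_zero (sin_pos_of_mem hp).ne' 0 this

lemma delta_lead (hp : p ∈ S.O) : HasLead 2
    (C (xi1 0 p * starRingEnd ℂ (xi1 1 p) - xi1 1 p * starRingEnd ℂ (xi1 0 p)))
    (ray p (S.sx 0 * S.sy 1 - S.sx 1 * S.sy 0)) := by
  have hx := fun i => (jetLead_sx (S := S) hp i).val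
  have hy := fun i => ((jetLead_sx (S := S) hp i).conj (S.conjPair_sx i)).val
  rw [ray_sub, ray_mul, ray_mul]
  exact (((hx 0).mul (hy 1)).sub ((hx 1).mul (hy 0))).congr_poly (by simp)

section

variable {s : ℤ} (h : Agree S S' s) (hp : p ∈ S.O) (hp' : p ∈ S'.O)
  {α β γ αb βb A' μ ν : Sm S.Ω} (hB : S.Brackets α β γ αb βb A' μ ν)
  {α' β' γ' αb' βb' A'' μ' ν' : Sm S'.Ω} (hB' : S'.Brackets α' β' γ' αb' βb' A'' μ' ν')

include h hp hp' hB hB'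

omit hB hB' in
lemma pair_of_delta_mul {f : Sm S.Ω} {f' : Sm S'.Ω}
    (hf : Pair 3 s (ray p ((S.sx 0 * S.sy 1 - S.sx 1 * S.sy 0) * f))
      (ray p ((S'.sx 0 * S'.sy 1 - S'.sx 1 * S'.sy 0) * f'))) : Pair 1 s (ray p f) (ray p f') := by
  have hd : Pair 2 s (ray p (S.sx 0 * S.sy 1 - S.sx 1 * S.sy 0))
      (ray p (S'.sx 0 * S'.sy 1 - S'.sx 1 * S'.sy 0)) :=
    (((pair_sx h hp hp' 0).mul (pair_sy h hp hp' 1)).sub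
      ((pair_sx h hp hp' 1).mul (pair_sy h hp hp' 0))).val
  refine Pair.of_mul (k := 1) (l := 2) ?_ hd (delta_lead hp) (delta_lead hp') (xi1_det_ne_zero hp)
    (xi1_det_ne_zero hp)
  rw [mul_comm, mul_comm (ray p f'), ← ray_mul, ← ray_mul]
  exact hf

lemma pair_μ : Pair 1 s (ray p μ) (ray p μ') := by
  refine pair_of_delta_mul h hp hp' ?_
  rw [hB.μ_eq, hB'.μ_eq]
  have hx := fun i => (pair_sx h hp hp' i)
  have hy := fun i => (pair_sy h hp hp' i)
  have hd := fun i => (pair_dmb h hp hp' (hx i)).sub (pair_dm h hp hp' (hy i))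
  simp only [ray_sub, ray_mul]
  exact ((hx 0).val.mul (hd 1)).sub ((hx 1).val.mul (hd 0))

lemma pair_ν : Pair 1 s (ray p ν) (ray p ν') := by
  refine pair_of_delta_mul h hp hp' ?_
  rw [hB.ν_eq, hB'.ν_eq]
  have hx := fun i => (pair_sx h hp hp' i).val
  have hC := fun i => (pair_sC h hp hp' i).dr
  simp only [ray_sub, ray_mul]
  exact ((hx 0).mul (hC 1)).sub ((hx 1).mul (hC 0))

/-- The leading part of the difference of two transport equations. -/
lemma transport_of_eq {k₀ n : ℤ} (hn : k₀ ≤ n) (hs : n + 1 ≤ k₀ + s) {X Y H : Sm S.Ω}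
    {X' Y' H' : Sm S'.Ω} {e e' : Coeffs} {h0 : ℂ} (hX : S.Exp p X k₀ e) (hX' : S'.Exp p X' k₀ e')
    (he' : ∀ l < k₀, ∀ j, e' l j =ᶠ[𝓝 p] fun _ => 0)
    {j : ℕ} (heq : ∀ l < n, ∀ i, e l i =ᶠ[𝓝 p] e' l i)
    (heqj : ∀ i, j < i → e n i =ᶠ[𝓝 p] e' n i)
    (hv : S.dv X = H * X + Y) (hv' : S'.dv X' = H' * X' + Y')
    (hH : Pair 0 s (ray p H) (ray p H')) (hH0 : HasLead 0 (C h0) (ray p H))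
    (hY : PB (n + 1) (ray p Y - ray p Y')) :
    S.b0 p * pd 0 (e n j) p + S.w 0 p * pd 1 (e n j) p + S.w 1 p * pd 2 (e n j) p
      + (-n * S.am1 p - h0) * e n j p =
    S.b0 p * pd 0 (e' n j) p + S.w 0 p * pd 1 (e' n j) p + S.w 1 p * pd 2 (e' n j) p
      + (-n * S.am1 p - h0) * e' n j p := by
  have pX' : PB k₀ (ray p X') := hX'.val.pb le_rfl fun l hl j => (he' l hl j).eq_of_nhds
  have pdX' : ∀ i, PB k₀ (ray p (S'.D (emb i) X')) := fun i =>
    (hX'.d i).pb le_rfl fun l hl j => by rw [pd_congr (he' l hl j), pd_const]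
  have prX' : PB (k₀ + 1) (ray p (S'.D 1 X')) := hX'.dr.pb le_rfl fun l hl j => by
    rw [(he' (l - 1) (by omega) j).eq_of_nhds, (he' (l - 1) (by omega) (j + 1)).eq_of_nhds]; simp
  -- Below order `n` the coefficients agree, so the difference of the two solutions starts at order
  -- `n`, and likewise for its derivatives.
  obtain ⟨q, hq, hl⟩ := (hX.val.sub hX'.val).lead hn fun l hl j => by
    rw [(heq l hl j).eq_of_nhds, sub_self]
  have := fun i => ((hX.d i).sub (hX'.d i)).lead hn fun l hl j => by
    rw [pd_congr (heq l hl j), sub_self]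
  choose qd hqd hld using this
  obtain ⟨qr, hqr, hlr⟩ := (hX.dr.sub hX'.dr).lead (K := n + 1) (by omega) fun l hl j => by
    rw [(heq (l - 1) (by omega) j).eq_of_nhds, (heq (l - 1) (by omega) (j + 1)).eq_of_nhds, sub_self]
  have hb := pair_sb h hp hp' hB hB'
  have hV := (pair_vr h hp hp' hB hB').val
  have hw := fun i => (pair_sw h hp hp' hB hB' i).val
  have lb := (jetLead_sb hB hp).val
  have lV := (jetLead_vr hB hp).val
  have lw := fun i => (jetLead_sw hB hp i).val
  -- each product contributes its leading term and a remainder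
  have key : ∀ {k l : ℤ} {F F' G G' : ℝ → ℂ} {a : ℂ} {r : ℂ[X]}, Pair k s F F' →
      HasLead k (C a) F → PB (k₀ - k) G' → HasLead l r (G - G') → k + l = n →
      HasLead n (C a * r) (F * G - F' * G') := by
    intro k l F F' G G' a r h1 h2 h3 h4 hk
    have h5 := (h2.mul h4).congr_order hk
    -- The orders `k + s` and `k₀ - k` add up to `k₀ + s ≥ n + 1`, so a change of the coefficient
    -- `F` is invisible at order `n`.
    have h6 : HasLead n 0 ((F - F') * G') := .of_pb ((h1.diff.mul h3).mono (by linarith))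
    have := h5.add h6
    rwa [mul_sub, sub_mul, sub_add_sub_cancel, add_zero] at this
  have t0 := key hb.val lb (by rw [sub_zero]; exact pdX' 0) (hld 0) (zero_add n)
  have t1 := key hV lV (by rw [sub_neg_eq_add]; exact prX') hlr (by ring)
  have t2 := key (hw 0) (lw 0) (by rw [sub_zero]; exact pdX' 1) (hld 1) (zero_add n)
  have t3 := key (hw 1) (lw 1) (by rw [sub_zero]; exact pdX' 2) (hld 2) (zero_add n)
  have t4 := key hH hH0 (by rw [sub_zero]; exact pX') hl (zero_add n)
  have hdiff : ray p (S.dv X) - ray p (S'.dv X') =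
      (ray p H * ray p X - ray p H' * ray p X') + (ray p Y - ray p Y') := by
    rw [hv, hv', ray_add, ray_add, ray_mul, ray_mul]; ring
  have l1 : HasLead n (C (S.b0 p) * qd 0 + C (S.am1 p) * qr + C (S.w 0 p) * qd 1
      + C (S.w 1 p) * qd 2) (ray p (S.dv X) - ray p (S'.dv X')) := by
    have := ((t0.add t1).add t2).add t3
    convert this using 1
    rw [dv_eq, dv_eq]
    simp only [ray_add, ray_mul]
    simp only [emb, Matrix.cons_val]
    ring
  have l2 := t4.add (HasLead.of_pb hY)
  rw [← hdiff] at l2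
  have hu := congrArg (fun q => coeff q j) (l1.unique l2)
  simp only [coeff_add, coeff_C_mul, hqd, hqr, hq, coeff_zero, add_sub_cancel_right] at hu
  -- The radial derivative feeds `j + 1` times the coefficient of `lnʲ⁺¹` into that of `lnʲ`. This
  -- contribution is the same in both spacetimes.
  rw [(heqj (j + 1) (by omega)).eq_of_nhds] at hu
  push_cast at hu
  linear_combination hu

end

end KillingSpacetime

end

/-! ### The constraint operators take values fixed by the previous data -/

section

open Filter Asymptotics Polynomial

lemma Pair.mul_sub {k l m s K : ℤ} {F F' G G' : ℝ → ℂ} (h : Pair k s F F') (hG : PB l G')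
    (hd : PB m (G - G')) (h1 : K ≤ k + m) (h2 : K ≤ k + s + l) : PB K (F * G - F' * G') := by
  have h5 := (h.left.mul hd).mono h1
  have h6 := (h.diff.mul hG).mono h2
  have := h5.add h6
  rwa [_root_.mul_sub, sub_mul, sub_add_sub_cancel] at this

lemma eq_of_keep {P : ℤ → ℕ → Prop} {e e' : Coeffs} (h : keep P e = keep P e') {k : ℤ} {j : ℕ}
    (hP : P k j) : e k j = e' k j := by
  have := congrFun (congrFun h k) j
  funext p
  simpa [keep, hP] using congrFun this p

namespace KillingSpacetime

open Sm

variable {S S' : KillingSpacetime} {p : Scri}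

lemma op_eq (s : ℤ) (H : Scri → ℂ) {X : Scri → ℂ} (hp : p ∈ S.O) (hX : DifferentiableAt ℝ X p) :
    S.op s H X p = S.b0 p * pd 0 X p + S.w 0 p * pd 1 X p + S.w 1 p * pd 2 X p
      + S.totalDamping s H p * X p := by
  have hs := (sin_pos_of_mem hp).ne'
  have h5 : ((Real.sqrt 2 : ℝ) : ℂ) ≠ 0 := by simp
  have h6 : ((Real.sin (p 1) : ℝ) : ℂ) ≠ 0 := by exact_mod_cast hs
  rw [op, constraintOp, eth_eq s hX hs, ethbar_eq s hX hs, totalDamping, w, w]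
  simp only [xi1, Matrix.cons_val_zero, Matrix.cons_val_one, map_div₀, map_one, map_neg,
    Complex.conj_ofReal, Complex.conj_I, Complex.ofReal_mul, map_mul]
  push_cast at h6 ⊢
  field_simp
  ring

lemma op_of_eventually_zero (s : ℤ) (H : Scri → ℂ) {X : Scri → ℂ} (hp : p ∈ S.O)
    (hX : X =ᶠ[𝓝 p] fun _ => 0) : S.op s H X p = 0 := by
  rw [op_eq s H hp ((differentiableAt_const 0).congr_of_eventuallyEq hX), pd_congr hX, pd_congr hX,
    pd_congr hX, hX.eq_of_nhds]
  simp [pd_const]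

/-- The Killing components `a`, `c` start at order `-1` and the tetrad functions `ξⁱ` at order `1`.
Knowing them through `κ.order` and `κ.order + 2` respectively is in both cases relative accuracy
`κ.order + 2`. -/
lemma agree_of_prev {κ : Constraint} (h : S.prev κ = S'.prev κ) (hκ : -1 ≤ κ.order) :
    Agree S S' (κ.order + 2) where
  pos := by omega
  b0 := congrArg PrevData.b0 h
  aE l hl j := eq_of_keep (congrArg PrevData.aE h) (by omega)
  cE l hl j := eq_of_keep (congrArg PrevData.cE h) (by omega)
  UE l hl j := eq_of_keep (congrArg PrevData.UE h) (by omega)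
  CE i l hl j := eq_of_keep (congrFun (congrArg PrevData.CE h) i) (by omega)
  xiE i l hl j := eq_of_keep (congrFun (congrArg PrevData.xiE h) i) (by omega)

lemma psi_of_prev {κ : Constraint} (h : S.prev κ = S'.prev κ) {i : Fin 4} {k : ℤ} {j : ℕ}
    (hκ : κ.weylKnown i k j) : S.PsiE i k j = S'.PsiE i k j :=
  eq_of_keep (congrFun (congrArg PrevData.PsiE h) i) hκ

lemma psi_pb (hp : p ∈ S.O) (i : Fin 4) :
    PB ((![4, 4, 3, 2] : Fin 4 → ℤ) i) (ray p (S.sPsi i)) :=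
  (exp_sPsi hp i).val.pb le_rfl fun l hl j => (S.Psi_exp i).2.2.1 l j hl p hp

lemma psi_sub_pb (hp : p ∈ S.O) (hp' : p ∈ S'.O) (i : Fin 4) {K : ℤ}
    (hK : (![4, 4, 3, 2] : Fin 4 → ℤ) i ≤ K) (h : ∀ l < K, ∀ j, S.PsiE i l j = S'.PsiE i l j) :
    PB K (ray p (S.sPsi i) - ray p (S'.sPsi i)) :=
  ((exp_sPsi hp i).val.sub (exp_sPsi hp' i).val).pb hK fun l hl j => by rw [h l hl, sub_self]

lemma psi_eventually_zero (hp : p ∈ S.O) (i : Fin 4) {l : ℤ}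
    (hl : l < (![4, 4, 3, 2] : Fin 4 → ℤ) i) (j : ℕ) : S.PsiE i l j =ᶠ[𝓝 p] fun _ => 0 :=
  (eventually_mem hp).mono fun q hq => (S.Psi_exp i).2.2.1 l j hl q hq

lemma Agree.am1 {s : ℤ} (h : Agree S S' s) : S.am1 = S'.am1 := h.aE (-1) (by linarith [h.pos]) 0
lemma Agree.cm1 {s : ℤ} (h : Agree S S' s) : S.cm1 = S'.cm1 := h.cE (-1) (by linarith [h.pos]) 0

lemma Agree.damping {s : ℤ} (h : Agree S S' s) (κ : Constraint) : S.damping κ = S'.damping κ := by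
  cases κ <;> simp only [KillingSpacetime.damping, ethc, ethbarcbar, h.am1, h.cm1]

lemma Agree.totalDamping {s : ℤ} (h : Agree S S' s) (t : ℤ) (H : Scri → ℂ) :
    S.totalDamping t H = S'.totalDamping t H := by
  funext p; simp only [KillingSpacetime.totalDamping, h.cm1]

lemma Agree.w {s : ℤ} (h : Agree S S' s) (i : Fin 2) : S.w i = S'.w i := by
  funext p; simp only [KillingSpacetime.w, h.cm1]

lemma Agree.op_congr {s : ℤ} (h : Agree S S' s) (hp : p ∈ S.O) (hp' : p ∈ S'.O) {κ : Constraint}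
    {X X' : Scri → ℂ} (hX : DifferentiableAt ℝ X p) (hX' : DifferentiableAt ℝ X' p) {a : ℂ}
    (ha : S.totalDamping κ.spin (S.damping κ) p = a)
    (he : S.b0 p * pd 0 X p + S.w 0 p * pd 1 X p + S.w 1 p * pd 2 X p + a * X p =
      S.b0 p * pd 0 X' p + S.w 0 p * pd 1 X' p + S.w 1 p * pd 2 X' p + a * X' p) :
    S.op κ.spin (S.damping κ) X p = S'.op κ.spin (S'.damping κ) X' p := by
  rw [op_eq _ _ hp hX, op_eq _ _ hp' hX', ← h.damping, ← h.totalDamping, ← h.b0, ← h.w, ← h.w, ha]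
  exact he

lemma A_lead_am1 {α β γ αb βb A' μ ν : Sm S.Ω} (hB : S.Brackets α β γ αb βb A' μ ν)
    (hp : p ∈ S.O) : HasLead 0 (C (-S.am1 p)) (ray p A') :=
  (A_lead hB hp).congr_poly (by rw [(a_leading hB hp).1])

lemma differentiableAt_PsiE (hp : p ∈ S.O) (i : Fin 4) (k : ℤ) (j : ℕ) :
    DifferentiableAt ℝ (S.PsiE i k j) p :=
  (contDiffAt_coeff (S.Psi_exp i) hp k j).differentiableAt (by simp)

/-- The limit `2(-a_{-1} + γ)` of the homogeneous factor combines with `-n a_{-1}` from the radial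
derivative to give the damping. Since `β` is of order one, only `Ψ₁` below order `n` enters; an
error in `β` itself, of relative order `n - 3`, is multiplied by a `Ψ₁` of order four and is
negligible. -/
lemma op_psi0 {n j : ℕ} (h : S.prev (.psi0 n j) = S'.prev (.psi0 n j)) (hp : p ∈ S.O)
    (hp' : p ∈ S'.O) :
    S.op 2 (S.damping (.psi0 n j)) (S.PsiE 0 n j) p =
      S'.op 2 (S'.damping (.psi0 n j)) (S'.PsiE 0 n j) p := by
  -- Below order four the coefficient vanishes identically, and the previous data need not even
  -- contain the leading terms.
  rcases lt_or_ge n 4 with hn | hn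
  · rw [op_of_eventually_zero _ _ hp (psi_eventually_zero hp 0 (by simpa using hn) j),
      op_of_eventually_zero _ _ hp' (psi_eventually_zero hp' 0 (by simpa using hn) j)]
  have hn' : (4 : ℤ) ≤ n := by exact_mod_cast hn
  have hA := agree_of_prev h (show (-1 : ℤ) ≤ n - 5 by omega)
  obtain ⟨α, β, γ, αb, βb, A', μ, ν, hB⟩ := S.exists_brackets
  obtain ⟨α', β', γ', αb', βb', A'', μ', ν', hB'⟩ := S'.exists_brackets
  obtain ⟨g, hg, hge, -⟩ := γ_lead_eq hB hp
  refine hA.op_congr (κ := .psi0 n j) hp hp' (differentiableAt_PsiE hp _ _ _)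
    (differentiableAt_PsiE hp' _ _ _) ?_
    (transport_of_eq hA hp hp' hB hB' (k₀ := 4) hn' ?_ (exp_sPsi hp 0) (exp_sPsi hp' 0)
    (fun l hl j => psi_eventually_zero hp' 0 hl j) ?_ ?_ hB.psi0_eq hB'.psi0_eq ?_
    (h0 := 2 * (-S.am1 p + g)) ?_ ?_)
  · simp only [KillingSpacetime.totalDamping, KillingSpacetime.damping, Constraint.spin, hge]
    push_cast; ring
  · simp only [Constraint.order]; omega
  · exact fun l hl i => (psi_of_prev h (i := 0) (Or.inl hl)) ▸ EventuallyEq.rfl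
  · exact fun i hi => (psi_of_prev h (i := 0) (Or.inr ⟨rfl, hi⟩)) ▸ EventuallyEq.rfl
  · rw [ray_smul, ray_smul, ray_add, ray_add]
    exact ((pair_A hA hp hp' hB hB').add (pair_γ hA hp hp' hB hB')).smul 2
  · rw [ray_smul, ray_add]
    exact (((A_lead_am1 hB hp).add hg).smul 2).congr_poly (by simp)
  · rw [ray_smul, ray_smul, ← smul_sub, ray_mul, ray_mul]
    refine PB.smul 4 ((pair_β hA hp hp' hB hB').val.mul_sub (psi_pb hp' 1)
      (psi_sub_pb hp hp' 1 hn' fun l hl i => psi_of_prev h (i := 1) hl) (by omega) ?_)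
    simp [Constraint.order]; omega

/-- The two source products have different ranges: `β` is of order one, so `Ψ₂` is needed through
order three, while `αb` is of order zero, so `Ψ₀` is needed through order four. -/
lemma op_psi1 {j : ℕ} (h : S.prev (.psi1 j) = S'.prev (.psi1 j)) (hp : p ∈ S.O)
    (hp' : p ∈ S'.O) :
    S.op 1 (S.damping (.psi1 j)) (S.PsiE 1 4 j) p =
      S'.op 1 (S'.damping (.psi1 j)) (S'.PsiE 1 4 j) p := by
  have hA : Agree S S' 1 := agree_of_prev h (le_refl (-1 : ℤ))
  obtain ⟨α, β, γ, αb, βb, A', μ, ν, hB⟩ := S.exists_brackets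
  obtain ⟨α', β', γ', αb', βb', A'', μ', ν', hB'⟩ := S'.exists_brackets
  obtain ⟨g, hg, hge, -⟩ := γ_lead_eq hB hp
  refine hA.op_congr (κ := .psi1 j) hp hp' (differentiableAt_PsiE hp _ _ _)
    (differentiableAt_PsiE hp' _ _ _) ?_
    (transport_of_eq hA hp hp' hB hB' (k₀ := 4) le_rfl (by norm_num) (exp_sPsi hp 1)
    (exp_sPsi hp' 1)
    (fun l hl j => psi_eventually_zero hp' 1 hl j) ?_ ?_ hB.psi1_eq hB'.psi1_eq ?_
    (h0 := -S.am1 p + g) ?_ ?_)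
  · simp only [KillingSpacetime.totalDamping, KillingSpacetime.damping, Constraint.spin, hge]
    push_cast; ring
  · exact fun l hl i => (psi_of_prev h (i := 1) (Or.inl hl)) ▸ EventuallyEq.rfl
  · exact fun i hi => (psi_of_prev h (i := 1) (Or.inr ⟨rfl, hi⟩)) ▸ EventuallyEq.rfl
  · rw [ray_add, ray_add]
    exact (pair_A hA hp hp' hB hB').add (pair_γ hA hp hp' hB hB')
  · rw [ray_add]
    exact ((A_lead_am1 hB hp).add hg).congr_poly (by simp)
  · rw [ray_add, ray_add, add_sub_add_comm, ray_smul, ray_smul, ← smul_sub]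
    simp only [ray_mul]
    refine (PB.smul 3 ((pair_β hA hp hp' hB hB').val.mul_sub (psi_pb hp' 2)
      (psi_sub_pb hp hp' 2 (K := 4) (by simp) fun l hl i => psi_of_prev h (i := 2) ?_)
      (by norm_num) (by simp))).add ((pair_αb hA hp hp' hB hB').mul_sub (psi_pb hp' 0)
      (psi_sub_pb hp hp' 0 (K := 5) (by simp) fun l hl i => psi_of_prev h (i := 0) ?_)
      (by norm_num) (by simp))
    · exact (show l ≤ 3 by omega)
    · exact (show l ≤ 4 by omega)

/-- The term `αb Ψ₁` starts at order four, beyond the order of the equation, so nothing about `Ψ₁`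
needs to agree. There is no homogeneous term, and the damping `-3a_{-1}` comes from the radial
derivative alone. -/
lemma op_psi2 {j : ℕ} (h : S.prev (.psi2 j) = S'.prev (.psi2 j)) (hp : p ∈ S.O)
    (hp' : p ∈ S'.O) :
    S.op 0 (S.damping (.psi2 j)) (S.PsiE 2 3 j) p =
      S'.op 0 (S'.damping (.psi2 j)) (S'.PsiE 2 3 j) p := by
  have hA : Agree S S' 1 := agree_of_prev h (le_refl (-1 : ℤ))
  obtain ⟨α, β, γ, αb, βb, A', μ, ν, hB⟩ := S.exists_brackets
  obtain ⟨α', β', γ', αb', βb', A'', μ', ν', hB'⟩ := S'.exists_brackets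
  refine hA.op_congr (κ := .psi2 j) hp hp' (differentiableAt_PsiE hp _ _ _)
    (differentiableAt_PsiE hp' _ _ _) ?_
    (transport_of_eq hA hp hp' hB hB' (k₀ := 3) le_rfl (by norm_num) (exp_sPsi hp 2)
    (exp_sPsi hp' 2)
    (fun l hl j => psi_eventually_zero hp' 2 hl j) ?_ ?_ hB.psi2_eq hB'.psi2_eq ?_
    (h0 := 0) ?_ ?_)
  · simp only [KillingSpacetime.totalDamping, KillingSpacetime.damping, Constraint.spin]
    push_cast; ring
  · exact fun l hl i => (psi_of_prev h (i := 2) (Or.inl hl)) ▸ EventuallyEq.rfl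
  · exact fun i hi => (psi_of_prev h (i := 2) (Or.inr ⟨rfl, hi⟩)) ▸ EventuallyEq.rfl
  · rw [ray_zero, ray_zero]
    exact .of_eq .zero EventuallyEq.rfl
  · rw [ray_zero]
    exact (HasLead.of_pb PB.zero).congr_poly C_0.symm
  · rw [ray_add, ray_add, add_sub_add_comm, ray_smul, ray_smul, ray_smul, ray_smul, ← smul_sub,
      ← smul_sub]
    simp only [ray_mul]
    refine (PB.smul 2 ((pair_β hA hp hp' hB hB').val.mul_sub (psi_pb hp' 3)
      (psi_sub_pb hp hp' 3 (K := 3) (by simp) fun l hl i => psi_of_prev h (i := 3) ?_)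
      (by norm_num) (by simp))).add (PB.smul 2 ((pair_αb hA hp hp' hB hB').mul_sub (psi_pb hp' 1)
      ((psi_pb hp 1).sub (psi_pb hp' 1))
      (by norm_num) (by simp)))
    exact (show l ≤ 2 by omega)

/-- At order two the source `-m(β) + βμ + βν` involves only `b` and the leading tetrad. The
conformal Killing relation brings the coefficient `a_{-1} - 2ð₁c_{-1}`, which results from the
expansion, to the stated form of `H`. -/
lemma op_shear (h : S.prev .shear = S'.prev .shear) (hp : p ∈ S.O) (hp' : p ∈ S'.O) :
    S.op 2 (S.damping .shear) (S.sigmaE 2 0) p = S'.op 2 (S'.damping .shear) (S'.sigmaE 2 0) p := by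
  have hA : Agree S S' 1 := agree_of_prev h (le_refl (-1 : ℤ))
  obtain ⟨α, β, γ, αb, βb, A', μ, ν, hB⟩ := S.exists_brackets
  obtain ⟨α', β', γ', αb', βb', A'', μ', ν', hB'⟩ := S'.exists_brackets
  obtain ⟨g, hg, hge, h2⟩ := γ_lead_eq hB hp
  have hz : ∀ (S : KillingSpacetime), p ∈ S.O → ∀ l < 2, ∀ j, S.sigmaE l j =ᶠ[𝓝 p] fun _ => 0 :=
    fun S hp l hl j => (eventually_mem hp).mono fun q hq => S.sigma_exp.2.2.1 l j hl q hq
  have hz' : ∀ (S : KillingSpacetime), p ∈ S.O → ∀ j, S.sigmaE 2 (j + 1) =ᶠ[𝓝 p] fun _ => 0 :=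
    fun S hp j => (eventually_mem hp).mono fun q hq => S.sigma_log j q hq
  refine hA.op_congr (κ := .shear) hp hp'
    ((contDiffAt_coeff S.sigma_exp hp _ _).differentiableAt (by simp))
    ((contDiffAt_coeff S'.sigma_exp hp' _ _).differentiableAt (by simp)) ?_
    (transport_of_eq hA hp hp' hB hB' (k₀ := 2) le_rfl (by norm_num) (exp_sSigma hp)
    (exp_sSigma hp') (hz S' hp') ?_ ?_ hB.shear_eq hB'.shear_eq ?_
    (h0 := -S.am1 p + 2 * g) ?_ ?_)
  · simp only [KillingSpacetime.totalDamping, KillingSpacetime.damping, Constraint.spin, hge]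
    push_cast; linear_combination -h2
  · exact fun l hl i => (hz S hp l hl i).trans (hz S' hp' l hl i).symm
  · intro i hi
    obtain ⟨i, rfl⟩ := Nat.exists_eq_succ_of_ne_zero hi.ne'
    exact (hz' S hp i).trans (hz' S' hp' i).symm
  · rw [ray_add, ray_add, ray_smul, ray_smul]
    exact (pair_A hA hp hp' hB hB').add ((pair_γ hA hp hp' hB hB').smul 2)
  · rw [ray_add, ray_smul]
    exact ((A_lead_am1 hB hp).add (hg.smul 2)).congr_poly (by simp)
  · simp only [ray_add, ray_mul, ray_neg]
    have hβ := pair_β hA hp hp' hB hB'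
    have h1 := (pair_dm hA hp hp' hβ).neg
    have h2 := hβ.val.mul (pair_μ hA hp hp' hB hB')
    have h3 := hβ.val.mul (pair_ν hA hp hp' hB hB')
    exact ((h1.add h2).add h3).diff.congr_order (by norm_num)

end KillingSpacetime

end

/-! ### Stationary coefficients, the news and mass equations, and the choice of the source -/

section

open Filter

/-- Smooth functions that do not depend on the retarded time, to first order. -/
structure Stationary (O : Set Scri) (f : Scri → ℂ) : Prop where
  smooth : ContDiffOn ℝ ∞ f O
  pd_zero : ∀ p ∈ O, pd 0 f p = 0

namespace Stationary

variable {O : Set Scri} {f g : Scri → ℂ} {p : Scri}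

lemma const (z : ℂ) : Stationary O (fun _ => z) := ⟨contDiffOn_const, fun _ _ => pd_const _ _⟩

lemma differentiableAt (hO : IsOpen O) (hf : Stationary O f) (hp : p ∈ O) :
    DifferentiableAt ℝ f p :=
  (hf.smooth.contDiffAt (hO.mem_nhds hp)).differentiableAt (by simp)

lemma congr (hO : IsOpen O) (hf : Stationary O f) (h : ∀ p ∈ O, g p = f p) : Stationary O g where
  smooth := hf.smooth.congr h
  pd_zero p hp := by
    rw [pd_congr (g := f) ((hO.eventually_mem hp).mono fun q hq => h q hq)]
    exact hf.pd_zero p hp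

lemma add (hO : IsOpen O) (hf : Stationary O f) (hg : Stationary O g) :
    Stationary O (fun p => f p + g p) where
  smooth := hf.smooth.add hg.smooth
  pd_zero p hp := by
    rw [pd_add 0 (hf.differentiableAt hO hp) (hg.differentiableAt hO hp), hf.pd_zero p hp,
      hg.pd_zero p hp, add_zero]

lemma mul (hO : IsOpen O) (hf : Stationary O f) (hg : Stationary O g) :
    Stationary O (fun p => f p * g p) where
  smooth := hf.smooth.mul hg.smooth
  pd_zero p hp := by
    rw [pd_mul 0 (hf.differentiableAt hO hp) (hg.differentiableAt hO hp), hf.pd_zero p hp,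
      hg.pd_zero p hp]
    simp

lemma const_mul (hO : IsOpen O) (z : ℂ) (hf : Stationary O f) : Stationary O (fun p => z * f p) :=
  (const z).mul hO hf

lemma sub (hO : IsOpen O) (hf : Stationary O f) (hg : Stationary O g) :
    Stationary O (fun p => f p - g p) :=
  (hf.add hO (hg.const_mul hO (-1))).congr hO fun p _ => by ring

lemma conj (hf : Stationary O f) : Stationary O (fun p => starRingEnd ℂ (f p)) where
  smooth := Complex.conjCLE.contDiff.comp_contDiffOn hf.smooth
  pd_zero p hp := by rw [pd_conj, hf.pd_zero p hp, map_zero]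

lemma pd (hO : IsOpen O) (hf : Stationary O f) (i : Fin 3) : Stationary O (pd i f) where
  smooth := contDiffOn_pd hO hf.smooth i
  pd_zero p hp := by
    rw [pd_comm (hf.smooth.contDiffAt (hO.mem_nhds hp)), pd_congr (g := fun _ => 0), pd_const]
    exact (hO.eventually_mem hp).mono fun q hq => hf.pd_zero q hq

lemma of_angle {h : ℝ → ℂ} (hh : ∀ p ∈ O, ContDiffAt ℝ ∞ h (p 1)) :
    Stationary O (fun p => h (p 1)) where
  smooth p hp := ((hh p hp).comp p (contDiff_apply ℝ ℝ (1 : Fin 3)).contDiffAt).contDiffWithinAt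
  pd_zero p hp := by
    rw [pd_comp_coord ((hh p hp).differentiableAt (by simp)).hasDerivAt]; simp

end Stationary

namespace KillingSpacetime

variable (S : KillingSpacetime)

lemma stationary_am1 : Stationary S.O S.am1 :=
  ⟨S.a_exp.2.1 _ _, fun _ hp =>
    let ⟨_, _, _, _, _, _, _, _, hB⟩ := S.exists_brackets
    pd_zero_am1 hB hp⟩

lemma stationary_cm1 : Stationary S.O S.cm1 :=
  ⟨S.c_exp.2.1 _ _, fun _ hp =>
    let ⟨_, _, _, _, _, _, _, _, hB⟩ := S.exists_brackets
    pd_zero_cm1 hB hp⟩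

lemma pd_zero_b0 {p : Scri} (hp : p ∈ S.O) : pd 0 S.b0 p = -S.am1 p :=
  let ⟨_, _, _, _, _, _, _, _, hB⟩ := S.exists_brackets
  (a_leading hB hp).1

lemma two_mul_am1 {p : Scri} (hp : p ∈ S.O) : 2 * S.am1 p = S.ethc p + S.ethbarcbar p :=
  let ⟨_, _, _, _, _, _, _, _, hB⟩ := S.exists_brackets
  let ⟨_, _, _, h⟩ := γ_lead_eq hB hp
  h

lemma stationary_angle {h : ℝ → ℝ} (hh : ∀ θ, Real.sin θ ≠ 0 → ContDiffAt ℝ ∞ h θ) :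
    Stationary S.O (fun p => (h (p 1) : ℂ)) :=
  .of_angle (h := fun θ => (h θ : ℂ)) fun p hp =>
    Complex.ofRealCLM.contDiff.contDiffAt.comp (p 1) (hh (p 1) (sin_pos_of_mem hp).ne')

lemma stationary_cot : Stationary S.O (fun p => ((Real.cos (p 1) / Real.sin (p 1) : ℝ) : ℂ)) :=
  S.stationary_angle fun _ h => Real.contDiff_cos.contDiffAt.div Real.contDiff_sin.contDiffAt h

lemma stationary_inv_sin : Stationary S.O (fun p => (((Real.sin (p 1))⁻¹ : ℝ) : ℂ)) :=
  S.stationary_angle fun _ h => Real.contDiff_sin.contDiffAt.inv h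

lemma stationary_ethc : Stationary S.O S.ethc := by
  have hO := S.isOpen_O
  have hc := S.stationary_cm1
  refine Stationary.congr hO ((((hc.pd hO 1).add hO (S.stationary_cot.mul hO hc)).sub hO
    (((S.stationary_inv_sin).mul hO (hc.pd hO 2)).const_mul hO Complex.I)).const_mul hO
    (1 / (Real.sqrt 2 : ℂ))) fun p hp => ?_
  rw [ethc, eth_eq _ (hc.differentiableAt hO hp) (sin_pos_of_mem hp).ne']
  push_cast; ring

lemma stationary_ethbarcbar : Stationary S.O S.ethbarcbar := by
  have hO := S.isOpen_O
  refine ((S.stationary_am1.const_mul hO 2).sub hO S.stationary_ethc).congr hO fun p hp => ?_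
  rw [S.two_mul_am1 hp]; ring

lemma stationary_w (i : Fin 2) : Stationary S.O (S.w i) := by
  have hO := S.isOpen_O
  have hx : Stationary S.O (xi1 i) :=
    ⟨fun p hp => (contDiffAt_xi1 hp i).contDiffWithinAt, fun p hp => by
      fin_cases i
      · exact pd_xi1_zero 0
      · exact pd_xi1_one (sin_pos_of_mem hp).ne' 0⟩
  have hc := S.stationary_cm1
  exact (((hc.mul hO hx).const_mul hO (-1)).sub hO (hc.conj.mul hO hx.conj)).congr hO fun p _ => by
    rw [w]; ring

lemma contDiffOn_damping (κ : Constraint) : ContDiffOn ℝ ∞ (S.damping κ) S.O := by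
  have hO := S.isOpen_O
  have ha := S.stationary_am1.smooth
  have hc := S.stationary_ethc.smooth
  have hcb := S.stationary_ethbarcbar.smooth
  cases κ
  · exact ((ha.add hc).sub hcb).neg
  · exact contDiffOn_const.mul hc
  · exact ((contDiffOn_const.mul ha).add (contDiffOn_const.mul hc)).neg
  · exact ((contDiffOn_const.mul ha).add hc).neg
  · exact contDiffOn_const.mul ha
  · exact contDiffOn_const.mul ha

lemma contDiffOn_quantity (κ : Constraint) : ContDiffOn ℝ ∞ (S.quantity κ) S.O := by
  cases κ
  · exact S.sigma_exp.2.1 _ _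
  · exact contDiffOn_pd S.isOpen_O (S.sigma_exp.2.1 _ _) 0
  · exact (S.Psi_exp _).2.1 _ _
  · exact (S.Psi_exp _).2.1 _ _
  · exact (S.Psi_exp _).2.1 _ _
  · exact Complex.ofRealCLM.contDiff.comp_contDiffOn
      (Complex.reCLM.contDiff.comp_contDiffOn ((S.Psi_exp 2).2.1 3 0))

lemma contDiffOn_b0 : ContDiffOn ℝ ∞ S.b0 S.O := S.b_exp.2.1 0 0

/-- The coefficient `cot θ / √2 (c̄ - c)`. -/
lemma stationary_cot_term : Stationary S.O (fun p =>
    ((Real.cos (p 1) / (Real.sqrt 2 * Real.sin (p 1)) : ℝ) : ℂ) *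
      (starRingEnd ℂ (S.cm1 p) - S.cm1 p)) := by
  have hO := S.isOpen_O
  have hc := S.stationary_cm1
  refine Stationary.mul hO (S.stationary_angle
    (h := fun θ => Real.cos θ / (Real.sqrt 2 * Real.sin θ)) fun θ h => ?_) (hc.conj.sub hO hc)
  exact Real.contDiff_cos.contDiffAt.div (contDiff_const.mul Real.contDiff_sin).contDiffAt
    (mul_ne_zero (by simp) h)

/-- The regularity is left free: the constraint equations use smooth `H`, the splitting theorem only
`C¹`. -/
lemma contDiffOn_totalDamping {k : ℕ∞} (s : ℤ) {H : Scri → ℂ} (hH : ContDiffOn ℝ k H S.O) :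
    ContDiffOn ℝ k (S.totalDamping s H) S.O := by
  have h := S.stationary_cot_term.smooth.of_le (show (k : WithTop ℕ∞) ≤ ∞ from
    WithTop.coe_le_coe.mpr le_top)
  exact (hH.sub (contDiffOn_const.mul h)).congr fun p _ => by
    rw [totalDamping, mul_assoc]

lemma contDiffOn_op (s : ℤ) {H X : Scri → ℂ} (hH : ContDiffOn ℝ ∞ H S.O)
    (hX : ContDiffOn ℝ ∞ X S.O) : ContDiffOn ℝ ∞ (S.op s H X) S.O := by
  have hd := fun i => contDiffOn_pd S.isOpen_O hX i
  have hw := fun i => (S.stationary_w i).smooth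
  refine ((((S.contDiffOn_b0.mul (hd 0)).add ((hw 0).mul (hd 1))).add ((hw 1).mul (hd 2))).add
    ((S.contDiffOn_totalDamping (k := ⊤) s hH).mul hX)).congr fun p hp => ?_
  exact op_eq s H hp ((hX.contDiffAt (S.isOpen_O.mem_nhds hp)).differentiableAt (by simp))

variable {S} {p : Scri}

/-- In the shear operator only `b` depends on `u`. Differentiating it adds `-a_{-1} ∂_uσ`, and
`-(a_{-1} + ð₁c_{-1} - ð̄₁c̄_{-1}) - a_{-1} = -2ð₁c_{-1}` by the conformal Killing relation. -/
lemma op_news (hp : p ∈ S.O) : S.op 2 (S.damping .news) (pd 0 (S.sigmaE 2 0)) p =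
    pd 0 (S.op 2 (S.damping .shear) (S.sigmaE 2 0)) p := by
  have hO := S.isOpen_O
  have hσ : ContDiffOn ℝ ∞ (S.sigmaE 2 0) S.O := S.sigma_exp.2.1 _ _
  have hdσ := contDiffOn_pd hO hσ
  have hd : ∀ {f : Scri → ℂ}, ContDiffOn ℝ ∞ f S.O → DifferentiableAt ℝ f p := fun h =>
    (h.contDiffAt (hO.mem_nhds hp)).differentiableAt (by simp)
  have hF : Stationary S.O (S.totalDamping 2 (S.damping .shear)) := by
    have h1 := ((S.stationary_am1.add hO S.stationary_ethc).sub hO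
      S.stationary_ethbarcbar).const_mul hO (-1)
    refine (h1.sub hO (S.stationary_cot_term.const_mul hO 2)).congr hO fun q _ => ?_
    simp only [totalDamping, damping]; push_cast; ring
  have hcong : S.op 2 (S.damping .shear) (S.sigmaE 2 0) =ᶠ[𝓝 p] fun q =>
      S.b0 q * pd 0 (S.sigmaE 2 0) q + S.w 0 q * pd 1 (S.sigmaE 2 0) q
        + S.w 1 q * pd 2 (S.sigmaE 2 0) q
        + S.totalDamping 2 (S.damping .shear) q * S.sigmaE 2 0 q :=
    (eventually_mem hp).mono fun q hq => op_eq 2 _ hq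
      ((hσ.contDiffAt (hO.mem_nhds hq)).differentiableAt (by simp))
  have hw := fun i => S.stationary_w i
  have e0 := (S.contDiffOn_b0.mul (hdσ 0))
  have e1 := ((hw 0).smooth.mul (hdσ 1))
  have e2 := ((hw 1).smooth.mul (hdσ 2))
  have e3 := (hF.smooth.mul hσ)
  have hc := pd_comm (hσ.contDiffAt (hO.mem_nhds hp))
  rw [pd_congr hcong, pd_add 0 (hd ((e0.add e1).add e2)) (hd e3), pd_add 0 (hd (e0.add e1)) (hd e2),
    pd_add 0 (hd e0) (hd e1), pd_mul 0 (hd S.contDiffOn_b0) (hd (hdσ 0)),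
    pd_mul 0 (hd (hw 0).smooth) (hd (hdσ 1)), pd_mul 0 (hd (hw 1).smooth) (hd (hdσ 2)),
    pd_mul 0 (hd hF.smooth) (hd hσ), S.pd_zero_b0 hp, (hw 0).pd_zero p hp, (hw 1).pd_zero p hp,
    hF.pd_zero p hp, op_eq 2 _ hp (hd (hdσ 0)), hc 0 1, hc 0 2]
  simp only [totalDamping, damping]
  linear_combination pd 0 (S.sigmaE 2 0) p * S.two_mul_am1 hp

lemma w_real (i : Fin 2) (p : Scri) : starRingEnd ℂ (S.w i p) = S.w i p := by
  simp only [w, map_sub, map_neg, map_mul, Complex.conj_conj]; ring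

lemma b0_real (hp : p ∈ S.O) : starRingEnd ℂ (S.b0 p) = S.b0 p := by
  obtain ⟨_, _, _, _, _, _, _, _, hB⟩ := S.exists_brackets
  have h := b_eq hB (lift_mem hp (lt_add_one S.r₀))
  rw [toScri_lift] at h
  rw [← h, Complex.conj_ofReal]

lemma am1_real (hp : p ∈ S.O) : starRingEnd ℂ (S.am1 p) = S.am1 p := by
  have h : (fun q => starRingEnd ℂ (S.b0 q)) =ᶠ[𝓝 p] S.b0 :=
    (eventually_mem hp).mono fun q hq => b0_real hq
  have := pd_congr (i := 0) h
  rw [pd_conj, S.pd_zero_b0 hp, map_neg] at this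
  exact neg_injective this

/-- At spin weight zero the vector field and the damping are real, so the operator commutes with
taking real parts. -/
lemma op_mass (hp : p ∈ S.O) : S.op 0 (S.damping .mass) (S.quantity .mass) p =
    ((S.op 0 (S.damping (.psi2 0)) (S.quantity (.psi2 0)) p).re : ℂ) := by
  have hΨ := differentiableAt_PsiE hp 2 3 0
  have hq : ContDiffAt ℝ ∞ (S.quantity .mass) p :=
    (S.contDiffOn_quantity .mass).contDiffAt (S.isOpen_O.mem_nhds hp)
  have h : ∀ i, pd i (S.quantity .mass) p = ((pd i (S.PsiE 2 3 0) p).re : ℂ) := fun i => by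
    rw [quantity, pd_ofReal, pd_re i hΨ]
  rw [op_eq 0 _ hp (hq.differentiableAt (by simp)), h, h, h]
  rw [show S.quantity (.psi2 0) = S.PsiE 2 3 0 from rfl, op_eq 0 _ hp hΨ]
  simp only [totalDamping, damping, quantity, Int.cast_zero, zero_mul, sub_zero]
  rw [← Complex.conj_eq_iff_re.mp (b0_real hp), ← Complex.conj_eq_iff_re.mp (am1_real hp),
    ← Complex.conj_eq_iff_re.mp (w_real (S := S) 0 p),
    ← Complex.conj_eq_iff_re.mp (w_real (S := S) 1 p)]
  simp

lemma op_quantity {S S' : KillingSpacetime} {κ : Constraint} (h : S.prev κ = S'.prev κ)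
    (hp : p ∈ S.O) (hp' : p ∈ S'.O) :
    S.op κ.spin (S.damping κ) (S.quantity κ) p =
      S'.op κ.spin (S'.damping κ) (S'.quantity κ) p := by
  cases κ with
  | shear => exact op_shear h hp hp'
  | news =>
    have h' : S.prev .shear = S'.prev .shear := h
    -- The previous data are functions on all of null infinity, so their equality yields the shear
    -- statement at every nearby point and it may be differentiated in `u`.
    exact (op_news hp).trans ((pd_congr (by
      filter_upwards [eventually_mem hp, eventually_mem hp'] with q hq hq'
      exact op_shear h' hq hq')).trans (op_news hp').symm)
  | psi0 n j => exact op_psi0 h hp hp'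
  | psi1 j => exact op_psi1 h hp hp'
  | psi2 j => exact op_psi2 h hp hp'
  | mass =>
    have h' : S.prev (.psi2 0) = S'.prev (.psi2 0) := h
    exact (op_mass hp).trans ((congrArg (fun z : ℂ => (z.re : ℂ)) (op_psi2 h' hp hp')).trans
      (op_mass hp').symm)

open Classical in
/-- The source of a constraint equation, as determined by the coefficients of previous orders. -/
def source (κ : Constraint) (d : PrevData) (p : Scri) : ℂ :=
  -- Any spacetime with these data over `p` will do; by `op_quantity` the value does not depend on
  -- the choice.
  if h : ∃ S : KillingSpacetime, S.prev κ = d ∧ p ∈ S.O then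
    h.choose.op κ.spin (h.choose.damping κ) (h.choose.quantity κ) p
  else 0

lemma source_eq (κ : Constraint) (hp : p ∈ S.O) :
    source κ (S.prev κ) p = S.op κ.spin (S.damping κ) (S.quantity κ) p := by
  have h : ∃ S' : KillingSpacetime, S'.prev κ = S.prev κ ∧ p ∈ S'.O := ⟨S, rfl, hp⟩
  rw [source, dif_pos h]
  exact op_quantity h.choose_spec.1 h.choose_spec.2 hp

lemma contDiffOn_source (κ : Constraint) : ContDiffOn ℝ ∞ (source κ (S.prev κ)) S.O :=
  (S.contDiffOn_op κ.spin (S.contDiffOn_damping κ) (S.contDiffOn_quantity κ)).congr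
    fun _ hp => source_eq κ hp

end KillingSpacetime

end

/-! ### The transport form of the operators and their characteristics -/

section

open Filter

lemma fderiv_apply_eq_sum {n : ℕ} (X : (Fin n → ℝ) → ℂ) (p v : Fin n → ℝ) :
    fderiv ℝ X p v = ∑ i, (v i : ℂ) * pd i X p := by
  have h := LinearMap.pi_apply_eq_sum_univ (fderiv ℝ X p : (Fin n → ℝ) →ₗ[ℝ] ℂ) v
  simp only [ContinuousLinearMap.coe_coe, Complex.real_smul] at h
  rw [h]
  refine Finset.sum_congr rfl fun i _ => ?_
  rw [pd]
  congr 2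
  ext j
  simp [Pi.single_apply, eq_comm]

/-- Testing on the constant `1` recovers the zeroth-order coefficient, and testing on the
coordinates then recovers the vector field. -/
lemma HasTransportForm.unique {O : Set Scri} {L : (Scri → ℂ) → Scri → ℂ} {v v' : Scri → Scri}
    {F F' : Scri → ℂ} (h : HasTransportForm O L v F) (h' : HasTransportForm O L v' F') {p : Scri}
    (hp : p ∈ O) : v p = v' p := by
  have h1 := (h (fun _ => 1) p hp (differentiableAt_const _)).symm.trans
    (h' (fun _ => 1) p hp (differentiableAt_const _))
  simp only [fderiv_fun_const, Pi.zero_apply, zero_apply, zero_add,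
    mul_one] at h1
  ext i
  have hd : HasFDerivAt (fun q : Scri => (q i : ℂ))
      (Complex.ofRealCLM.comp (ContinuousLinearMap.proj (R := ℝ) (φ := fun _ : Fin 3 => ℝ) i)) p :=
    Complex.ofRealCLM.hasFDerivAt.comp p (hasFDerivAt_apply i p)
  have h2 := (h _ p hp hd.differentiableAt).symm.trans (h' _ p hp hd.differentiableAt)
  rw [hd.fderiv, h1] at h2
  simpa using h2

lemma IsOrbit.congr {O : Set Scri} {v v' : Scri → Scri} {γ : ℝ → Scri} {J : Set ℝ}
    (h : IsOrbit O v γ J) (hv : ∀ p ∈ O, v p = v' p) : IsOrbit O v' γ J :=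
  ⟨h.1, fun t ht => ⟨(h.2 t ht).1, hv _ (h.2 t ht).1 ▸ (h.2 t ht).2⟩⟩

lemma HasTransportForm.isCharacteristic_iff {O : Set Scri} {L : (Scri → ℂ) → Scri → ℂ}
    {v : Scri → Scri} {F : Scri → ℂ} (h : HasTransportForm O L v F) (γ : ℝ → Scri) (J : Set ℝ) :
    IsCharacteristic O L γ J ↔ IsOrbit O v γ J :=
  ⟨fun ⟨_, _, h', ho⟩ => ho.congr fun _ hp => h'.unique h hp, fun ho => ⟨v, F, h, ho⟩⟩

namespace KillingSpacetime

variable (S : KillingSpacetime)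

/-- The restriction of the Killing field to null infinity. -/
def scriField (p : Scri) : Scri := ![(S.b0 p).re, (S.w 0 p).re, (S.w 1 p).re]

variable {S} {p : Scri}

lemma scriField_zero (hp : p ∈ S.O) : (S.scriField p 0 : ℂ) = S.b0 p :=
  Complex.conj_eq_iff_re.mp (b0_real hp)

lemma scriField_one : (S.scriField p 1 : ℂ) = S.w 0 p := Complex.conj_eq_iff_re.mp (w_real 0 p)

lemma scriField_two : (S.scriField p 2 : ℂ) = S.w 1 p := Complex.conj_eq_iff_re.mp (w_real 1 p)

variable (S) in
lemma isRestriction_scriField : S.IsRestriction S.scriField := by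
  intro p hp
  obtain ⟨_, _, _, _, _, _, _, _, hB⟩ := S.exists_brackets
  have key : ∀ (k : Fin 4) (z : ℂ), HasLead 0 (Polynomial.C z) (Sm.ray p (S.sv k)) →
      Tendsto (fun r => S.field (lift p r) k) atTop (𝓝 z.re) := by
    intro k z h
    refine ((Complex.continuous_re.tendsto z).comp h.tendsto).congr' ?_
    filter_upwards [Sm.ray_eventuallyEq (F := fun x => (S.field x k : ℂ))
      (fun y hy => S.ev_sv hy k) hp] with r hr
    simp [hr]
  rw [tendsto_pi_nhds]
  intro i
  fin_cases i
  · exact key 0 _ (jetLead_sb hB hp).val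
  · exact key 2 _ (jetLead_sw hB hp 0).val
  · exact key 3 _ (jetLead_sw hB hp 1).val

variable (S) in
lemma contDiffOn_scriField : ContDiffOn ℝ ∞ S.scriField S.O := by
  rw [contDiffOn_pi]
  intro i
  fin_cases i
  · exact Complex.reCLM.contDiff.comp_contDiffOn S.contDiffOn_b0
  · exact Complex.reCLM.contDiff.comp_contDiffOn (S.stationary_w 0).smooth
  · exact Complex.reCLM.contDiff.comp_contDiffOn (S.stationary_w 1).smooth

lemma w_zero_eq (p : Scri) :
    S.w 0 p = -(starRingEnd ℂ (S.cm1 p) + S.cm1 p) / (Real.sqrt 2 : ℂ) := by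
  simp only [w, xi1, Matrix.cons_val_zero, map_div₀, map_one, Complex.conj_ofReal]; ring

lemma w_one_eq (p : Scri) : S.w 1 p = -Complex.I * (starRingEnd ℂ (S.cm1 p) - S.cm1 p) /
    ((Real.sqrt 2 * Real.sin (p 1) : ℝ) : ℂ) := by
  simp only [w, xi1, Matrix.cons_val_one, Matrix.cons_val_fin_one, map_div₀, map_neg,
    Complex.conj_ofReal, Complex.conj_I]; ring

variable (S) in
lemma hasTransportForm_op (s : ℤ) (H : Scri → ℂ) :
    HasTransportForm S.O (S.op s H) S.scriField (S.totalDamping s H) := by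
  intro X p hp hX
  rw [op_eq s H hp hX, fderiv_apply_eq_sum, Fin.sum_univ_three, scriField_zero hp, scriField_one,
    scriField_two]

end KillingSpacetime

/-! ### Integrals depending on parameters -/

section Parametric

open MeasureTheory Set

variable {E F : Type*} [NormedAddCommGroup E] [NormedAddCommGroup F]

lemma exists_closedBall_prod_subset {W : Set (E × ℝ)} (hW : IsOpen W) {q : E}
    (hq : ∀ τ ∈ Icc (0 : ℝ) 1, (q, τ) ∈ W) :
    ∃ ε > 0, Metric.closedBall q ε ×ˢ Icc (0 : ℝ) 1 ⊆ W := by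
  obtain ⟨u, v, hu, -, hqu, hv, huv⟩ := generalized_tube_lemma (isCompact_singleton (x := q))
    (isCompact_Icc (a := (0 : ℝ)) (b := 1)) hW (by rintro ⟨a, τ⟩ ⟨rfl, h⟩; exact hq τ h)
  obtain ⟨ε, hε, h⟩ := Metric.nhds_basis_closedBall.mem_iff.mp (hu.mem_nhds (hqu rfl))
  exact ⟨ε, hε, (prod_mono h hv).trans huv⟩

lemma exists_bound [ProperSpace E] {W : Set (E × ℝ)} {h : E × ℝ → F} (hc : ContinuousOn h W) {q : E} {ε : ℝ}
    (hε : Metric.closedBall q ε ×ˢ Icc (0 : ℝ) 1 ⊆ W) :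
    ∃ C, ∀ x ∈ Metric.closedBall q ε, ∀ τ ∈ Icc (0 : ℝ) 1, ‖h (x, τ)‖ ≤ C := by
  obtain ⟨C, hC⟩ := ((isCompact_closedBall q ε).prod isCompact_Icc).exists_bound_of_continuousOn
    (hc.mono hε)
  exact ⟨C, fun x hx τ hτ => hC (x, τ) ⟨hx, hτ⟩⟩

lemma continuousOn_slice {W : Set (E × ℝ)} {h : E × ℝ → F} (hc : ContinuousOn h W) {q : E}
    (hq : ∀ τ ∈ Icc (0 : ℝ) 1, (q, τ) ∈ W) : ContinuousOn (fun τ => h (q, τ)) (Icc 0 1) :=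
  hc.comp (by fun_prop) hq

lemma aestronglyMeasurable_slice {W : Set (E × ℝ)} {h : E × ℝ → F} (hc : ContinuousOn h W) {q : E}
    (hq : ∀ τ ∈ Icc (0 : ℝ) 1, (q, τ) ∈ W) :
    AEStronglyMeasurable (fun τ => h (q, τ)) (volume.restrict (uIoc (0 : ℝ) 1)) := by
  rw [uIoc_of_le zero_le_one]
  exact ((continuousOn_slice hc hq).mono Ioc_subset_Icc_self).aestronglyMeasurable measurableSet_Ioc

variable [NormedSpace ℝ E] [ProperSpace E] [NormedSpace ℝ F]

omit [NormedSpace ℝ E] in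
lemma continuousAt_integral {W : Set (E × ℝ)} (hW : IsOpen W) {h : E × ℝ → F}
    (hc : ContinuousOn h W) {q : E} (hq : ∀ τ ∈ Icc (0 : ℝ) 1, (q, τ) ∈ W) :
    ContinuousAt (fun x => ∫ τ in (0 : ℝ)..1, h (x, τ)) q := by
  obtain ⟨ε, hε, hsub⟩ := exists_closedBall_prod_subset hW hq
  obtain ⟨C, hC⟩ := exists_bound hc hsub
  refine intervalIntegral.continuousAt_of_dominated_interval (bound := fun _ => C) ?_ ?_
    intervalIntegrable_const ?_
  · filter_upwards [Metric.closedBall_mem_nhds q hε] with x hx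
    exact aestronglyMeasurable_slice hc fun τ hτ => hsub ⟨hx, hτ⟩
  · filter_upwards [Metric.closedBall_mem_nhds q hε] with x hx
    refine .of_forall fun τ hτ => hC x hx τ ?_
    rw [uIoc_of_le zero_le_one] at hτ
    exact Ioc_subset_Icc_self hτ
  · refine .of_forall fun τ hτ => ?_
    rw [uIoc_of_le zero_le_one] at hτ
    have h1 : ContinuousAt h (q, τ) := hc.continuousAt (hW.mem_nhds (hq τ (Ioc_subset_Icc_self hτ)))
    exact ContinuousAt.comp (f := fun x : E => (x, τ)) h1 (by fun_prop)

/-- Differentiation under the integral sign. The dominating constant is a bound for the derivative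
on the compact set formed by a small closed ball and `[0, 1]`. -/
lemma contDiffOn_integral {W : Set (E × ℝ)} (hW : IsOpen W) {g : E × ℝ → F}
    (hg : ContDiffOn ℝ 1 g W) {U : Set E} (hU : IsOpen U)
    (hUW : ∀ q ∈ U, ∀ τ ∈ Icc (0 : ℝ) 1, (q, τ) ∈ W) :
    ContDiffOn ℝ 1 (fun x => ∫ τ in (0 : ℝ)..1, g (x, τ)) U := by
  set A : E × ℝ → E →L[ℝ] F := fun z => (fderiv ℝ g z).comp (ContinuousLinearMap.inl ℝ E ℝ)
  have hA : ContinuousOn A W :=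
    (hg.continuousOn_fderiv_of_isOpen hW le_rfl).clm_comp continuousOn_const
  have hd : ∀ q ∈ U, HasFDerivAt (fun x => ∫ τ in (0 : ℝ)..1, g (x, τ))
      (∫ τ in (0 : ℝ)..1, A (q, τ)) q := by
    intro q hq
    obtain ⟨ε, hε, hsub⟩ := exists_closedBall_prod_subset hW (hUW q hq)
    obtain ⟨C, hC⟩ := exists_bound hA hsub
    refine intervalIntegral.hasFDerivAt_integral_of_dominated_of_fderiv_le (F := fun x τ => g (x, τ))
      (F' := fun x τ => A (x, τ)) (bound := fun _ => C) (Metric.closedBall_mem_nhds q hε)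
      ?_ ?_ (aestronglyMeasurable_slice hA (hUW q hq)) ?_ intervalIntegrable_const ?_
    · filter_upwards [Metric.closedBall_mem_nhds q hε] with x hx
      exact aestronglyMeasurable_slice hg.continuousOn fun τ hτ => hsub ⟨hx, hτ⟩
    · refine ContinuousOn.intervalIntegrable ?_
      rw [uIcc_of_le zero_le_one]
      exact continuousOn_slice hg.continuousOn (hUW q hq)
    · refine .of_forall fun τ hτ x hx => hC x hx τ ?_
      rw [uIoc_of_le zero_le_one] at hτ
      exact Ioc_subset_Icc_self hτ
    · refine .of_forall fun τ hτ x hx => ?_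
      rw [uIoc_of_le zero_le_one] at hτ
      have hm : (x, τ) ∈ W := hsub ⟨hx, Ioc_subset_Icc_self hτ⟩
      have h1 : HasFDerivAt g (fderiv ℝ g (x, τ)) (x, τ) :=
        ((hg.contDiffAt (hW.mem_nhds hm)).differentiableAt (by simp)).hasFDerivAt
      exact h1.comp x (hasFDerivAt_prodMk_left x τ)
  rw [← zero_add (1 : WithTop ℕ∞), contDiffOn_succ_iff_fderiv_of_isOpen hU, contDiffOn_zero]
  refine ⟨fun q hq => (hd q hq).differentiableAt.differentiableWithinAt, by simp, ?_⟩
  refine ContinuousOn.congr (f := fun q => ∫ τ in (0 : ℝ)..1, A (q, τ)) ?_ fun q hq => (hd q hq).fderiv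
  exact fun q hq => (continuousAt_integral hW hA (hUW q hq)).continuousWithinAt

end Parametric

end

/-! ### The method of characteristics -/

section

open Filter Set

section Primitive

variable {D : Set (ℝ × (Fin 2 → ℝ))} {G : ℝ × (Fin 2 → ℝ) → ℂ}

/-- The substitution `s = tτ` fixes the endpoints at `0` and `1`, so that the variable upper limit
becomes a parameter. The segment condition keeps the rescaled points in `D`. -/
lemma contDiffOn_primitive (hD : IsOpen D) (hseg : ∀ t y, (t, y) ∈ D → ∀ s ∈ uIcc 0 t, (s, y) ∈ D)
    (hG : ContDiffOn ℝ 1 G D) :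
    ContDiffOn ℝ 1 (fun q => ∫ s in (0 : ℝ)..q.1, G (s, q.2)) D := by
  have hc : ContDiff ℝ 1 (fun z : (ℝ × (Fin 2 → ℝ)) × ℝ => (z.1.1 * z.2, z.1.2)) := by fun_prop
  have h := contDiffOn_integral (hD.preimage hc.continuous)
    (hG.comp hc.contDiffOn fun z hz => hz) hD fun q hq τ hτ => hseg q.1 q.2 hq _ ?_
  · refine (contDiff_fst.contDiffOn.smul h).congr fun q hq => ?_
    have := intervalIntegral.smul_integral_comp_mul_left (a := 0) (b := 1)
      (fun s => G (s, q.2)) q.1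
    rw [mul_zero, mul_one] at this
    exact this.symm
  · rcases le_total 0 q.1 with h0 | h0
    · rw [uIcc_of_le h0]
      exact ⟨mul_nonneg h0 hτ.1, mul_le_of_le_one_right h0 hτ.2⟩
    · rw [uIcc_of_ge h0]
      exact ⟨by nlinarith [hτ.1, hτ.2], mul_nonpos_of_nonpos_of_nonneg h0 hτ.1⟩

lemma hasDerivAt_primitive (hD : IsOpen D)
    (hseg : ∀ t y, (t, y) ∈ D → ∀ s ∈ uIcc 0 t, (s, y) ∈ D) (hG : ContinuousOn G D) {t : ℝ}
    {y : Fin 2 → ℝ} (h : (t, y) ∈ D) :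
    HasDerivAt (fun t => ∫ s in (0 : ℝ)..t, G (s, y)) (G (t, y)) t := by
  have hJ : IsOpen {s | (s, y) ∈ D} := hD.preimage (by fun_prop)
  have hc : ContinuousOn (fun s => G (s, y)) {s | (s, y) ∈ D} :=
    hG.comp (by fun_prop) fun s hs => hs
  refine intervalIntegral.integral_hasDerivAt_right ((hc.mono (hseg t y h)).intervalIntegrable)
    (hc.stronglyMeasurableAtFilter hJ t h) (hc.continuousAt (hJ.mem_nhds h))

end Primitive

namespace IsCharacteristicMap

variable {O : Set Scri} {L : (Scri → ℂ) → Scri → ℂ} {u₀ : ℝ} {D : Set (ℝ × (Fin 2 → ℝ))}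
  {Φ : ℝ × (Fin 2 → ℝ) → Scri} {v : Scri → Scri} {F Q : Scri → ℂ} {f : (Fin 2 → ℝ) → ℂ}
  {t : ℝ} {y : Fin 2 → ℝ}

section

variable (hΦ : IsCharacteristicMap O L u₀ D Φ)

include hΦ

lemma zero_mem (h : (t, y) ∈ D) : (0, y) ∈ D := hΦ.segment t y h 0 left_mem_uIcc

lemma isOpen_slice (y : Fin 2 → ℝ) : IsOpen {t | (t, y) ∈ D} := hΦ.isOpen.preimage (by fun_prop)

lemma mapsTo : MapsTo Φ D O := fun ⟨t, y⟩ h =>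
  let ⟨_, _, _, ho⟩ := hΦ.characteristic y
  (ho.2 t h).1

lemma contDiffAt {q : ℝ × (Fin 2 → ℝ)} (h : q ∈ D) : ContDiffAt ℝ 1 Φ q :=
  hΦ.contDiffOn.contDiffAt (hΦ.isOpen.mem_nhds h)

/-- The differential, as an isomorphism. -/
def diffEquiv {q : ℝ × (Fin 2 → ℝ)} (h : q ∈ D) : (ℝ × (Fin 2 → ℝ)) ≃L[ℝ] Scri :=
  (LinearEquiv.ofBijective (fderiv ℝ Φ q : (ℝ × (Fin 2 → ℝ)) →ₗ[ℝ] Scri)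
    (hΦ.jacobian q h)).toContinuousLinearEquiv

lemma hasStrictFDerivAt {q : ℝ × (Fin 2 → ℝ)} (h : q ∈ D) :
    HasStrictFDerivAt Φ (hΦ.diffEquiv h : (ℝ × (Fin 2 → ℝ)) →L[ℝ] Scri) q := by
  have := (hΦ.contDiffAt h).hasStrictFDerivAt (by simp)
  convert! this using 1

lemma image_mem_nhds {q : ℝ × (Fin 2 → ℝ)} (h : q ∈ D) {U : Set (ℝ × (Fin 2 → ℝ))}
    (hU : U ∈ 𝓝 q) : Φ '' U ∈ 𝓝 (Φ q) := by
  rw [← (hΦ.hasStrictFDerivAt h).map_nhds_eq_of_equiv]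
  exact image_mem_map hU

lemma isOpen_image {U : Set (ℝ × (Fin 2 → ℝ))} (hU : IsOpen U) (hUD : U ⊆ D) : IsOpen (Φ '' U) := by
  rw [isOpen_iff_mem_nhds]
  rintro _ ⟨q, hq, rfl⟩
  exact hΦ.image_mem_nhds (hUD hq) (hU.mem_nhds hq)

/-- The characteristic coordinates, as a homeomorphism. -/
def homeo : OpenPartialHomeomorph (ℝ × (Fin 2 → ℝ)) Scri :=
  .ofContinuousOpenRestrict (hΦ.injOn.toPartialEquiv Φ D) hΦ.contDiffOn.continuousOn
    (by
      intro V hV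
      obtain ⟨U, hU, rfl⟩ := isOpen_induced_iff.mp hV
      have : D.domRestrict Φ '' (Subtype.val ⁻¹' U) = Φ '' (D ∩ U) := by
        ext p; constructor
        · rintro ⟨q, hq, rfl⟩; exact ⟨q, ⟨q.2, hq⟩, rfl⟩
        · rintro ⟨q, hq, rfl⟩; exact ⟨⟨q, hq.1⟩, hq.2, rfl⟩
      have h2 := hΦ.isOpen_image (hΦ.isOpen.inter hU) inter_subset_left
      rw [← this] at h2
      exact h2)
    hΦ.isOpen

lemma homeo_symm_apply {q : ℝ × (Fin 2 → ℝ)} (h : q ∈ D) : hΦ.homeo.symm (Φ q) = q :=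
  hΦ.homeo.left_inv h

lemma contDiffOn_symm : ContDiffOn ℝ 1 hΦ.homeo.symm (Φ '' D) := by
  rintro _ ⟨q, hq, rfl⟩
  have hs : hΦ.homeo.symm (hΦ.homeo q) = q := hΦ.homeo_symm_apply hq
  refine (hΦ.homeo.contDiffAt_symm (f₀' := hΦ.diffEquiv hq) (hΦ.homeo.map_source hq) ?_
    ?_).contDiffWithinAt
  · rw [hs]; exact (hΦ.hasStrictFDerivAt hq).hasFDerivAt
  · rw [hs]; exact hΦ.contDiffAt hq

variable (hL : HasTransportForm O L v F)

include hL

lemma hasDerivAt (h : (t, y) ∈ D) : HasDerivAt (fun t => Φ (t, y)) (v (Φ (t, y))) t :=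
  ((((hL.isCharacteristic_iff _ _).mp (hΦ.characteristic y)).2 t h).2).hasDerivAt
    ((hΦ.isOpen_slice y).mem_nhds h)

lemma isPreconnected_slice (y : Fin 2 → ℝ) : IsPreconnected {t | (t, y) ∈ D} :=
  ((hL.isCharacteristic_iff _ _).mp (hΦ.characteristic y)).1.isPreconnected

/-- Along a characteristic, `L` is an ordinary differential operator. -/
lemma hasDerivAt_comp (h : (t, y) ∈ D) {X : Scri → ℂ} (hX : DifferentiableAt ℝ X (Φ (t, y))) :
    HasDerivAt (fun t => X (Φ (t, y)))
      (L X (Φ (t, y)) - F (Φ (t, y)) * X (Φ (t, y))) t := by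
  rw [hL X _ (hΦ.mapsTo h) hX, add_sub_cancel_right]
  exact hX.hasFDerivAt.comp_hasDerivAt t (hΦ.hasDerivAt hL h)

lemma op_eq_of_hasDerivAt (h : (t, y) ∈ D) {X : Scri → ℂ}
    (hX : DifferentiableAt ℝ X (Φ (t, y))) {g : ℝ → ℂ} {g' : ℂ}
    (hg : ∀ s, (s, y) ∈ D → X (Φ (s, y)) = g s) (hg' : HasDerivAt g g' t) :
    L X (Φ (t, y)) = g' + F (Φ (t, y)) * X (Φ (t, y)) := by
  have h1 : HasDerivAt (fun t => X (Φ (t, y))) g' t := hg'.congr_of_eventuallyEq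
    (((hΦ.isOpen_slice y).eventually_mem h).mono fun s hs => hg s hs)
  rw [h1.unique (hΦ.hasDerivAt_comp hL h hX), sub_add_cancel]

variable (hF : ContDiffOn ℝ 1 F O)

include hF

omit hL in
lemma contDiffOn_comp : ContDiffOn ℝ 1 (fun q => F (Φ q)) D :=
  hF.comp hΦ.contDiffOn hΦ.mapsTo

omit hL in
lemma contDiffOn_homogeneousPart (hf : ContDiffOn ℝ 1 f {y | (0, y) ∈ D}) :
    ContDiffOn ℝ 1 (fun q => homogeneousPart F f Φ q.1 q.2) D :=
  (hf.comp contDiffOn_snd fun _ h => hΦ.zero_mem h).mul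
    (contDiffOn_primitive hΦ.isOpen hΦ.segment (hΦ.contDiffOn_comp hF)).neg.cexp

omit hL in
lemma contDiffOn_integrand (hQ : ContDiffOn ℝ 1 Q O) : ContDiffOn ℝ 1
    (fun q => Q (Φ q) * Complex.exp (∫ s in (0 : ℝ)..q.1, F (Φ (s, q.2)))) D :=
  (hΦ.contDiffOn_comp hQ).mul
    (contDiffOn_primitive hΦ.isOpen hΦ.segment (hΦ.contDiffOn_comp hF)).cexp

omit hL in
lemma contDiffOn_sourcePart (hQ : ContDiffOn ℝ 1 Q O) :
    ContDiffOn ℝ 1 (fun q => sourcePart F Q Φ q.1 q.2) D :=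
  (contDiffOn_primitive hΦ.isOpen hΦ.segment (hΦ.contDiffOn_comp hF)).neg.cexp.mul
    (contDiffOn_primitive hΦ.isOpen hΦ.segment (hΦ.contDiffOn_integrand hF hQ))

omit hL in
lemma hasDerivAt_exponent (h : (t, y) ∈ D) :
    HasDerivAt (fun t => ∫ s in (0 : ℝ)..t, F (Φ (s, y))) (F (Φ (t, y))) t :=
  hasDerivAt_primitive hΦ.isOpen hΦ.segment (hΦ.contDiffOn_comp hF).continuousOn h

omit hL in
lemma hasDerivAt_homogeneousPart (h : (t, y) ∈ D) :
    HasDerivAt (fun t => homogeneousPart F f Φ t y)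
      (-F (Φ (t, y)) * homogeneousPart F f Φ t y) t := by
  convert! ((hΦ.hasDerivAt_exponent hF h).neg.cexp.const_mul (f y)) using 1
  rw [homogeneousPart]; simp; ring

omit hL in
lemma hasDerivAt_sourcePart (hQ : ContDiffOn ℝ 1 Q O) (h : (t, y) ∈ D) :
    HasDerivAt (fun t => sourcePart F Q Φ t y)
      (Q (Φ (t, y)) - F (Φ (t, y)) * sourcePart F Q Φ t y) t := by
  have h1 := hasDerivAt_primitive hΦ.isOpen hΦ.segment
    (hΦ.contDiffOn_integrand hF hQ).continuousOn h
  convert! (hΦ.hasDerivAt_exponent hF h).neg.cexp.mul h1 using 1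
  have h2 : Complex.exp (-∫ s in (0 : ℝ)..t, F (Φ (s, y))) *
      Complex.exp (∫ s in (0 : ℝ)..t, F (Φ (s, y))) = 1 := by
    rw [← Complex.exp_add, neg_add_cancel, Complex.exp_zero]
  rw [sourcePart]
  simp only [Pi.neg_apply]
  linear_combination -Q (Φ (t, y)) * h2

/-- A solution is determined by its values on the initial cut. -/
lemma eq_zero_of_hasDerivAt {z : ℝ → ℂ}
    (hz : ∀ s, (s, y) ∈ D → HasDerivAt z (-F (Φ (s, y)) * z s) s) (h0 : z 0 = 0)
    (h : (t, y) ∈ D) : z t = 0 := by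
  -- With the integrating factor `e^{∫F}` the function has zero derivative. It is constant on the
  -- whole slice because the domain of a characteristic is an interval.
  have hd : ∀ s ∈ {s | (s, y) ∈ D},
      HasDerivAt (fun s => z s * Complex.exp (∫ s in (0 : ℝ)..s, F (Φ (s, y)))) 0 s := by
    intro s hs
    convert! (hz s hs).mul (hΦ.hasDerivAt_exponent hF hs).cexp using 1
    ring
  have := (hΦ.isOpen_slice y).is_const_of_deriv_eq_zero (hΦ.isPreconnected_slice hL y)
    (fun s hs => (hd s hs).differentiableAt.differentiableWithinAt)
    (fun s hs => (hd s hs).deriv) h (hΦ.zero_mem h)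
  simpa [h0, Complex.exp_ne_zero] using this

/-- The splitting of the solution of the transport equation. -/
theorem exists_splitting (hQ : ContDiffOn ℝ 1 Q O) (hf : ContDiffOn ℝ 1 f {y | (0, y) ∈ D}) :
    IsOpen (Φ '' D) ∧
    ∃ Xh Xp : Scri → ℂ,
      ContDiffOn ℝ 1 Xh (Φ '' D) ∧ ContDiffOn ℝ 1 Xp (Φ '' D) ∧
      (∀ t y, (t, y) ∈ D →
        Xh (Φ (t, y)) = homogeneousPart F f Φ t y ∧ Xp (Φ (t, y)) = sourcePart F Q Φ t y) ∧
      (∀ p ∈ Φ '' D, L Xh p = 0 ∧ L Xp p = Q p) ∧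
      (∀ y, (0, y) ∈ D → Xh (cut u₀ y) = f y ∧ Xp (cut u₀ y) = 0) ∧
      ∀ X : Scri → ℂ, DifferentiableOn ℝ X (Φ '' D) →
        (((∀ p ∈ Φ '' D, L X p = Q p) ∧ ∀ y, (0, y) ∈ D → X (cut u₀ y) = f y) ↔
          ∀ p ∈ Φ '' D, X p = Xh p + Xp p) := by
  have hopen : IsOpen (Φ '' D) := hΦ.isOpen_image hΦ.isOpen subset_rfl
  have hsymm : MapsTo hΦ.homeo.symm (Φ '' D) D := by
    rintro _ ⟨q, hq, rfl⟩; rwa [hΦ.homeo_symm_apply hq]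
  set Xh : Scri → ℂ := fun p => homogeneousPart F f Φ (hΦ.homeo.symm p).1 (hΦ.homeo.symm p).2
  set Xp : Scri → ℂ := fun p => sourcePart F Q Φ (hΦ.homeo.symm p).1 (hΦ.homeo.symm p).2
  have eh : ∀ t y, (t, y) ∈ D → Xh (Φ (t, y)) = homogeneousPart F f Φ t y := fun t y h => by
    simp only [Xh, hΦ.homeo_symm_apply h]
  have ep : ∀ t y, (t, y) ∈ D → Xp (Φ (t, y)) = sourcePart F Q Φ t y := fun t y h => by
    simp only [Xp, hΦ.homeo_symm_apply h]
  have ch : ContDiffOn ℝ 1 Xh (Φ '' D) :=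
    (hΦ.contDiffOn_homogeneousPart hF hf).comp hΦ.contDiffOn_symm hsymm
  have cp : ContDiffOn ℝ 1 Xp (Φ '' D) :=
    (hΦ.contDiffOn_sourcePart hF hQ).comp hΦ.contDiffOn_symm hsymm
  have dh : ∀ p ∈ Φ '' D, DifferentiableAt ℝ Xh p := fun p hp =>
    (ch.contDiffAt (hopen.mem_nhds hp)).differentiableAt (by simp)
  have dp : ∀ p ∈ Φ '' D, DifferentiableAt ℝ Xp p := fun p hp =>
    (cp.contDiffAt (hopen.mem_nhds hp)).differentiableAt (by simp)
  have lh : ∀ p ∈ Φ '' D, L Xh p = 0 := by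
    rintro _ ⟨⟨t, y⟩, h, rfl⟩
    rw [hΦ.op_eq_of_hasDerivAt hL h (dh _ ⟨_, h, rfl⟩) (fun s hs => eh s y hs)
      (hΦ.hasDerivAt_homogeneousPart hF h), eh t y h]
    ring
  have lp : ∀ p ∈ Φ '' D, L Xp p = Q p := by
    rintro _ ⟨⟨t, y⟩, h, rfl⟩
    rw [hΦ.op_eq_of_hasDerivAt hL h (dp _ ⟨_, h, rfl⟩) (fun s hs => ep s y hs)
      (hΦ.hasDerivAt_sourcePart hF hQ h), ep t y h]
    ring
  have ih : ∀ y, (0, y) ∈ D → Xh (cut u₀ y) = f y := fun y h => by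
    rw [← hΦ.init y h, eh 0 y h]; simp [homogeneousPart]
  have ip : ∀ y, (0, y) ∈ D → Xp (cut u₀ y) = 0 := fun y h => by
    rw [← hΦ.init y h, ep 0 y h]; simp [sourcePart]
  refine ⟨hopen, Xh, Xp, ch, cp, fun t y h => ⟨eh t y h, ep t y h⟩,
    fun p hp => ⟨lh p hp, lp p hp⟩, fun y h => ⟨ih y h, ip y h⟩, fun X hX => ⟨?_, fun h => ⟨?_, ?_⟩⟩⟩
  · rintro ⟨hLX, hX0⟩ _ ⟨⟨t, y⟩, h, rfl⟩
    have hm : ∀ s, (s, y) ∈ D → Φ (s, y) ∈ Φ '' D := fun s hs => ⟨_, hs, rfl⟩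
    -- Along each characteristic the difference between `X` and `Xh + Xp` solves the homogeneous
    -- equation with zero initial value.
    have := hΦ.eq_zero_of_hasDerivAt hL hF (t := t)
      (z := fun s => X (Φ (s, y)) - (Xh (Φ (s, y)) + Xp (Φ (s, y)))) (fun s hs => ?_) ?_ h
    · exact sub_eq_zero.mp this
    · have d1 := hΦ.hasDerivAt_comp hL hs (hX.differentiableAt (hopen.mem_nhds (hm s hs)))
      have d2 := hΦ.hasDerivAt_comp hL hs (dh _ (hm s hs))
      have d3 := hΦ.hasDerivAt_comp hL hs (dp _ (hm s hs))
      convert! d1.sub (d2.add d3) using 1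
      rw [hLX _ (hm s hs), lh _ (hm s hs), lp _ (hm s hs)]
      ring
    · have h0 := hΦ.zero_mem h
      simp only [hΦ.init y h0, hX0 y h0, ih y h0, ip y h0]
      ring
  · intro p hp
    have hO : p ∈ O := by obtain ⟨q, hq, rfl⟩ := hp; exact hΦ.mapsTo hq
    have he : X =ᶠ[𝓝 p] Xh + Xp := (hopen.eventually_mem hp).mono fun q hq => h q hq
    rw [hL X p hO (hX.differentiableAt (hopen.mem_nhds hp)), he.fderiv_eq,
      fderiv_add (dh p hp) (dp p hp), h p hp]
    have h1 := lh p hp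
    have h2 := lp p hp
    rw [hL _ p hO (dh p hp)] at h1
    rw [hL _ p hO (dp p hp)] at h2
    rw [add_apply]
    linear_combination h1 + h2
  · intro y h0
    rw [h _ ⟨_, h0, hΦ.init y h0⟩, ih y h0, ip y h0, add_zero]

end

end IsCharacteristicMap

end

end

end AFKilling

open AFKilling

theorem mainTheorem6 :
    -- the sources: fixed expressions in the coefficients calculated at previous orders
    ∃ source : Constraint → PrevData → Scri → ℂ, ∀ S : KillingSpacetime,
      -- the constraint equations have the generic form
      (∀ κ : Constraint,
        ContDiffOn ℝ ∞ (S.quantity κ) S.O ∧ ContDiffOn ℝ ∞ (S.damping κ) S.O ∧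
        ContDiffOn ℝ ∞ (source κ (S.prev κ)) S.O ∧
        ∀ p ∈ S.O, S.op κ.spin (S.damping κ) (S.quantity κ) p = source κ (S.prev κ) p) ∧
      -- the restriction of the Killing field to null infinity
      ∃ v : Scri → Scri, S.IsRestriction v ∧ ContDiffOn ℝ ∞ v S.O ∧
        (∀ p ∈ S.O,
          (v p 0 : ℂ) = S.b0 p ∧
          (v p 1 : ℂ) = -(starRingEnd ℂ (S.cm1 p) + S.cm1 p) / (Real.sqrt 2 : ℂ) ∧
          (v p 2 : ℂ) = -Complex.I * (starRingEnd ℂ (S.cm1 p) - S.cm1 p) /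
            ((Real.sqrt 2 * Real.sin (p 1) : ℝ) : ℂ) ∧
          pd 0 S.b0 p = -S.am1 p ∧ pd 0 S.am1 p = 0 ∧ pd 0 S.cm1 p = 0) ∧
        ∀ (s : ℤ) (H : Scri → ℂ),
          -- the equation in partial derivatives; its characteristics are exactly the orbits
          HasTransportForm S.O (S.op s H) v (S.totalDamping s H) ∧
          (∀ (γ : ℝ → Scri) (J : Set ℝ),
            IsCharacteristic S.O (S.op s H) γ J ↔ IsOrbit S.O v γ J) ∧
          -- the splitting of the solution
          ∀ (Q : Scri → ℂ) (u₀ : ℝ) (D : Set (ℝ × (Fin 2 → ℝ))) (Φ : ℝ × (Fin 2 → ℝ) → Scri)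
            (f : (Fin 2 → ℝ) → ℂ),
            ContDiffOn ℝ 1 H S.O → ContDiffOn ℝ 1 Q S.O →
            IsCharacteristicMap S.O (S.op s H) u₀ D Φ →
            ContDiffOn ℝ 1 f {y | (0, y) ∈ D} →
            IsOpen (Φ '' D) ∧
            ∃ Xh Xp : Scri → ℂ,
              ContDiffOn ℝ 1 Xh (Φ '' D) ∧ ContDiffOn ℝ 1 Xp (Φ '' D) ∧
              (∀ t y, (t, y) ∈ D →
                Xh (Φ (t, y)) = homogeneousPart (S.totalDamping s H) f Φ t y ∧
                Xp (Φ (t, y)) = sourcePart (S.totalDamping s H) Q Φ t y) ∧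
              (∀ p ∈ Φ '' D, S.op s H Xh p = 0 ∧ S.op s H Xp p = Q p) ∧
              (∀ y, (0, y) ∈ D → Xh (cut u₀ y) = f y ∧ Xp (cut u₀ y) = 0) ∧
              ∀ X : Scri → ℂ, DifferentiableOn ℝ X (Φ '' D) →
                (((∀ p ∈ Φ '' D, S.op s H X p = Q p) ∧ ∀ y, (0, y) ∈ D → X (cut u₀ y) = f y) ↔
                  ∀ p ∈ Φ '' D, X p = Xh p + Xp p) := by
  refine ⟨KillingSpacetime.source, fun S => ⟨fun κ => ⟨S.contDiffOn_quantity κ,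
    S.contDiffOn_damping κ, KillingSpacetime.contDiffOn_source κ,
    fun p hp => (KillingSpacetime.source_eq κ hp).symm⟩, S.scriField, S.isRestriction_scriField,
    S.contDiffOn_scriField, fun p hp => ⟨KillingSpacetime.scriField_zero hp,
      KillingSpacetime.scriField_one.trans (KillingSpacetime.w_zero_eq p),
      KillingSpacetime.scriField_two.trans (KillingSpacetime.w_one_eq p), S.pd_zero_b0 hp,
      S.stationary_am1.pd_zero p hp, S.stationary_cm1.pd_zero p hp⟩, fun s H => ?_⟩⟩
  have hL := S.hasTransportForm_op s H
  exact ⟨hL, hL.isCharacteristic_iff, fun Q u₀ D Φ f hH hQ hΦ hf =>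
    hΦ.exists_splitting hL (S.contDiffOn_totalDamping (k := 1) s hH) hQ hf⟩
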